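/- Let $\Omega\subset\mathbb R^3$ be a bounded open set, $T>0$, $Q_T=(0,T)\times\Omega$, and let $\nu_K\ge 0$ with $\nu_K\to0$ as $K\to\infty$. Let $\rho_0,n_0\in L^1(\Omega)$ be nonnegative. For every $K$ let $\rho_K,n_K\in L^\infty(0,T;L^2(\Omega))$ be nonnegative, let $u_K\in L^2(0,T;H^1_0(\Omega;\mathbb R^3))$, and suppose that $\rho_K$ and $n_K$ are weak solutions of $$\partial_t\rho_K+\operatorname{div}(\rho_Ku_K)=\nu_K\Delta\rho_K,\quad \rho_K|_{t=0}=\rho_0,\quad \nu_K\frac{\partial\rho_K}{\partial \mathbf n}\Big|_{\partial\Omega}=0,$$ $$\partial_tn_K+\operatorname{div}(n_Ku_K)=\nu_K\Delta n_K,\quad n_K|_{t=0}=n_0,\quad \nu_K\frac{\partial n_K}{\partial \mathbf n}\Big|_{\partial\Omega}=0 ,$$ that is, for $(f,f_0)=(\rho_K,\rho_0)$ and $(f,f_0)=(n_K,n_0)$: if $\nu_K>0$, then $f(t)$ has a weak gradient $\nabla f(t)$ on $\Omega$ for a.e. $t\in(0,T)$, jointly measurable on $Q_T$; and for all $\varphi\in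 C_c^\infty((-\infty,T)\times\mathbb R^3)$, $$\int_{Q_T}\big(f\,\partial_t\varphi+f\,u_K\cdot\nabla\varphi-\nu_K\nabla f\cdot\nabla\varphi\big)\,dx\,dt+\int_\Omega f_0\,\varphi(0,\cdot)\,dx=0$$ (the last term of the first integral being absent if $\nu_K=0$). Put $d_K=\rho_K+n_K$, $d_0=\rho_0+n_0$. Assume that there is a constant $C_0$ independent of $K$ such that for all $K$ $$\|\rho_K\|_{L^\infty(0,T;L^2(\Omega))}\le C_0,\qquad \|n_K\|_{L^\infty(0,T;L^2(\Omega))}\le C_0,$$ $$\sqrt{\nu_K}\,\|\nabla\rho_K\|_{L^2(Q_T)}\le C_0,\qquad \sqrt{\nu_K}\,\|\nabla n_K\|_{L^2(Q_T)}\le C_0,\qquad \|u_K\|_{L^2(Q_T)}\le C_0,\qquad\|\nabla u_K\|_{L^2(Q_T)}\le C_0$$ (the gradient bounds on $\rho_K,n_K$ being void if $\nu_K=0$), and that, for $(b_K,b_0)=(\rho_K,\rho_0)$ or for $(b_K,b_0)=(n_K,n_0)$ (at least one of the two, the same for all $K$), for all $K$ and a.e. $t\in(0,T)$ $$\int_\Omega\frac{b_K^2}{d_K}(t,x)\,dx\le\int_\Omega\frac{b_0^2}{d_0}(x)\,dx,$$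 where quotients are read as $0$ where the denominator vanishes. Then there are a subsequence (not relabelled), nonnegative $\rho,n\in L^\infty(0,T;L^2(\Omega))$ and $u\in L^2(0,T;H^1_0(\Omega;\mathbb R^3))$ such that $$\rho_K\to\rho,\quad n_K\to n\quad\text{weakly-* in }L^\infty(0,T;L^2(\Omega)),\qquad u_K\to u\quad\text{weakly in }L^2(0,T;H^1_0(\Omega;\mathbb R^3)),$$ and, with $d=\rho+n$, both for $(b_K,b)=(\rho_K,\rho)$ and for $(b_K,b)=(n_K,n)$: for all measurable $a_K,a:Q_T\to\mathbb{R}$ with $0\le a_K,a\le1$, $a_Kd_K=b_K$ and $ad=b$ a.e. in $Q_T$ (so that $a_K=b_K/d_K$ where $d_K\ne0$ and $a=b/d$ where $d\neq0$), and for every $s>1$, $$\lim_{K\to\infty}\int_0^T\!\!\int_\Omega d_K\,|a_K-a|^s\,dx\,dt=0.$$ -/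

import Mathlib

open MeasureTheory Filter Topology Set
open scoped ContDiff

noncomputable section

/-- Three-dimensional Euclidean space. -/
abbrev R3 : Type := EuclideanSpace ℝ (Fin 3)

/-- Lebesgue measure on the time interval `(0,T)`. -/
abbrev timeMeasure (T : ℝ) : Measure ℝ := volume.restrict (Ioo 0 T)

/-- Lebesgue measure on the space-time cylinder `(0,T) × Ω`. -/
abbrev cylMeasure (Ω : Set R3) (T : ℝ) : Measure (ℝ × R3) :=
  volume.restrict (Ioo 0 T ×ˢ Ω)

/-- The norm of `L^∞(0,T;L²(Ω))`. -/
def normLinfL2 (Ω : Set R3) (T : ℝ) (f : ℝ → R3 → ℝ) : ENNReal :=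
  essSup (fun t => eLpNorm (f t) 2 (volume.restrict Ω)) (timeMeasure T)

/-- Membership in `L^∞(0,T;L²(Ω))`. -/
def MemLinfL2 (Ω : Set R3) (T : ℝ) (f : ℝ → R3 → ℝ) : Prop :=
  AEStronglyMeasurable (Function.uncurry f) (cylMeasure Ω T) ∧ normLinfL2 Ω T f < ⊤

/-- Membership in `L¹(0,T;L²(Ω))`, the predual of `L^∞(0,T;L²(Ω))`. -/
def MemL1L2 (Ω : Set R3) (T : ℝ) (ψ : ℝ → R3 → ℝ) : Prop :=
  AEStronglyMeasurable (Function.uncurry ψ) (cylMeasure Ω T) ∧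
    ∫⁻ t, eLpNorm (ψ t) 2 (volume.restrict Ω) ∂(timeMeasure T) < ⊤

/-- `G` is the weak (distributional) gradient of `f` on the open set `Ω`. -/
def HasWeakGradient (Ω : Set R3) (f : R3 → ℝ) (G : R3 → R3) : Prop :=
  LocallyIntegrableOn f Ω ∧ LocallyIntegrableOn G Ω ∧
    ∀ φ : R3 → ℝ, ContDiff ℝ ∞ φ → HasCompactSupport φ → tsupport φ ⊆ Ω →
      ∀ e : R3, ∫ x in Ω, f x * fderiv ℝ φ x e = - ∫ x in Ω, inner ℝ (G x) e * φ x

/-- `v ∈ H¹₀(Ω; ℝ³)` with weak derivative `Dv`: the pair `(v, Dv)` is the `L²` limit of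
`(φ_j, Dφ_j)` for smooth fields `φ_j` with compact support in `Ω`. -/
def IsH10 (Ω : Set R3) (v : R3 → R3) (Dv : R3 → R3 →L[ℝ] R3) : Prop :=
  MemLp v 2 (volume.restrict Ω) ∧ MemLp Dv 2 (volume.restrict Ω) ∧
    ∃ φ : ℕ → R3 → R3,
      (∀ j, ContDiff ℝ ∞ (φ j) ∧ HasCompactSupport (φ j) ∧ tsupport (φ j) ⊆ Ω) ∧
      Tendsto (fun j => eLpNorm (fun x => φ j x - v x) 2 (volume.restrict Ω)) atTop (𝓝 0) ∧
      Tendsto (fun j => eLpNorm (fun x => fderiv ℝ (φ j) x - Dv x) 2 (volume.restrict Ω))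
        atTop (𝓝 0)

/-- `u ∈ L²(0,T;H¹₀(Ω; ℝ³))` with weak spatial derivative `Du`. -/
def MemL2H10 (Ω : Set R3) (T : ℝ) (u : ℝ → R3 → R3) (Du : ℝ → R3 → R3 →L[ℝ] R3) : Prop :=
  MemLp (Function.uncurry u) 2 (cylMeasure Ω T) ∧
    MemLp (Function.uncurry Du) 2 (cylMeasure Ω T) ∧
    ∀ᵐ t ∂(timeMeasure T), IsH10 Ω (u t) (Du t)

/-- `f` is a weak solution on `(0,T) × Ω` of
`∂ₜ f + div (f u) = ν Δ f`, `f(0,·) = f₀`, `ν ∂f/∂n = 0` on the boundary of `Ω`.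

For `ν > 0` the function `f` has the spatial weak gradient `Df`; for `ν = 0` nothing is asked
of `Df`. The test functions are smooth with compact support in `(-∞,T) × ℝ³`: they need not
vanish at `t = 0`, which encodes the initial condition, nor on the boundary of `Ω`, which
encodes the zero-flux boundary condition. Here `fderiv ℝ φ z (1, v) = ∂ₜφ + v · ∇φ` and
`fderiv ℝ φ z (0, v) = v · ∇φ`. -/
def IsWeakSolution (Ω : Set R3) (T ν : ℝ) (u : ℝ → R3 → R3) (f₀ : R3 → ℝ)
    (f : ℝ → R3 → ℝ) (Df : ℝ → R3 → R3) : Prop :=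
  (0 < ν → AEStronglyMeasurable (Function.uncurry Df) (cylMeasure Ω T) ∧
    ∀ᵐ t ∂(timeMeasure T), HasWeakGradient Ω (f t) (Df t)) ∧
  ∀ φ : ℝ × R3 → ℝ, ContDiff ℝ ∞ φ → HasCompactSupport φ → tsupport φ ⊆ Iio T ×ˢ univ →
    (∫ z, (f z.1 z.2 * fderiv ℝ φ z (1, u z.1 z.2)
        - ν * fderiv ℝ φ z (0, Df z.1 z.2)) ∂(cylMeasure Ω T))
      + ∫ x in Ω, f₀ x * φ (0, x) = 0

/-- `∫_Ω b²/d dx` at almost every time in `(0,T)` is at most its initial value. The quotients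
are read as `0` where the denominator vanishes. -/
def QuotientBound (Ω : Set R3) (T : ℝ) (b d : ℝ → R3 → ℝ) (b₀ d₀ : R3 → ℝ) : Prop :=
  ∀ᵐ t ∂(timeMeasure T), ∫ x in Ω, b t x ^ 2 / d t x ≤ ∫ x in Ω, b₀ x ^ 2 / d₀ x

/-- Weak-* convergence in `L^∞(0,T;L²(Ω))`. -/
def TendstoWeakStar (Ω : Set R3) (T : ℝ) (f : ℕ → ℝ → R3 → ℝ) (g : ℝ → R3 → ℝ) : Prop :=
  ∀ ψ : ℝ → R3 → ℝ, MemL1L2 Ω T ψ →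
    Tendsto (fun K => ∫ z, f K z.1 z.2 * ψ z.1 z.2 ∂(cylMeasure Ω T)) atTop
      (𝓝 (∫ z, g z.1 z.2 * ψ z.1 z.2 ∂(cylMeasure Ω T)))

/-- Weak convergence in `L²((0,T) × Ω; ℝ³)`. -/
def TendstoWeakL2 (Ω : Set R3) (T : ℝ) (v : ℕ → ℝ → R3 → R3) (w : ℝ → R3 → R3) : Prop :=
  ∀ ψ : ℝ × R3 → R3, MemLp ψ 2 (cylMeasure Ω T) →
    Tendsto (fun K => ∫ z, inner ℝ (v K z.1 z.2) (ψ z) ∂(cylMeasure Ω T)) atTop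
      (𝓝 (∫ z, inner ℝ (w z.1 z.2) (ψ z) ∂(cylMeasure Ω T)))

/-- Weak convergence in `L²(0,T;H¹₀(Ω; ℝ³))`: the fields and all their first-order partial
derivatives converge weakly in `L²`. -/
def TendstoWeakL2H10 (Ω : Set R3) (T : ℝ) (u : ℕ → ℝ → R3 → R3)
    (Du : ℕ → ℝ → R3 → R3 →L[ℝ] R3) (v : ℝ → R3 → R3) (Dv : ℝ → R3 → R3 →L[ℝ] R3) : Prop :=
  TendstoWeakL2 Ω T u v ∧
    ∀ e : R3, TendstoWeakL2 Ω T (fun K t x => Du K t x e) (fun t x => Dv t x e)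

/-- `a` is a version of the fraction `b/d`: a measurable function with values in `[0,1]` and
`a d = b` almost everywhere (so `a = b/d` where `d ≠ 0`). -/
def IsFraction (Ω : Set R3) (T : ℝ) (b d a : ℝ → R3 → ℝ) : Prop :=
  AEStronglyMeasurable (Function.uncurry a) (cylMeasure Ω T) ∧
    ∀ᵐ z ∂(cylMeasure Ω T),
      0 ≤ a z.1 z.2 ∧ a z.1 z.2 ≤ 1 ∧ a z.1 z.2 * d z.1 z.2 = b z.1 z.2

/-- For all versions `a_K` of `b_K/d_K` and `a` of `b/d` and every `s > 1`,
`∫₀ᵀ∫_Ω d_K |a_K - a|^s dx dt → 0`. -/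
def FractionsConverge (Ω : Set R3) (T : ℝ) (bK dK : ℕ → ℝ → R3 → ℝ) (b d : ℝ → R3 → ℝ) : Prop :=
  ∀ (aK : ℕ → ℝ → R3 → ℝ) (a : ℝ → R3 → ℝ),
    (∀ K, IsFraction Ω T (bK K) (dK K) (aK K)) → IsFraction Ω T b d a →
    ∀ s : ℝ, 1 < s →
      Tendsto (fun K => ∫ z, dK K z.1 z.2 * |aK K z.1 z.2 - a z.1 z.2| ^ s ∂(cylMeasure Ω T))
        atTop (𝓝 0)

end

/-! With `b = a d` one has `b²/d = a b = d a²`, hence `∫ d_K (a_K - a)² = ∫ b_K²/d_K - 2 ∫ b_K a + ∫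
d_K a²`. The last two integrals are linear in `(b_K, d_K)` with fixed bounded coefficients, so weak
convergence suffices for them, and together they tend to `-∫ b²/d`. The first one is nonlinear, but
the quotient hypothesis bounds it by `T ∫ b₀²/d₀`. Everything therefore rests on the reverse
inequality for the limit, `T ∫_Ω b₀²/d₀ ≤ ∫_{Q_T} b²/d`, which says that the limit loses none of
this quantity (`tendsto_integral_mul_sq_sub`, `TransportData.quotient_bound`).

The limit solves the transport equation without viscosity. The viscous flux is `√ν · √ν ∇f` and
tends to zero in `L²`. In the convective flux both factors converge only weakly. The equation makes
`∫ f_K w`, for fixed smooth `w`, equi-Hölder of exponent `1/2` in time, so it converges at almost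
every time (`ae_tendsto_of_equicontinuous`) and spatial mollifications of `f_K` converge strongly.
The gradient bound keeps `u_K` uniformly close in `L²` to its mollifications. As mollification is
self-adjoint, it can be moved from one factor to the other, and the product passes to the limit
(`tendsto_integral_mul_of_compact_time_space`, `IsFluxSolution.of_weaklyTendsto`).

For the transport equation the reverse inequality is DiPerna–Lions renormalization with the function
`b²/(d+δ)`. The equations are mollified at scale `ε`; at each point of space the mollified densities
are absolutely continuous in time and the chain rule applies. Up to `δ` the function is homogeneous
of degree one, so the transport terms form a divergence, whose integral vanishes because the
velocity lies in `H¹₀`. What remains are commutators, which vanish in `L¹` as `ε → 0`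
(`tendsto_lintegral_dpComm`), and a term of size `δ |Du|`. The limits `ε → 0` and then `δ → 0` give
the claim. The time weight `T - t` produces the inequality integrated in time directly, so no
pointwise-in-time statement about the limit is needed.

Since `|a_K - a| ≤ 1` and the masses `∫ d_K` are bounded, the exponent `2` yields every `s > 1`. The
second fraction is one minus the first. -/

/-! ### Absolutely continuous functions of time -/

/-- Meant for `y ↦ (y + δ)⁻¹`, which is Lipschitz only on the range of a nonnegative `f`; this is
why the Lipschitz condition is imposed on values of `f` only. -/
theorem AbsolutelyContinuousOnInterval.lipschitz_comp {f g : ℝ → ℝ} {a b K : ℝ}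
    (hf : AbsolutelyContinuousOnInterval f a b)
    (hg : ∀ x ∈ uIcc a b, ∀ y ∈ uIcc a b, |g (f x) - g (f y)| ≤ K * |f x - f y|) :
    AbsolutelyContinuousOnInterval (fun x => g (f x)) a b := by
  rw [absolutelyContinuousOnInterval_iff] at hf ⊢
  intro ε hε
  -- The denominator is positive whatever the sign of `K`.
  obtain ⟨δ, hδ, h⟩ := hf (ε / (|K| + 1)) (by positivity)
  refine ⟨δ, hδ, fun E hE hlt => ?_⟩
  have h1 := h E hE hlt
  rw [lt_div_iff₀ (by positivity)] at h1
  refine lt_of_le_of_lt ?_ h1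
  rw [Finset.sum_mul]
  refine Finset.sum_le_sum fun i hi => ?_
  have hm := hE.1 i hi
  have h2 := hg _ hm.1 _ hm.2
  rw [Real.dist_eq, Real.dist_eq]
  refine h2.trans ?_
  have := le_abs_self K
  have := abs_nonneg (f (E.2 i).1 - f (E.2 i).2)
  nlinarith

theorem restrict_Ioo_eq_Ioc (a b : ℝ) :
    (volume.restrict (Ioo a b) : Measure ℝ) = volume.restrict (Ioc a b) :=
  Measure.restrict_congr_set Ioo_ae_eq_Ioc

theorem integral_timeMeasure {T : ℝ} (hT : 0 ≤ T) {E : Type*} [NormedAddCommGroup E]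
    [NormedSpace ℝ E] (f : ℝ → E) :
    ∫ t, f t ∂(timeMeasure T) = ∫ t in (0 : ℝ)..T, f t := by
  rw [intervalIntegral.integral_of_le hT, timeMeasure, restrict_Ioo_eq_Ioc]

theorem intervalIntegrable_iff_timeMeasure {T : ℝ} (hT : 0 ≤ T) {E : Type*} [NormedAddCommGroup E]
    {f : ℝ → E} :
    IntervalIntegrable f volume 0 T ↔ Integrable f (timeMeasure T) := by
  rw [intervalIntegrable_iff_integrableOn_Ioc_of_le hT, timeMeasure, restrict_Ioo_eq_Ioc]; rfl

/-- A continuous function that is nonnegative almost everywhere on `(0,T)` is nonnegative on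
`[0,T]`. -/
theorem ContinuousOn.nonneg_of_ae_timeMeasure {T : ℝ} (hT : 0 < T) {f : ℝ → ℝ}
    (hf : ContinuousOn f (Icc 0 T)) (h : ∀ᵐ t ∂(timeMeasure T), 0 ≤ f t) :
    ∀ t ∈ Icc 0 T, 0 ≤ f t := by
  -- Taking the minimum with zero turns the inequality into an equality of continuous functions, and
  -- an almost everywhere equality of these on an open set holds everywhere on it.
  have h1 : EqOn (fun t => min (f t) 0) (fun _ => 0) (Ioo 0 T) := by
    refine Measure.eqOn_open_of_ae_eq (μ := volume) (f := fun t => min (f t) 0) (g := fun _ => 0)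
      ?_ isOpen_Ioo ?_ continuousOn_const
    · filter_upwards [h] with t ht using min_eq_right ht
    · exact (hf.mono Ioo_subset_Icc_self).inf continuousOn_const
  have h2 : EqOn (fun t => min (f t) 0) (fun _ => 0) (Icc 0 T) := by
    refine h1.of_subset_closure (hf.inf continuousOn_const) continuousOn_const
      Ioo_subset_Icc_self ?_
    rw [closure_Ioo hT.ne]
  intro t ht
  exact min_eq_right_iff.1 (h2 ht)

/-- The chain rule for `p² / (q + δ)` along absolutely continuous `p`, `q`, integrated in time. -/
theorem integral_quotient_eq {T δ p₀ q₀ : ℝ} (hT : 0 < T) (hδ : 0 < δ) {p q hp hq : ℝ → ℝ}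
    (hhp : Integrable hp (timeMeasure T)) (hhq : Integrable hq (timeMeasure T))
    (hpe : ∀ᵐ t ∂(timeMeasure T), p t = p₀ + ∫ s in (0 : ℝ)..t, hp s)
    (hqe : ∀ᵐ t ∂(timeMeasure T), q t = q₀ + ∫ s in (0 : ℝ)..t, hq s)
    (hpos : ∀ᵐ t ∂(timeMeasure T), 0 ≤ q t) :
    ∫ t, p t ^ 2 / (q t + δ) ∂(timeMeasure T) = T * (p₀ ^ 2 / (q₀ + δ)) +
      ∫ s, (T - s) * (2 * (p s / (q s + δ)) * hp s - (p s / (q s + δ)) ^ 2 * hq s)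
        ∂(timeMeasure T) := by
  rw [← intervalIntegrable_iff_timeMeasure hT.le] at hhp hhq
  set P : ℝ → ℝ := fun t => p₀ + ∫ s in (0 : ℝ)..t, hp s with hP
  set Q : ℝ → ℝ := fun t => q₀ + ∫ s in (0 : ℝ)..t, hq s with hQ
  have ac0 : ∀ c : ℝ, AbsolutelyContinuousOnInterval (fun _ : ℝ => c) 0 T := fun c =>
    (contDiff_const.contDiffOn).absolutelyContinuousOnInterval
  have acP : AbsolutelyContinuousOnInterval P 0 T :=
    (ac0 p₀).add (hhp.absolutelyContinuousOnInterval_intervalIntegral left_mem_uIcc)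
  have acQ : AbsolutelyContinuousOnInterval Q 0 T :=
    (ac0 q₀).add (hhq.absolutelyContinuousOnInterval_intervalIntegral left_mem_uIcc)
  -- The sign is known for `q` at almost every time; continuity of `Q` extends it to all of `[0,T]`,
  -- which keeps `Q + δ` away from zero.
  have hQ0 : ∀ t ∈ Icc 0 T, 0 ≤ Q t := by
    refine ContinuousOn.nonneg_of_ae_timeMeasure hT ?_ ?_
    · simpa [uIcc_of_le hT.le] using acQ.continuousOn
    · filter_upwards [hpos, hqe] with t h1 h2
      rw [hQ]; simp only; rw [← h2]; exact h1
  have hQd : ∀ t ∈ Icc 0 T, 0 < Q t + δ := fun t ht => by linarith [hQ0 t ht]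
  have acI : AbsolutelyContinuousOnInterval (fun t => (Q t + δ)⁻¹) 0 T := by
    refine acQ.lipschitz_comp (g := fun y => (y + δ)⁻¹) (K := (δ ^ 2)⁻¹) fun x hx y hy => ?_
    rw [uIcc_of_le hT.le] at hx hy
    have h1 := hQ0 x hx
    have h2 := hQ0 y hy
    have e : (Q x + δ)⁻¹ - (Q y + δ)⁻¹ = ((Q x + δ) * (Q y + δ))⁻¹ * (Q y - Q x) := by
      have := (hQd x hx).ne'
      have := (hQd y hy).ne'
      field_simp
      ring
    rw [e, abs_mul, abs_sub_comm (Q y), abs_of_nonneg (by positivity)]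
    gcongr
    nlinarith
  have acF : AbsolutelyContinuousOnInterval (fun t => P t * P t * (Q t + δ)⁻¹) 0 T :=
    (acP.mul acP).mul acI
  have acT : AbsolutelyContinuousOnInterval (fun t : ℝ => T - t) 0 T :=
    ((contDiff_const.sub contDiff_id).contDiffOn).absolutelyContinuousOnInterval
  -- The weight `T - t` vanishes at `T` and has derivative `-1`: integration by parts yields the
  -- time integral of the quotient and its initial value times `T`, with no terminal value.
  have key := acT.integral_mul_deriv_eq_deriv_mul acF
  have hd : ∀ t, deriv (fun t : ℝ => T - t) t = -1 := fun t => by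
    simp
  have hP0 : P 0 = p₀ := by simp [hP]
  have hQ00 : Q 0 = q₀ := by simp [hQ]
  simp only [hd, sub_self, zero_mul, sub_zero, hP0, hQ00, neg_mul, one_mul,
    intervalIntegral.integral_neg, zero_sub, sub_neg_eq_add] at key
  have e1 : ∫ t, p t ^ 2 / (q t + δ) ∂(timeMeasure T)
      = ∫ t in (0 : ℝ)..T, P t * P t * (Q t + δ)⁻¹ := by
    rw [← integral_timeMeasure hT.le]
    refine integral_congr_ae ?_
    filter_upwards [hpe, hqe] with t h1 h2
    rw [h1, h2]; simp only [hP, hQ]; ring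
  have e2 : ∫ s, (T - s) * (2 * (p s / (q s + δ)) * hp s - (p s / (q s + δ)) ^ 2 * hq s)
        ∂(timeMeasure T)
      = ∫ t in (0 : ℝ)..T, (T - t) * deriv (fun t => P t * P t * (Q t + δ)⁻¹) t := by
    rw [← integral_timeMeasure hT.le]
    refine integral_congr_ae ?_
    have dP := hhp.ae_hasDerivAt_integral
    have dQ := hhq.ae_hasDerivAt_integral
    filter_upwards [hpe, hqe, ae_restrict_of_ae dP, ae_restrict_of_ae dQ,
      ae_restrict_mem measurableSet_Ioo] with t h1 h2 d1 d2 ht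
    have htI : t ∈ uIcc 0 T := by rw [uIcc_of_le hT.le]; exact Ioo_subset_Icc_self ht
    have D1 : HasDerivAt P (hp t) t := (d1 htI 0 left_mem_uIcc).const_add p₀
    have D2 : HasDerivAt Q (hq t) t := (d2 htI 0 left_mem_uIcc).const_add q₀
    have hne := (hQd t (Ioo_subset_Icc_self ht)).ne'
    have D3 := (D1.mul D1).mul ((D2.add_const δ).inv hne)
    have D4 : deriv (fun t => P t * P t * (Q t + δ)⁻¹) t = _ := D3.deriv
    rw [D4, h1, h2]
    change (T - t) * (2 * (P t / (Q t + δ)) * hp t - (P t / (Q t + δ)) ^ 2 * hq t) = _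
    simp only [Pi.mul_apply, Pi.inv_apply]
    field_simp
    ring
  rw [e1, e2, key]
  ring

/-! ### The weak formulation with a flux, and its time slices -/

theorem cylMeasure_eq_prod (Ω : Set R3) (T : ℝ) :
    cylMeasure Ω T = (timeMeasure T).prod (volume.restrict Ω) := by
  rw [cylMeasure, timeMeasure, Measure.prod_restrict, Measure.volume_eq_prod]

/-- `∂ₜ f + div J = 0` on `(0,T) × Ω` with zero normal flux and initial value `f₀`, tested with
products `θ(t) w(x)`. -/
def IsFluxSolution (Ω : Set R3) (T : ℝ) (f₀ : R3 → ℝ) (f : ℝ → R3 → ℝ) (J : ℝ → R3 → R3) :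
    Prop :=
  ∀ (θ : ℝ → ℝ) (w : R3 → ℝ), ContDiff ℝ ∞ θ → HasCompactSupport θ → tsupport θ ⊆ Iio T →
    ContDiff ℝ ∞ w → HasCompactSupport w →
    (∫ z, (deriv θ z.1 * (w z.2 * f z.1 z.2) + θ z.1 * fderiv ℝ w z.2 (J z.1 z.2))
      ∂(cylMeasure Ω T)) + θ 0 * ∫ x in Ω, f₀ x * w x = 0

/-- Product test functions are all the proof needs, and collecting convection and diffusion in one
flux lets the viscous equations and their limit share one formulation. -/
theorem IsWeakSolution.isFluxSolution {Ω : Set R3} {T ν : ℝ} {u : ℝ → R3 → R3} {f₀ : R3 → ℝ}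
    {f : ℝ → R3 → ℝ} {Df : ℝ → R3 → R3} (h : IsWeakSolution Ω T ν u f₀ f Df) :
    IsFluxSolution Ω T f₀ f (fun t x => f t x • u t x - ν • Df t x) := by
  intro θ w hθ hθc hθT hw hwc
  have hθw : ContDiff ℝ ∞ (fun z : ℝ × R3 => θ z.1 * w z.2) :=
    (hθ.comp contDiff_fst).mul (hw.comp contDiff_snd)
  have hsub : tsupport (fun z : ℝ × R3 => θ z.1 * w z.2) ⊆ tsupport θ ×ˢ tsupport w := by
    refine closure_minimal ?_ ((isClosed_tsupport θ).prod (isClosed_tsupport w))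
    intro z hz
    have hz' : θ z.1 * w z.2 ≠ 0 := hz
    exact ⟨subset_tsupport _ (left_ne_zero_of_mul hz'), subset_tsupport _ (right_ne_zero_of_mul hz')⟩
  have hcs : HasCompactSupport (fun z : ℝ × R3 => θ z.1 * w z.2) :=
    IsCompact.of_isClosed_subset (hθc.isCompact.prod hwc.isCompact) (isClosed_tsupport _) hsub
  have hfd : ∀ (z : ℝ × R3) (a : ℝ) (v : R3), fderiv ℝ (fun z : ℝ × R3 => θ z.1 * w z.2) z (a, v)
      = a * deriv θ z.1 * w z.2 + θ z.1 * fderiv ℝ w z.2 v := by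
    intro z a v
    have h1 : HasFDerivAt (fun z : ℝ × R3 => θ z.1)
        ((fderiv ℝ θ z.1).comp (ContinuousLinearMap.fst ℝ ℝ R3)) z :=
      ((hθ.differentiable (by simp)) z.1).hasFDerivAt.comp z hasFDerivAt_fst
    have h2 : HasFDerivAt (fun z : ℝ × R3 => w z.2)
        ((fderiv ℝ w z.2).comp (ContinuousLinearMap.snd ℝ ℝ R3)) z :=
      ((hw.differentiable (by simp)) z.2).hasFDerivAt.comp z hasFDerivAt_snd
    have h3 := (h1.mul h2).fderiv
    have h4 : fderiv ℝ (fun z : ℝ × R3 => θ z.1 * w z.2) z = _ := h3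
    rw [h4]
    simp only [add_apply, smul_apply,
      ContinuousLinearMap.comp_apply, ContinuousLinearMap.coe_fst', ContinuousLinearMap.coe_snd',
      smul_eq_mul]
    rw [fderiv_eq_smul_deriv]
    simp only [smul_eq_mul]
    ring
  have key := h.2 _ hθw hcs (hsub.trans (prod_mono hθT (subset_univ _)))
  refine Eq.trans ?_ key
  rw [← integral_const_mul]
  congr 1
  · refine integral_congr_ae (Eventually.of_forall fun z => ?_)
    simp only [hfd, map_sub, map_smul, smul_eq_mul]
    ring
  · refine integral_congr_ae (Eventually.of_forall fun x => ?_)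
    simp only
    ring

/-- Every test function on `(0,T)` is, on `(0,T)`, the derivative of a test function on
`(-∞,T)`. -/
theorem exists_contDiff_primitive {T : ℝ} {ψ : ℝ → ℝ} (hT : 0 < T) (hψ : ContDiff ℝ ∞ ψ)
    (hψT : tsupport ψ ⊆ Ioo 0 T) :
    ∃ θ : ℝ → ℝ, ContDiff ℝ ∞ θ ∧ HasCompactSupport θ ∧ tsupport θ ⊆ Iio T ∧
      ∀ t ∈ Icc 0 T, deriv θ t = ψ t := by
  -- A copy of `ψ` translated into `(-2T, -T)` is subtracted to make the mean zero. The primitive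
  -- then has compact support, and on `[0,T]` its derivative is unchanged. The test functions need
  -- not vanish at negative times, so the copy does no harm.
  set χ : ℝ → ℝ := fun t => ψ t - ψ (t + 2 * T) with hχ
  have hχd : ContDiff ℝ ∞ χ := hψ.sub (hψ.comp (contDiff_id.add contDiff_const))
  have hz : ∀ t, t ∉ Ioo 0 T → ψ t = 0 := fun t ht =>
    image_eq_zero_of_notMem_tsupport (fun h => ht (hψT h))
  have hc : Continuous ψ := hψ.continuous
  -- the support of `ψ` stays away from `T`
  obtain ⟨b, hbT, hb⟩ : ∃ b < T, ∀ t, b < t → ψ t = 0 := by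
    have hK : IsCompact (tsupport ψ) :=
      isCompact_Icc.of_isClosed_subset (isClosed_tsupport _) (hψT.trans Ioo_subset_Icc_self)
    rcases (tsupport ψ).eq_empty_or_nonempty with he | hne
    · refine ⟨0, hT, fun t _ => image_eq_zero_of_notMem_tsupport (by simp [he])⟩
    · obtain ⟨b, hb, hmax⟩ := hK.exists_isGreatest hne
      exact ⟨b, (hψT hb).2, fun t ht => image_eq_zero_of_notMem_tsupport
        (fun h => absurd (hmax h) (not_le.2 ht))⟩
  have hDer : ∀ t, HasDerivAt (fun t => ∫ s in T..t, χ s) (χ t) t := fun t =>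
    intervalIntegral.integral_hasDerivAt_right (hχd.continuous.intervalIntegrable _ _)
      (hχd.continuous.stronglyMeasurableAtFilter _ _) hχd.continuous.continuousAt
  have hsupp : ∀ t, t ∉ Icc (-2 * T) b → ∫ s in T..t, χ s = 0 := by
    intro t ht
    rw [mem_Icc, not_and_or, not_le, not_le] at ht
    rcases ht with ht | ht
    · simp only [hχ]
      rw [intervalIntegral.integral_sub (hc.intervalIntegrable _ _)
        ((show Continuous fun s => ψ (s + 2 * T) by fun_prop).intervalIntegrable _ _),
        intervalIntegral.integral_comp_add_right (fun s => ψ s)]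
      have e1 := intervalIntegral.integral_add_adjacent_intervals (μ := volume) (f := ψ) (a := T + 2 * T) (b := T)
        (c := t + 2 * T) (hc.intervalIntegrable _ _) (hc.intervalIntegrable _ _)
      have e2 := intervalIntegral.integral_add_adjacent_intervals (μ := volume) (f := ψ) (a := T) (b := t + 2 * T)
        (c := t) (hc.intervalIntegrable _ _) (hc.intervalIntegrable _ _)
      have z1 : ∫ s in (T + 2 * T)..T, ψ s = 0 := by
        rw [intervalIntegral.integral_congr (g := fun _ => (0 : ℝ))]
        · simp
        · intro s hs
          rw [uIcc_of_ge (by linarith)] at hs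
          exact hz s (fun h => absurd h.2 (not_lt.2 hs.1))
      have z2 : ∫ s in (t + 2 * T)..t, ψ s = 0 := by
        rw [intervalIntegral.integral_congr (g := fun _ => (0 : ℝ))]
        · simp
        · intro s hs
          rw [uIcc_of_ge (by linarith)] at hs
          exact hz s (fun h => absurd h.1 (not_lt.2 (by linarith [hs.2])))
      rw [z1, zero_add] at e1
      rw [z2, add_zero] at e2
      rw [← e1, ← e2, sub_self]
    · rw [intervalIntegral.integral_congr (g := fun _ => (0 : ℝ))]
      · simp
      · intro s hs
        have hbs : b < s := lt_of_lt_of_le (lt_min hbT ht) hs.1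
        simp only [hχ]
        rw [hb s hbs, hb (s + 2 * T) (by linarith), sub_zero]
  have hts : tsupport (fun t => ∫ s in T..t, χ s) ⊆ Icc (-2 * T) b :=
    closure_minimal (fun t ht => by_contra fun h => ht (hsupp t h)) isClosed_Icc
  refine ⟨fun t => ∫ s in T..t, χ s, ?_,
    isCompact_Icc.of_isClosed_subset (isClosed_tsupport _) hts,
    fun t ht => lt_of_le_of_lt (hts ht).2 hbT, ?_⟩
  · have hd : deriv (fun t => ∫ s in T..t, χ s) = χ := funext fun t => (hDer t).deriv
    rw [contDiff_infty_iff_deriv, hd]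
    exact ⟨fun t => (hDer t).differentiableAt, hχd⟩
  · intro t ht
    rw [(hDer t).deriv]
    simp only [hχ]
    rw [hz (t + 2 * T) (fun h => absurd h.2 (not_lt.2 (by linarith [ht.1]))), sub_zero]

/-- The time slices of a flux solution, tested with a fixed `w`, are absolutely continuous. -/
theorem IsFluxSolution.ae_eq {Ω : Set R3} {T : ℝ} {f₀ : R3 → ℝ} {f : ℝ → R3 → ℝ}
    {J : ℝ → R3 → R3} (hT : 0 < T) (h : IsFluxSolution Ω T f₀ f J)
    (hf : Integrable (Function.uncurry f) (cylMeasure Ω T))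
    (hJ : Integrable (Function.uncurry J) (cylMeasure Ω T))
    {w : R3 → ℝ} (hw : ContDiff ℝ ∞ w) (hwc : HasCompactSupport w) :
    ∀ᵐ t ∂(timeMeasure T), ∫ x in Ω, w x * f t x =
      (∫ x in Ω, f₀ x * w x) + ∫ s in (0 : ℝ)..t, ∫ x in Ω, fderiv ℝ w x (J s x) := by
  obtain ⟨Cw, hCw⟩ := hw.continuous.bounded_above_of_compact_support hwc
  have hw' : Continuous (fderiv ℝ w) := hw.continuous_fderiv (by simp)
  obtain ⟨Dw, hDw⟩ := hw'.bounded_above_of_compact_support (hwc.fderiv ℝ)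
  rw [cylMeasure_eq_prod] at hf hJ
  have hwf : Integrable (fun z : ℝ × R3 => w z.2 * f z.1 z.2)
      ((timeMeasure T).prod (volume.restrict Ω)) :=
    hf.bdd_mul (hw.continuous.comp continuous_snd).aestronglyMeasurable
      (Eventually.of_forall fun z => hCw z.2)
  have hwJ : Integrable (fun z : ℝ × R3 => fderiv ℝ w z.2 (J z.1 z.2))
      ((timeMeasure T).prod (volume.restrict Ω)) := by
    refine (hJ.norm.const_mul Dw).mono' ?_ (Eventually.of_forall fun z => ?_)
    · exact (isBoundedBilinearMap_apply (𝕜 := ℝ) (E := R3) (F := ℝ)).continuous.comp_aestronglyMeasurable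
        ((hw'.comp continuous_snd).aestronglyMeasurable.prodMk hJ.aestronglyMeasurable)
    · exact ((fderiv ℝ w z.2).le_opNorm _).trans
        (mul_le_mul_of_nonneg_right (hDw z.2) (norm_nonneg _))
  set g : ℝ → ℝ := fun t => ∫ x in Ω, w x * f t x with hg
  set k : ℝ → ℝ := fun t => ∫ x in Ω, fderiv ℝ w x (J t x) with hk
  set c : ℝ := ∫ x in Ω, f₀ x * w x with hc
  have hgi : Integrable g (timeMeasure T) := hwf.integral_prod_left
  have hki : Integrable k (timeMeasure T) := hwJ.integral_prod_left
  have hki' := (intervalIntegrable_iff_timeMeasure hT.le).2 hki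
  set G : ℝ → ℝ := fun t => c + ∫ s in (0 : ℝ)..t, k s with hG
  have acG : AbsolutelyContinuousOnInterval G 0 T :=
    ((contDiff_const.contDiffOn).absolutelyContinuousOnInterval).add
      (hki'.absolutelyContinuousOnInterval_intervalIntegral left_mem_uIcc)
  have hGi : Integrable G (timeMeasure T) :=
    (intervalIntegrable_iff_timeMeasure hT.le).1 acG.continuousOn.intervalIntegrable
  have hloc : LocallyIntegrableOn (fun t => g t - G t) (Ioo 0 T) volume :=
    IntegrableOn.locallyIntegrableOn (hgi.sub hGi)
  -- It suffices that `g - G` be orthogonal to all test functions on `(0,T)`. Each of them is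
  -- written as `θ'`; the weak formulation computes the integral of `θ' g`, and integration by parts
  -- that of `θ' G`.
  have main := isOpen_Ioo.ae_eq_zero_of_integral_contDiff_smul_eq_zero hloc ?_
  · rw [timeMeasure, ae_restrict_iff' measurableSet_Ioo]
    filter_upwards [main] with t ht hmem
    exact sub_eq_zero.1 (ht hmem)
  intro ψ hψ hψc hψT
  obtain ⟨θ, hθ, hθc, hθT, hθψ⟩ := exists_contDiff_primitive hT hψ hψT
  have hθ' : Continuous (deriv θ) := hθ.continuous_deriv (by simp)
  obtain ⟨Cθ, hCθ⟩ := hθ.continuous.bounded_above_of_compact_support hθc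
  obtain ⟨Dθ, hDθ⟩ := hθ'.bounded_above_of_compact_support (hθc.deriv)
  -- No boundary term survives at `T`; the one at `0` matches the initial datum.
  have hθTz : θ T = 0 := image_eq_zero_of_notMem_tsupport fun hm => lt_irrefl T (hθT hm)
  -- the weak formulation, integrated over the space variable
  have e := h θ w hθ hθc hθT hw hwc
  have i1 : Integrable (fun z : ℝ × R3 => deriv θ z.1 * (w z.2 * f z.1 z.2))
      ((timeMeasure T).prod (volume.restrict Ω)) :=
    hwf.bdd_mul (hθ'.comp continuous_fst).aestronglyMeasurable
      (Eventually.of_forall fun z => hDθ z.1)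
  have i2 : Integrable (fun z : ℝ × R3 => θ z.1 * fderiv ℝ w z.2 (J z.1 z.2))
      ((timeMeasure T).prod (volume.restrict Ω)) :=
    hwJ.bdd_mul (hθ.continuous.comp continuous_fst).aestronglyMeasurable
      (Eventually.of_forall fun z => hCθ z.1)
  rw [cylMeasure_eq_prod, integral_add i1 i2, integral_prod _ i1, integral_prod _ i2] at e
  simp only [integral_const_mul] at e
  -- integration by parts in time for `G`
  have acθ : AbsolutelyContinuousOnInterval θ 0 T :=
    ((hθ.of_le (by simp)).contDiffOn).absolutelyContinuousOnInterval
  have ibp := acG.integral_mul_deriv_eq_deriv_mul acθ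
  have hG0 : G 0 = c := by simp [hG]
  have hGd : ∫ t in (0 : ℝ)..T, deriv G t * θ t = ∫ t in (0 : ℝ)..T, θ t * k t := by
    refine intervalIntegral.integral_congr_ae ?_
    filter_upwards [hki'.ae_hasDerivAt_integral] with t ht hmem
    have := ((ht (uIoc_subset_uIcc hmem) 0 left_mem_uIcc).const_add c).deriv
    rw [show deriv G t = k t from this, mul_comm]
  rw [hθTz, hG0, hGd, mul_zero, zero_sub] at ibp
  rw [← integral_timeMeasure hT.le, ← integral_timeMeasure hT.le] at ibp
  have hψg : Integrable (fun t => ψ t * g t) (timeMeasure T) := by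
    obtain ⟨Cψ, hCψ⟩ := hψ.continuous.bounded_above_of_compact_support hψc
    exact hgi.bdd_mul hψ.continuous.aestronglyMeasurable (Eventually.of_forall hCψ)
  have hψG : Integrable (fun t => ψ t * G t) (timeMeasure T) := by
    obtain ⟨Cψ, hCψ⟩ := hψ.continuous.bounded_above_of_compact_support hψc
    exact hGi.bdd_mul hψ.continuous.aestronglyMeasurable (Eventually.of_forall hCψ)
  have f1 : ∫ t, ψ t • (g t - G t) = ∫ t, ψ t * (g t - G t) ∂(timeMeasure T) := by
    rw [timeMeasure]
    refine (setIntegral_eq_integral_of_forall_compl_eq_zero fun t ht => ?_).symm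
    rw [image_eq_zero_of_notMem_tsupport (fun hm => ht (hψT hm)), zero_smul]
  have f2 : ∫ t, ψ t * G t ∂(timeMeasure T) = ∫ t, G t * deriv θ t ∂(timeMeasure T) := by
    refine setIntegral_congr_fun measurableSet_Ioo fun t ht => ?_
    simp only [hθψ t (Ioo_subset_Icc_self ht), mul_comm]
  have f3 : ∫ t, ψ t * g t ∂(timeMeasure T) = ∫ t, deriv θ t * g t ∂(timeMeasure T) := by
    refine setIntegral_congr_fun measurableSet_Ioo fun t ht => ?_
    simp only [hθψ t (Ioo_subset_Icc_self ht)]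
  rw [f1]
  simp only [mul_sub]
  rw [integral_sub hψg hψG, f2, f3, ibp]
  linarith

/-! ### `L²` inequalities and translates of `H¹₀` fields -/

theorem eLpNorm_two_sq {α E : Type*} [MeasurableSpace α] [NormedAddCommGroup E] (f : α → E)
    (μ : Measure α) : eLpNorm f 2 μ ^ 2 = ∫⁻ x, ‖f x‖ₑ ^ 2 ∂μ := by
  have h := eLpNorm_nnreal_pow_eq_lintegral (f := f) (μ := μ) (p := 2) (by norm_num)
  have h2 : ((2 : NNReal) : ENNReal) = 2 := by norm_num
  rw [h2] at h
  simpa using h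

theorem lintegral_enorm_mul_le {α E F : Type*} [MeasurableSpace α] [NormedAddCommGroup E]
    [NormedAddCommGroup F] {μ : Measure α} {f : α → E} {g : α → F}
    (hf : AEStronglyMeasurable f μ) (hg : AEStronglyMeasurable g μ) :
    ∫⁻ x, ‖f x‖ₑ * ‖g x‖ₑ ∂μ ≤ eLpNorm f 2 μ * eLpNorm g 2 μ := by
  have h := ENNReal.lintegral_mul_le_Lp_mul_Lq μ Real.HolderConjugate.two_two hf.enorm hg.enorm
  rw [eLpNorm_eq_lintegral_rpow_enorm_toReal (by norm_num) (by norm_num),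
    eLpNorm_eq_lintegral_rpow_enorm_toReal (by norm_num) (by norm_num)]
  simpa using h

/-- Jensen's inequality, as Cauchy–Schwarz against the constant one. It is applied on the unit
interval and with the probability density `bumpKernel`. -/
theorem sq_lintegral_le {α : Type*} [MeasurableSpace α] {μ : Measure α} [IsProbabilityMeasure μ]
    {f : α → ENNReal} (hf : AEMeasurable f μ) : (∫⁻ x, f x ∂μ) ^ 2 ≤ ∫⁻ x, f x ^ 2 ∂μ := by
  have h := ENNReal.lintegral_mul_le_Lp_mul_Lq μ Real.HolderConjugate.two_two hf
    (aemeasurable_const (b := (1 : ENNReal)))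
  simp only [Pi.mul_apply, mul_one, ENNReal.one_rpow, lintegral_one, measure_univ] at h
  calc (∫⁻ x, f x ∂μ) ^ 2 ≤ ((∫⁻ x, f x ^ (2 : ℝ) ∂μ) ^ (1 / 2 : ℝ)) ^ 2 := by gcongr
    _ = ∫⁻ x, f x ^ 2 ∂μ := by
      rw [← ENNReal.rpow_natCast, ← ENNReal.rpow_mul]
      norm_num

theorem eLpNorm_two_le_of_sq_le {α β E F : Type*} [MeasurableSpace α] [MeasurableSpace β]
    [NormedAddCommGroup E] [NormedAddCommGroup F] {μ : Measure α} {κ : Measure β} {f : α → E}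
    {g : β → F} {c : ENNReal} (h : ∫⁻ x, ‖f x‖ₑ ^ 2 ∂μ ≤ c ^ 2 * ∫⁻ x, ‖g x‖ₑ ^ 2 ∂κ) :
    eLpNorm f 2 μ ≤ c * eLpNorm g 2 κ := by
  rw [← eLpNorm_two_sq, ← eLpNorm_two_sq, ← mul_pow] at h
  exact (ENNReal.pow_right_strictMono two_ne_zero).le_iff_le.1 h

theorem eLpNorm_le_sub_add {α E : Type*} [MeasurableSpace α] [NormedAddCommGroup E]
    {μ : Measure α} {f g : α → E} (hf : AEStronglyMeasurable f μ) (hg : AEStronglyMeasurable g μ)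
    {p : ENNReal} (hp : 1 ≤ p) :
    eLpNorm f p μ ≤ eLpNorm (fun x => f x - g x) p μ + eLpNorm g p μ := by
  have h := eLpNorm_add_le (hf.sub hg) hg hp
  rwa [sub_add_cancel] at h

/-- The `L²` modulus of continuity of a smooth field is controlled by its derivative. -/
theorem eLpNorm_sub_translate_le_of_contDiff {φ : R3 → R3} (hφ : ContDiff ℝ 1 φ) (z : R3) :
    eLpNorm (fun x => φ (x - z) - φ x) 2 volume ≤ ‖z‖ₑ * eLpNorm (fderiv ℝ φ) 2 volume := by
  have hD : Continuous (fderiv ℝ φ) := hφ.continuous_fderiv (by simp)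
  have hpt : ∀ x, ‖φ (x - z) - φ x‖ₑ ^ 2
      ≤ ‖z‖ₑ ^ 2 * ∫⁻ s in Ioo (0 : ℝ) 1, ‖fderiv ℝ φ (x - s • z)‖ₑ ^ 2 := by
    intro x
    have hd : ∀ s ∈ uIcc (0 : ℝ) 1, HasDerivAt (fun s : ℝ => φ (x - s • z))
        (-fderiv ℝ φ (x - s • z) z) s := by
      intro s _
      have h1 : HasDerivAt (fun s : ℝ => x - s • z) (-z) s := by
        simpa using ((hasDerivAt_id s).smul_const z).const_sub x
      have := ((hφ.differentiable (by simp)) (x - s • z)).hasFDerivAt.comp_hasDerivAt s h1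
      rw [map_neg] at this
      exact this
    have hc : Continuous fun s : ℝ => -fderiv ℝ φ (x - s • z) z := by fun_prop
    -- The increment is the integral of the derivative along the segment from `x` to `x - z`; Jensen
    -- on `(0,1)` then bounds its square.
    have h2 := intervalIntegral.integral_eq_sub_of_hasDerivAt hd (hc.intervalIntegrable 0 1)
    simp only [one_smul, zero_smul, sub_zero] at h2
    rw [← h2, intervalIntegral.integral_of_le zero_le_one, ← restrict_Ioo_eq_Ioc]
    have : IsProbabilityMeasure (volume.restrict (Ioo (0 : ℝ) 1)) :=
      ⟨by simp⟩
    have hm : Measurable fun s : ℝ => ‖fderiv ℝ φ (x - s • z)‖ₑ :=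
      (by fun_prop : Continuous fun s : ℝ => fderiv ℝ φ (x - s • z)).enorm.measurable
    calc ‖∫ s in Ioo (0 : ℝ) 1, -fderiv ℝ φ (x - s • z) z‖ₑ ^ 2
        ≤ (∫⁻ s in Ioo (0 : ℝ) 1, ‖z‖ₑ * ‖fderiv ℝ φ (x - s • z)‖ₑ) ^ 2 := by
          gcongr
          refine (enorm_integral_le_lintegral_enorm _).trans (lintegral_mono fun s => ?_)
          rw [enorm_neg, mul_comm]
          exact (fderiv ℝ φ (x - s • z)).le_opENorm z
      _ ≤ _ := by
          rw [lintegral_const_mul _ hm, mul_pow]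
          gcongr
          exact sq_lintegral_le hm.aemeasurable
  refine eLpNorm_two_le_of_sq_le ?_
  calc ∫⁻ x, ‖φ (x - z) - φ x‖ₑ ^ 2
      ≤ ∫⁻ x, ‖z‖ₑ ^ 2 * ∫⁻ s in Ioo (0 : ℝ) 1, ‖fderiv ℝ φ (x - s • z)‖ₑ ^ 2 :=
        lintegral_mono hpt
    _ = ‖z‖ₑ ^ 2 * ∫⁻ s in Ioo (0 : ℝ) 1, ∫⁻ x, ‖fderiv ℝ φ (x - s • z)‖ₑ ^ 2 := by
        have hm : Measurable (Function.uncurry fun (x : R3) (s : ℝ) =>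
            ‖fderiv ℝ φ (x - s • z)‖ₑ ^ 2) := by
          refine Measurable.pow_const ?_ 2
          exact (by fun_prop : Continuous fun p : R3 × ℝ =>
            fderiv ℝ φ (p.1 - p.2 • z)).enorm.measurable
        rw [lintegral_const_mul, lintegral_lintegral_swap hm.aemeasurable]
        exact hm.lintegral_prod_right'
    _ = ‖z‖ₑ ^ 2 * ∫⁻ x, ‖fderiv ℝ φ x‖ₑ ^ 2 := by
        congr 1
        have : ∀ s : ℝ, ∫⁻ x, ‖fderiv ℝ φ (x - s • z)‖ₑ ^ 2 = ∫⁻ x, ‖fderiv ℝ φ x‖ₑ ^ 2 :=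
          fun s => lintegral_sub_right_eq_self (fun x => ‖fderiv ℝ φ x‖ₑ ^ 2) (s • z)
        simp [this]

theorem eLpNorm_restrict_of_support {E : Type*} [NormedAddCommGroup E] {Ω : Set R3}
    (hΩ : MeasurableSet Ω) {f : R3 → E} (hf : ∀ x, x ∉ Ω → f x = 0) (p : ENNReal) :
    eLpNorm f p (volume.restrict Ω) = eLpNorm f p volume := by
  rw [← eLpNorm_indicator_eq_eLpNorm_restrict hΩ]
  congr 1
  exact indicator_eq_self.2 fun x hx => by_contra fun h => hx (hf x h)

theorem aestronglyMeasurable_of_support {α E : Type*} [MeasurableSpace α] {μ : Measure α}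
    [NormedAddCommGroup E] {Ω : Set α}
    (hΩ : MeasurableSet Ω) {f : α → E} (hf : ∀ x, x ∉ Ω → f x = 0)
    (h : AEStronglyMeasurable f (μ.restrict Ω)) : AEStronglyMeasurable f μ := by
  have : Ω.indicator f = f := indicator_eq_self.2 fun x hx => by_contra fun h => hx (hf x h)
  rw [← this]
  exact (aestronglyMeasurable_indicator_iff hΩ).2 h

/-- Smooth approximation, on the whole space, of the extension by zero of a field in `H¹₀`. -/
theorem IsH10.exists_approx {Ω : Set R3} (hΩ : MeasurableSet Ω) {v : R3 → R3}
    {Dv : R3 → R3 →L[ℝ] R3} (h : IsH10 Ω v Dv) (hv : ∀ x, x ∉ Ω → v x = 0)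
    (hDv : ∀ x, x ∉ Ω → Dv x = 0) :
    ∃ φ : ℕ → R3 → R3, (∀ j, ContDiff ℝ ∞ (φ j) ∧ HasCompactSupport (φ j) ∧ tsupport (φ j) ⊆ Ω) ∧
      Tendsto (fun j => eLpNorm (fun x => φ j x - v x) 2 volume) atTop (𝓝 0) ∧
      Tendsto (fun j => eLpNorm (fun x => fderiv ℝ (φ j) x - Dv x) 2 volume) atTop (𝓝 0) := by
  obtain ⟨-, -, φ, hφ, h1, h2⟩ := h
  have z1 : ∀ j x, x ∉ Ω → φ j x = 0 := fun j x hx =>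
    image_eq_zero_of_notMem_tsupport fun hm => hx ((hφ j).2.2 hm)
  have z2 : ∀ j x, x ∉ Ω → fderiv ℝ (φ j) x = 0 := fun j x hx =>
    image_eq_zero_of_notMem_tsupport fun hm => hx ((hφ j).2.2 (tsupport_fderiv_subset ℝ hm))
  refine ⟨φ, hφ, ?_, ?_⟩
  · convert h1 using 2 with j
    exact (eLpNorm_restrict_of_support hΩ (fun x hx => by rw [z1 j x hx, hv x hx, sub_zero]) 2).symm
  · convert h2 using 2 with j
    exact (eLpNorm_restrict_of_support hΩ
      (fun x hx => by rw [z2 j x hx, hDv x hx, sub_zero]) 2).symm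

theorem eLpNorm_comp_sub {E : Type*} [NormedAddCommGroup E] {f : R3 → E}
    (hf : AEStronglyMeasurable f volume) (z : R3) (p : ENNReal) :
    eLpNorm (fun x => f (x - z)) p volume = eLpNorm f p volume :=
  eLpNorm_comp_measurePreserving hf (measurePreserving_sub_right volume z)

/-- The smooth case passes to the limit along the approximating fields. Vanishing outside `Ω` turns
approximation in `L²(Ω)` into approximation on the whole space, where translation is an isometry. -/
theorem IsH10.eLpNorm_sub_translate_le {Ω : Set R3} (hΩ : MeasurableSet Ω) {v : R3 → R3}
    {Dv : R3 → R3 →L[ℝ] R3} (h : IsH10 Ω v Dv) (hv : ∀ x, x ∉ Ω → v x = 0) (z : R3) :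
    eLpNorm (fun x => v (x - z) - v x) 2 volume
      ≤ ‖z‖ₑ * eLpNorm Dv 2 (volume.restrict Ω) := by
  have hvm : AEStronglyMeasurable v volume := aestronglyMeasurable_of_support hΩ hv h.1.1
  obtain ⟨-, hDm, φ, hφ, h1, h2⟩ := h
  have z1 : ∀ j x, x ∉ Ω → φ j x = 0 := fun j x hx =>
    image_eq_zero_of_notMem_tsupport fun hm => hx ((hφ j).2.2 hm)
  have z2 : ∀ j x, x ∉ Ω → fderiv ℝ (φ j) x = 0 := fun j x hx =>
    image_eq_zero_of_notMem_tsupport fun hm => hx ((hφ j).2.2 (tsupport_fderiv_subset ℝ hm))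
  have e1 : ∀ j, eLpNorm (fun x => φ j x - v x) 2 (volume.restrict Ω)
      = eLpNorm (fun x => φ j x - v x) 2 volume := fun j =>
    eLpNorm_restrict_of_support hΩ (fun x hx => by rw [z1 j x hx, hv x hx, sub_zero]) 2
  simp only [e1] at h1
  have hb : ∀ j, eLpNorm (fun x => v (x - z) - v x) 2 volume ≤
      eLpNorm (fun x => φ j x - v x) 2 volume + (‖z‖ₑ *
        (eLpNorm (fun x => fderiv ℝ (φ j) x - Dv x) 2 (volume.restrict Ω)
          + eLpNorm Dv 2 (volume.restrict Ω)) + eLpNorm (fun x => φ j x - v x) 2 volume) := by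
    intro j
    have hφm : AEStronglyMeasurable (φ j) volume := (hφ j).1.continuous.aestronglyMeasurable
    have hdm : AEStronglyMeasurable (fun x => φ j x - v x) volume := hφm.sub hvm
    have hmp := measurePreserving_sub_right (volume : Measure R3) z
    have hdm' : AEStronglyMeasurable (fun x => φ j (x - z) - v (x - z)) volume :=
      hdm.comp_measurePreserving hmp
    have hφm' : AEStronglyMeasurable (fun x => φ j (x - z) - φ j x) volume :=
      (hφm.comp_measurePreserving hmp).sub hφm
    have hsplit : (fun x => v (x - z) - v x) = (fun x => -(φ j (x - z) - v (x - z))) +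
        ((fun x => φ j (x - z) - φ j x) + fun x => φ j x - v x) := by
      ext1 x; simp only [Pi.add_apply]; abel
    rw [hsplit]
    refine (eLpNorm_add_le hdm'.neg (hφm'.add hdm) (by norm_num)).trans ?_
    gcongr
    · refine le_of_eq ((eLpNorm_neg (fun x => φ j (x - z) - v (x - z)) 2 volume).trans ?_)
      exact eLpNorm_comp_sub hdm z 2
    refine (eLpNorm_add_le hφm' hdm (by norm_num)).trans ?_
    gcongr
    refine (eLpNorm_sub_translate_le_of_contDiff ((hφ j).1.of_le (by simp)) z).trans ?_
    gcongr
    rw [← eLpNorm_restrict_of_support hΩ (z2 j)]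
    have hfm : AEStronglyMeasurable (fderiv ℝ (φ j)) (volume.restrict Ω) :=
      ((hφ j).1.continuous_fderiv (by simp)).aestronglyMeasurable
    exact eLpNorm_le_sub_add hfm hDm.1 (by norm_num)
  have hlim := h1.add ((ENNReal.Tendsto.const_mul (a := ‖z‖ₑ) (h2.add_const
    (eLpNorm Dv 2 (volume.restrict Ω))) (Or.inr enorm_ne_top)).add h1)
  simp only [zero_add, add_zero] at hlim
  exact ge_of_tendsto' hlim hb

/-! ### Mollification -/

/-- A smooth nonnegative kernel of integral one, supported in the unit ball. -/
noncomputable def bumpKernel : R3 → ℝ :=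
  (⟨1 / 2, 1, by norm_num, by norm_num⟩ : ContDiffBump (0 : R3)).normed volume

theorem bumpKernel_contDiff : ContDiff ℝ ∞ bumpKernel := ContDiffBump.contDiff_normed _

theorem bumpKernel_nonneg (z : R3) : 0 ≤ bumpKernel z := ContDiffBump.nonneg_normed _ _

theorem bumpKernel_hasCompactSupport : HasCompactSupport bumpKernel :=
  ContDiffBump.hasCompactSupport_normed _

theorem integral_bumpKernel : ∫ z, bumpKernel z = 1 := ContDiffBump.integral_normed _

theorem bumpKernel_eq_zero {z : R3} (hz : 1 ≤ ‖z‖) : bumpKernel z = 0 := by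
  have h := ContDiffBump.support_normed_eq (μ := (volume : Measure R3))
    (⟨1 / 2, 1, by norm_num, by norm_num⟩ : ContDiffBump (0 : R3))
  by_contra hne
  have hm : z ∈ Function.support bumpKernel := hne
  rw [bumpKernel, h] at hm
  simp only [Metric.mem_ball, dist_zero_right] at hm
  linarith

theorem bumpKernel_continuous : Continuous bumpKernel := bumpKernel_contDiff.continuous

theorem integrable_bumpKernel : Integrable bumpKernel :=
  bumpKernel_continuous.integrable_of_hasCompactSupport bumpKernel_hasCompactSupport

theorem continuous_fderiv_bumpKernel : Continuous (fderiv ℝ bumpKernel) :=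
  bumpKernel_contDiff.continuous_fderiv (by simp)

theorem lintegral_enorm_bumpKernel : ∫⁻ z, ‖bumpKernel z‖ₑ = 1 := by
  have h := ofReal_integral_eq_lintegral_ofReal integrable_bumpKernel
    (Eventually.of_forall bumpKernel_nonneg)
  rw [integral_bumpKernel, ENNReal.ofReal_one] at h
  rw [h]
  exact lintegral_congr fun z => Real.enorm_of_nonneg (bumpKernel_nonneg z)

/-- The rescaled kernel `ε⁻³ η(·/ε)`. -/
noncomputable def mollKernel (ε : ℝ) (z : R3) : ℝ := ε⁻¹ ^ 3 * bumpKernel (ε⁻¹ • z)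

/-- The mollification of `f` at scale `ε`. -/
noncomputable def moll (ε : ℝ) (f : R3 → ℝ) (x : R3) : ℝ := ∫ y, mollKernel ε (x - y) * f y

/-- Substitution `y = x - ε z`; the Jacobian `ε³` is where the dimension enters, and it cancels the
normalization of `mollKernel`. -/
theorem integral_rescale {E : Type*} [NormedAddCommGroup E] [NormedSpace ℝ E] {ε : ℝ} (hε : 0 < ε)
    (x : R3) (G : R3 → R3 → E) :
    ∫ y, G y (ε⁻¹ • (x - y)) = ε ^ 3 • ∫ z, G (x - ε • z) z := by
  have h1 := integral_sub_left_eq_self (μ := (volume : Measure R3))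
    (fun y => G (x - y) (ε⁻¹ • y)) x
  have h2 := Measure.integral_comp_smul (volume : Measure R3) (fun y => G (x - y) (ε⁻¹ • y)) ε
  simp only [sub_sub_cancel] at h1
  rw [finrank_euclideanSpace, Fintype.card_fin, abs_of_pos (by positivity)] at h2
  simp only [smul_smul, inv_mul_cancel₀ hε.ne', one_smul] at h2
  rw [h1, h2, smul_smul, mul_inv_cancel₀ (by positivity), one_smul]

theorem moll_eq {ε : ℝ} (hε : 0 < ε) (f : R3 → ℝ) (x : R3) :
    moll ε f x = ∫ z, bumpKernel z * f (x - ε • z) := by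
  simp only [moll, mollKernel]
  rw [integral_rescale hε x (fun y z => ε⁻¹ ^ 3 * bumpKernel z * f y)]
  simp only [mul_assoc, integral_const_mul, smul_eq_mul]
  rw [← mul_assoc, ← mul_pow, mul_inv_cancel₀ hε.ne', one_pow, one_mul]

theorem mollKernel_contDiff (ε : ℝ) : ContDiff ℝ ∞ (mollKernel ε) :=
  contDiff_const.mul (bumpKernel_contDiff.comp (contDiff_const_smul _))

theorem mollKernel_nonneg {ε : ℝ} (hε : 0 < ε) (z : R3) : 0 ≤ mollKernel ε z :=
  mul_nonneg (by positivity) (bumpKernel_nonneg _)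

theorem mollKernel_eq_zero {ε : ℝ} (hε : 0 < ε) {z : R3} (hz : ε ≤ ‖z‖) : mollKernel ε z = 0 := by
  rw [mollKernel, bumpKernel_eq_zero, mul_zero]
  rw [norm_smul, norm_inv, Real.norm_of_nonneg hε.le, ← div_eq_inv_mul, le_div_iff₀ hε, one_mul]
  exact hz

theorem mollKernel_hasCompactSupport {ε : ℝ} (hε : 0 < ε) : HasCompactSupport (mollKernel ε) :=
  HasCompactSupport.of_support_subset_isCompact (isCompact_closedBall 0 ε) fun z hz => by
    rw [mem_closedBall_zero_iff]
    by_contra h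
    exact hz (mollKernel_eq_zero hε (not_le.1 h).le)

theorem fderiv_mollKernel (ε : ℝ) (x v : R3) :
    fderiv ℝ (mollKernel ε) x v = ε⁻¹ ^ 3 * (ε⁻¹ * fderiv ℝ bumpKernel (ε⁻¹ • x) v) := by
  have h1 : HasFDerivAt (fun z : R3 => ε⁻¹ • z) (ε⁻¹ • ContinuousLinearMap.id ℝ R3) x :=
    (hasFDerivAt_id x).const_smul ε⁻¹
  have h2 := (((bumpKernel_contDiff.differentiable (by simp)) (ε⁻¹ • x)).hasFDerivAt.comp x
    h1).const_mul (ε⁻¹ ^ 3)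
  have h3 : fderiv ℝ (mollKernel ε) x = _ := h2.fderiv
  rw [h3]
  simp

theorem moll_eq_convolution (ε : ℝ) (f : R3 → ℝ) :
    moll ε f = convolution f (mollKernel ε) (ContinuousLinearMap.mul ℝ ℝ) volume := by
  ext x
  simp only [moll, convolution, ContinuousLinearMap.mul_apply', mul_comm]

theorem moll_contDiff {ε : ℝ} (hε : 0 < ε) {f : R3 → ℝ} (hf : LocallyIntegrable f) :
    ContDiff ℝ ∞ (moll ε f) := by
  rw [moll_eq_convolution]
  exact (mollKernel_hasCompactSupport hε).contDiff_convolution_right _ hf (mollKernel_contDiff ε)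

/-- The derivative falls on the kernel and costs a factor `ε⁻¹`. In the commutator this factor is
compensated by an increment of the velocity. -/
theorem fderiv_moll {ε : ℝ} (hε : 0 < ε) {f : R3 → ℝ} (hf : LocallyIntegrable f) (x v : R3) :
    fderiv ℝ (moll ε f) x v = ε⁻¹ * ∫ z, f (x - ε • z) * fderiv ℝ bumpKernel z v := by
  have h := ((mollKernel_hasCompactSupport hε).hasFDerivAt_convolution_right
    (ContinuousLinearMap.mul ℝ ℝ) hf ((mollKernel_contDiff ε).of_le (by simp)) x).fderiv
  rw [← moll_eq_convolution] at h
  rw [h, convolution]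
  have hex := ((mollKernel_hasCompactSupport hε).fderiv ℝ).convolutionExists_right
    ((ContinuousLinearMap.mul ℝ ℝ).precompR R3) hf
    ((mollKernel_contDiff ε).continuous_fderiv (by simp)) x
  rw [ContinuousLinearMap.integral_apply hex.integrable]
  have hpt : ∀ y, (((ContinuousLinearMap.mul ℝ ℝ).precompR R3) (f y)
      (fderiv ℝ (mollKernel ε) (x - y))) v
      = f y * (ε⁻¹ ^ 3 * (ε⁻¹ * fderiv ℝ bumpKernel (ε⁻¹ • (x - y)) v)) := fun y => by
    rw [← fderiv_mollKernel]; rfl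
  simp only [hpt]
  rw [integral_rescale hε x (fun y z => f y * (ε⁻¹ ^ 3 * (ε⁻¹ * fderiv ℝ bumpKernel z v)))]
  have : ∀ z, f (x - ε • z) * (ε⁻¹ ^ 3 * (ε⁻¹ * fderiv ℝ bumpKernel z v))
      = ε⁻¹ ^ 3 * (ε⁻¹ * (f (x - ε • z) * fderiv ℝ bumpKernel z v)) := fun z => by ring
  simp only [this, integral_const_mul, smul_eq_mul]
  rw [← mul_assoc, ← mul_pow, mul_inv_cancel₀ hε.ne', one_pow, one_mul]

/-! ### Divergence and integration by parts -/

/-- The trace of a linear map of `ℝ³`: the divergence, when applied to a derivative. -/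
noncomputable def tr3 : (R3 →L[ℝ] R3) →L[ℝ] ℝ :=
  ∑ i : Fin 3, (EuclideanSpace.proj i).comp
    (ContinuousLinearMap.apply ℝ R3 (EuclideanSpace.single i (1 : ℝ)))

theorem tr3_apply (A : R3 →L[ℝ] R3) :
    tr3 A = ∑ i : Fin 3, A (EuclideanSpace.single i (1 : ℝ)) i := by
  simp [tr3]

/-- Three diagonal entries, each at most the operator norm. -/
theorem norm_tr3_le (A : R3 →L[ℝ] R3) : ‖tr3 A‖ ≤ 3 * ‖A‖ := by
  rw [tr3_apply]
  refine (norm_sum_le _ _).trans ?_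
  have : ∀ i ∈ (Finset.univ : Finset (Fin 3)),
      ‖A (EuclideanSpace.single i (1 : ℝ)) i‖ ≤ ‖A‖ := fun i _ => by
    refine (PiLp.norm_apply_le _ i).trans ((A.le_opNorm _).trans ?_)
    simp
  exact (Finset.sum_le_sum this).trans (by simp)

theorem enorm_tr3_le (A : R3 →L[ℝ] R3) : ‖tr3 A‖ₑ ≤ 3 * ‖A‖ₑ := by
  have h := norm_tr3_le A
  rw [← ofReal_norm, ← ofReal_norm]
  refine (ENNReal.ofReal_le_ofReal h).trans ?_
  rw [ENNReal.ofReal_mul (by norm_num)]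
  simp

theorem R3_eq_sum (x : R3) : x = ∑ i : Fin 3, x i • EuclideanSpace.single i (1 : ℝ) := by
  ext j
  simp [Finset.sum_apply, Pi.single_apply]

/-- Integration by parts: the gradient is minus the adjoint of the divergence. -/
theorem integral_fderiv_apply_eq {F : R3 → ℝ} {V : R3 → R3} (hF : ContDiff ℝ 1 F)
    (hV : ContDiff ℝ 1 V) (hc : HasCompactSupport F ∨ HasCompactSupport V) :
    ∫ x, fderiv ℝ F x (V x) = - ∫ x, F x * tr3 (fderiv ℝ V x) := by
  have hF' : Continuous (fderiv ℝ F) := hF.continuous_fderiv (by simp)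
  have hV' : Continuous (fderiv ℝ V) := hV.continuous_fderiv (by simp)
  have hVi : ∀ i : Fin 3, ContDiff ℝ 1 fun x => V x i := fun i =>
    (EuclideanSpace.proj i : R3 →L[ℝ] ℝ).contDiff.comp hV
  have hVd : ∀ (i : Fin 3) x v, fderiv ℝ (fun x => V x i) x v = (fderiv ℝ V x v) i := by
    intro i x v
    have := ((EuclideanSpace.proj i : R3 →L[ℝ] ℝ).hasFDerivAt.comp x
      ((hV.differentiable (by simp)) x).hasFDerivAt).fderiv
    have h2 : fderiv ℝ (fun x => V x i) x = _ := this
    rw [h2]; rfl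
  have e1 : ∀ x, fderiv ℝ F x (V x)
      = ∑ i : Fin 3, V x i * fderiv ℝ F x (EuclideanSpace.single i (1 : ℝ)) := by
    intro x
    conv_lhs => rw [R3_eq_sum (V x)]
    simp
  have e2 : ∀ x, F x * tr3 (fderiv ℝ V x) = ∑ i : Fin 3,
      fderiv ℝ (fun x => V x i) x (EuclideanSpace.single i (1 : ℝ)) * F x := by
    intro x
    simp only [tr3_apply, Finset.mul_sum, hVd]
    exact Finset.sum_congr rfl fun i _ => mul_comm _ _
  have c1 : ∀ i : Fin 3, Continuous fun x =>
      V x i * fderiv ℝ F x (EuclideanSpace.single i (1 : ℝ)) := fun i =>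
    (hVi i).continuous.mul (hF'.clm_apply continuous_const)
  have c2 : ∀ i : Fin 3, Continuous fun x =>
      fderiv ℝ (fun x => V x i) x (EuclideanSpace.single i (1 : ℝ)) * F x := fun i =>
    (((hVi i).continuous_fderiv (by simp)).clm_apply continuous_const).mul hF.continuous
  have hVic : HasCompactSupport V → ∀ i : Fin 3, HasCompactSupport fun x => V x i :=
    fun h i => h.comp_left (g := fun y : R3 => y i) rfl
  have s1 : ∀ i : Fin 3, HasCompactSupport fun x =>
      V x i * fderiv ℝ F x (EuclideanSpace.single i (1 : ℝ)) := fun i => by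
    rcases hc with h | h
    · exact HasCompactSupport.mul_left ((h.fderiv ℝ).comp_left
        (g := fun L : R3 →L[ℝ] ℝ => L (EuclideanSpace.single i (1 : ℝ))) rfl)
    · exact (hVic h i).mul_right
  have s2 : ∀ i : Fin 3, HasCompactSupport fun x =>
      fderiv ℝ (fun x => V x i) x (EuclideanSpace.single i (1 : ℝ)) * F x := fun i => by
    rcases hc with h | h
    · exact h.mul_left
    · exact HasCompactSupport.mul_right (((hVic h i).fderiv ℝ).comp_left
        (g := fun L : R3 →L[ℝ] ℝ => L (EuclideanSpace.single i (1 : ℝ))) rfl)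
  have s3 : ∀ i : Fin 3, HasCompactSupport fun x => V x i * F x := fun i => by
    rcases hc with h | h
    · exact h.mul_left
    · exact (hVic h i).mul_right
  simp only [e1, e2]
  rw [integral_finsetSum _ fun i _ => (c1 i).integrable_of_hasCompactSupport (s1 i),
    integral_finsetSum _ fun i _ => (c2 i).integrable_of_hasCompactSupport (s2 i),
    ← Finset.sum_neg_distrib]
  refine Finset.sum_congr rfl fun i _ => ?_
  exact integral_mul_fderiv_eq_neg_fderiv_mul_of_integrable
    ((c2 i).integrable_of_hasCompactSupport (s2 i)) ((c1 i).integrable_of_hasCompactSupport (s1 i))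
    (((hVi i).continuous.mul hF.continuous).integrable_of_hasCompactSupport (s3 i))
    (fun x _ => ((hVi i).differentiable (by simp)) x)
    (fun x _ => (hF.differentiable (by simp)) x)

/-- Integration by parts against a linear field, whose divergence is the constant `tr3 A`. This is
the cancellation that makes the commutator small: to leading order its kernel is this integrand with
`A` the derivative of the velocity. -/
theorem integral_fderiv_bumpKernel_apply (A : R3 →L[ℝ] R3) :
    ∫ z, (fderiv ℝ bumpKernel z (A z) + tr3 A * bumpKernel z) = 0 := by
  have h := integral_fderiv_apply_eq (bumpKernel_contDiff.of_le (by simp)) A.contDiff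
    (Or.inl bumpKernel_hasCompactSupport)
  simp only [ContinuousLinearMap.fderiv] at h
  rw [integral_add, h]
  · simp only [mul_comm (tr3 A)]
    ring
  · exact (continuous_fderiv_bumpKernel.clm_apply A.continuous).integrable_of_hasCompactSupport
      ((bumpKernel_hasCompactSupport.fderiv ℝ).mono fun z hz hz' => hz (by simp [hz']))
  · exact integrable_bumpKernel.const_mul _

/-! ### The DiPerna–Lions commutator -/

/-- Continuity of translations in `L¹`. -/
theorem tendsto_eLpNorm_translate_sub {f : R3 → ℝ} (hf : Integrable f) :
    Tendsto (fun h : R3 => eLpNorm (fun x => f (x - h) - f x) 1 volume) (𝓝 0) (𝓝 0) := by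
  have hm : MemLp f 1 volume := memLp_one_iff_integrable.2 hf
  set F := hm.toLp f
  let g : R3 → C(R3, R3) := fun h => ⟨fun x => x - h, by fun_prop⟩
  have hg : Continuous g := by
    refine ContinuousMap.continuous_of_continuous_uncurry g ?_
    change Continuous fun p : R3 × R3 => p.2 - p.1
    fun_prop
  have hgm : ∀ h, MeasurePreserving (g h) (volume : Measure R3) volume := fun h =>
    measurePreserving_sub_right volume h
  -- For finite exponents, composition with a measure-preserving map is continuous in the map;
  -- translations form a continuous family of such maps.
  have hc := (continuous_const (y := F)).compMeasurePreservingLp hg hgm (by norm_num)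
  have h0 : Lp.compMeasurePreserving (g 0) (hgm 0) F = F := by
    refine Lp.ext ?_
    filter_upwards [Lp.coeFn_compMeasurePreserving F (hgm 0)] with x hx
    rw [hx]; simp [g]
  have ht := (hc.tendsto 0)
  rw [h0, tendsto_iff_edist_tendsto_0] at ht
  refine ht.congr fun h => ?_
  rw [Lp.edist_def]
  refine eLpNorm_congr_ae ?_
  have e := hm.coeFn_toLp
  have e' := (hgm h).quasiMeasurePreserving.ae_eq e
  filter_upwards [Lp.coeFn_compMeasurePreserving F (hgm h), e, e'] with x h1 h2 h3
  simp only [Pi.sub_apply]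
  rw [h1, h2]
  have h3' : F (g h x) = f (x - h) := h3
  rw [Function.comp_apply, h3']

/-- The integrand of the DiPerna–Lions commutator
`∇(b_ε)·v - div (b v)_ε + b_ε div v` at the point `x`. -/
noncomputable def commKernel (ε : ℝ) (b : R3 → ℝ) (v : R3 → R3) (Dv : R3 → R3 →L[ℝ] R3)
    (x z : R3) : ℝ :=
  b (x - ε • z) * (fderiv ℝ bumpKernel z (ε⁻¹ • (v x - v (x - ε • z))) + tr3 (Dv x) * bumpKernel z)

/-- The density of the constant in the commutator estimate. -/
noncomputable def kernelDensity (z : R3) : ENNReal :=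
  ‖fderiv ℝ bumpKernel z‖ₑ * ‖z‖ₑ + 3 * ‖bumpKernel z‖ₑ

theorem measurable_kernelDensity : Measurable kernelDensity := by
  have h1 := continuous_fderiv_bumpKernel.enorm.measurable
  have h2 := bumpKernel_continuous.enorm.measurable
  exact (h1.mul measurable_enorm).add (h2.const_mul 3)

theorem lintegral_fderiv_bumpKernel_pow_lt_top (n : ℕ) :
    ∫⁻ z, ‖fderiv ℝ bumpKernel z‖ₑ * ‖z‖ₑ ^ n < ⊤ := by
  have hc : Continuous fun z => ‖fderiv ℝ bumpKernel z‖ * ‖z‖ ^ n :=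
    continuous_fderiv_bumpKernel.norm.mul (continuous_norm.pow n)
  have hi : Integrable fun z => ‖fderiv ℝ bumpKernel z‖ * ‖z‖ ^ n :=
    hc.integrable_of_hasCompactSupport
      ((bumpKernel_hasCompactSupport.fderiv ℝ).mono fun z hz hz' => hz (by simp [hz']))
  refine (lintegral_congr fun z => ?_).trans_lt hi.2
  simp [enorm_mul, enorm_pow]

theorem lintegral_kernelDensity_lt_top : ∫⁻ z, kernelDensity z < ⊤ := by
  unfold kernelDensity
  rw [lintegral_add_right _ (bumpKernel_continuous.enorm.measurable.const_mul 3),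
    lintegral_const_mul _ bumpKernel_continuous.enorm.measurable, lintegral_enorm_bumpKernel]
  have := lintegral_fderiv_bumpKernel_pow_lt_top 1
  simp only [pow_one] at this
  exact ENNReal.add_lt_top.2 ⟨this, by simp⟩

theorem measurable_commKernel {ε : ℝ} {b : R3 → ℝ} {v : R3 → R3} {Dv : R3 → R3 →L[ℝ] R3}
    (hb : Measurable b) (hv : Measurable v) (hDv : Measurable Dv) :
    Measurable (Function.uncurry (commKernel ε b v Dv)) := by
  have hs : Measurable fun p : R3 × R3 => p.1 - ε • p.2 :=
    (by fun_prop : Continuous fun p : R3 × R3 => p.1 - ε • p.2).measurable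
  have h1 : Measurable fun p : R3 × R3 => ε⁻¹ • (v p.1 - v (p.1 - ε • p.2)) :=
    ((hv.comp measurable_fst).sub (hv.comp hs)).const_smul ε⁻¹
  have h2 : Measurable fun p : R3 × R3 => fderiv ℝ bumpKernel p.2 :=
    (continuous_fderiv_bumpKernel.comp continuous_snd).measurable
  have h3 : Measurable fun p : R3 × R3 =>
      fderiv ℝ bumpKernel p.2 (ε⁻¹ • (v p.1 - v (p.1 - ε • p.2))) :=
    (isBoundedBilinearMap_apply (𝕜 := ℝ) (E := R3) (F := ℝ)).continuous.measurable.comp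
      (h2.prodMk h1)
  have h4 : Measurable fun p : R3 × R3 => tr3 (Dv p.1) :=
    tr3.continuous.measurable.comp (hDv.comp measurable_fst)
  exact (hb.comp hs).mul (h3.add (h4.mul (bumpKernel_continuous.measurable.comp measurable_snd)))

/-- For fixed `z`, Cauchy–Schwarz in `x`. The factor `ε⁻¹` in the difference quotient is absorbed by
the bound `‖ε z‖ ‖Dv‖` on the translate, so the constant does not depend on `ε`. -/
theorem lintegral_commKernel_le {ε : ℝ} (hε : 0 < ε) {b : R3 → ℝ} {v : R3 → R3}
    {Dv : R3 → R3 →L[ℝ] R3} (hb : Measurable b) (hv : Measurable v) (hDv : Measurable Dv)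
    (htr : ∀ z, eLpNorm (fun x => v (x - z) - v x) 2 volume ≤ ‖z‖ₑ * eLpNorm Dv 2 volume) :
    ∫⁻ x, ∫⁻ z, ‖commKernel ε b v Dv x z‖ₑ
      ≤ (∫⁻ z, kernelDensity z) * (eLpNorm b 2 volume * eLpNorm Dv 2 volume) := by
  rw [lintegral_lintegral_swap (measurable_commKernel hb hv hDv).enorm.aemeasurable,
    ← lintegral_mul_const _ measurable_kernelDensity]
  refine lintegral_mono fun z => ?_
  have hs : Measurable fun x : R3 => x - ε • z := measurable_id.sub_const _
  have hbs : Measurable fun x => b (x - ε • z) := hb.comp hs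
  have hvs : Measurable fun x => v (x - ε • z) - v x := (hv.comp hs).sub hv
  have hpt : ∀ x, ‖commKernel ε b v Dv x z‖ₑ ≤
      ‖fderiv ℝ bumpKernel z‖ₑ * ‖ε⁻¹‖ₑ * (‖b (x - ε • z)‖ₑ * ‖v (x - ε • z) - v x‖ₑ)
        + 3 * ‖bumpKernel z‖ₑ * (‖b (x - ε • z)‖ₑ * ‖Dv x‖ₑ) := by
    intro x
    rw [commKernel, enorm_mul]
    calc ‖b (x - ε • z)‖ₑ * ‖fderiv ℝ bumpKernel z (ε⁻¹ • (v x - v (x - ε • z)))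
          + tr3 (Dv x) * bumpKernel z‖ₑ
        ≤ ‖b (x - ε • z)‖ₑ * (‖fderiv ℝ bumpKernel z‖ₑ * (‖ε⁻¹‖ₑ * ‖v (x - ε • z) - v x‖ₑ)
          + 3 * ‖Dv x‖ₑ * ‖bumpKernel z‖ₑ) := by
          gcongr
          refine (enorm_add_le _ _).trans ?_
          gcongr
          · refine ((fderiv ℝ bumpKernel z).le_opENorm _).trans ?_
            rw [enorm_smul, ← enorm_neg (v x - v (x - ε • z)), neg_sub]
          · rw [enorm_mul]
            gcongr
            exact enorm_tr3_le _
      _ = _ := by ring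
  refine (lintegral_mono hpt).trans ?_
  have m1 : Measurable fun x => ‖b (x - ε • z)‖ₑ * ‖v (x - ε • z) - v x‖ₑ :=
    hbs.enorm.mul hvs.enorm
  have m2 : Measurable fun x => ‖b (x - ε • z)‖ₑ * ‖Dv x‖ₑ := hbs.enorm.mul hDv.enorm
  rw [lintegral_add_left (m1.const_mul _), lintegral_const_mul _ m1, lintegral_const_mul _ m2,
    kernelDensity, add_mul]
  have hbn : eLpNorm (fun x => b (x - ε • z)) 2 volume = eLpNorm b 2 volume :=
    eLpNorm_comp_sub hb.aestronglyMeasurable _ _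
  have hεε : ‖ε⁻¹‖ₑ * ‖ε • z‖ₑ = ‖z‖ₑ := by
    rw [← enorm_smul, smul_smul, inv_mul_cancel₀ hε.ne', one_smul]
  refine add_le_add ?_ ?_
  · calc _ ≤ ‖fderiv ℝ bumpKernel z‖ₑ * ‖ε⁻¹‖ₑ *
          (eLpNorm b 2 volume * (‖ε • z‖ₑ * eLpNorm Dv 2 volume)) := by
          refine mul_le_mul_right ((lintegral_enorm_mul_le hbs.aestronglyMeasurable
            hvs.aestronglyMeasurable).trans ?_) _
          rw [hbn]
          exact mul_le_mul_right (htr _) _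
      _ = ‖fderiv ℝ bumpKernel z‖ₑ * (‖ε⁻¹‖ₑ * ‖ε • z‖ₑ) *
          (eLpNorm b 2 volume * eLpNorm Dv 2 volume) := by ring
      _ = _ := by rw [hεε]
  · rw [← hbn]
    exact mul_le_mul_right (lintegral_enorm_mul_le hbs.aestronglyMeasurable
      hDv.aestronglyMeasurable) _

/-- `‖b(· - h) - b‖_{L¹}`, as an extended nonnegative number. -/
noncomputable def l1Modulus (b : R3 → ℝ) (h : R3) : ENNReal := ∫⁻ x, ‖b (x - h) - b x‖ₑ

theorem tendsto_l1Modulus {b : R3 → ℝ} (hb : Integrable b) :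
    Tendsto (l1Modulus b) (𝓝 0) (𝓝 0) := by
  have := tendsto_eLpNorm_translate_sub hb
  simp only [eLpNorm_one_eq_lintegral_enorm] at this
  exact this

theorem measurable_l1Modulus {b : R3 → ℝ} (hb : Measurable b) : Measurable (l1Modulus b) := by
  have h : Measurable (Function.uncurry fun (h x : R3) => ‖b (x - h) - b x‖ₑ) :=
    ((hb.comp (measurable_snd.sub measurable_fst)).sub (hb.comp measurable_snd)).enorm
  exact h.lintegral_prod_right'

theorem l1Modulus_le {b : R3 → ℝ} (hb : Measurable b) (h : R3) :
    l1Modulus b h ≤ 2 * ∫⁻ x, ‖b x‖ₑ := by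
  calc l1Modulus b h ≤ ∫⁻ x, (‖b (x - h)‖ₑ + ‖b x‖ₑ) := lintegral_mono fun x => enorm_sub_le
    _ = 2 * ∫⁻ x, ‖b x‖ₑ := by
      rw [lintegral_add_right _ hb.enorm, lintegral_sub_right_eq_self (fun x => ‖b x‖ₑ), two_mul]

/-- Averages of the `L¹` modulus of continuity over small scales tend to zero. -/
theorem tendsto_lintegral_l1Modulus {b : R3 → ℝ} (hb : Measurable b) (hbi : Integrable b)
    {κ : R3 → ENNReal} (hκ : Measurable κ) (hκi : ∫⁻ z, κ z < ⊤) :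
    Tendsto (fun ε : ℝ => ∫⁻ z, κ z * l1Modulus b (ε • z)) (𝓝[>] 0) (𝓝 0) := by
  have hfin : ∫⁻ x, ‖b x‖ₑ ≠ ⊤ := hbi.2.ne
  have hlim : ∀ᵐ z : R3, Tendsto (fun ε : ℝ => κ z * l1Modulus b (ε • z)) (𝓝[>] 0) (𝓝 0) := by
    filter_upwards [ae_lt_top hκ hκi.ne] with z hz
    have h1 : Tendsto (fun ε : ℝ => ε • z) (𝓝[>] 0) (𝓝 0) := by
      have : Tendsto (fun ε : ℝ => ε • z) (𝓝 0) (𝓝 ((0 : ℝ) • z)) :=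
        tendsto_id.smul_const z
      rw [zero_smul] at this
      exact this.mono_left nhdsWithin_le_nhds
    have h2 := ENNReal.Tendsto.const_mul ((tendsto_l1Modulus hbi).comp h1) (Or.inr hz.ne)
    simpa using h2
  have := tendsto_lintegral_filter_of_dominated_convergence
    (l := 𝓝[>] (0 : ℝ)) (μ := (volume : Measure R3)) (f := fun _ => 0)
    (fun z => κ z * (2 * ∫⁻ x, ‖b x‖ₑ))
    (F := fun (ε : ℝ) z => κ z * l1Modulus b (ε • z))
    (Eventually.of_forall fun ε => hκ.mul ((measurable_l1Modulus hb).comp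
      (measurable_const_smul ε)))
    (Eventually.of_forall fun ε => Eventually.of_forall fun z => by
      gcongr; exact l1Modulus_le hb _)
    (by rw [lintegral_mul_const _ hκ]; finiteness) hlim
  simpa using this

theorem measurable_comp_sub_smul {E : Type*} [MeasurableSpace E] {f : R3 → E} (hf : Measurable f)
    (ε : ℝ) : Measurable fun p : R3 × R3 => f (p.1 - ε • p.2) :=
  hf.comp (by fun_prop : Continuous fun p : R3 × R3 => p.1 - ε • p.2).measurable

theorem integrable_comp_sub_smul {E : Type*} [NormedAddCommGroup E] {f : R3 → E}
    (hf : Integrable f) {ε : ℝ} (hε : 0 < ε) (x : R3) : Integrable fun z => f (x - ε • z) :=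
  (hf.comp_sub_left x).comp_smul hε.ne'

theorem moll_sub_eq {b : R3 → ℝ} (hb : Integrable b) {ε : ℝ} (hε : 0 < ε) (x : R3) :
    moll ε b x - b x = ∫ z, bumpKernel z * (b (x - ε • z) - b x) := by
  have hint : Integrable fun z => bumpKernel z * b (x - ε • z) := by
    obtain ⟨c, hc⟩ :=
      bumpKernel_continuous.bounded_above_of_compact_support bumpKernel_hasCompactSupport
    exact (integrable_comp_sub_smul hb hε x).bdd_mul
      bumpKernel_continuous.aestronglyMeasurable (Eventually.of_forall hc)
  simp only [mul_sub]
  rw [integral_sub hint (integrable_bumpKernel.mul_const _), integral_mul_const,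
    integral_bumpKernel, one_mul, moll_eq hε]

/-- Mollification converges in `L¹`. -/
theorem tendsto_lintegral_moll_sub {b : R3 → ℝ} (hb : Measurable b) (hbi : Integrable b) :
    Tendsto (fun ε : ℝ => ∫⁻ x, ‖moll ε b x - b x‖ₑ) (𝓝[>] 0) (𝓝 0) := by
  have hη := bumpKernel_continuous.enorm.measurable
  refine tendsto_of_tendsto_of_tendsto_of_le_of_le' tendsto_const_nhds
    (tendsto_lintegral_l1Modulus hb hbi hη (by rw [lintegral_enorm_bumpKernel]; simp))
    (Eventually.of_forall fun _ => zero_le) ?_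
  filter_upwards [self_mem_nhdsWithin] with ε hε
  have hε : 0 < ε := hε
  have hm : Measurable (Function.uncurry fun (x z : R3) =>
      ‖bumpKernel z‖ₑ * ‖b (x - ε • z) - b x‖ₑ) :=
    (hη.comp measurable_snd).mul
      ((measurable_comp_sub_smul hb ε).sub (hb.comp measurable_fst)).enorm
  calc ∫⁻ x, ‖moll ε b x - b x‖ₑ
      ≤ ∫⁻ x, ∫⁻ z, ‖bumpKernel z‖ₑ * ‖b (x - ε • z) - b x‖ₑ := by
        refine lintegral_mono fun x => ?_
        rw [moll_sub_eq hbi hε]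
        refine (enorm_integral_le_lintegral_enorm _).trans (le_of_eq ?_)
        simp only [enorm_mul]
    _ = ∫⁻ z, ‖bumpKernel z‖ₑ * l1Modulus b (ε • z) := by
        rw [lintegral_lintegral_swap hm.aemeasurable]
        refine lintegral_congr fun z => ?_
        rw [lintegral_const_mul]
        · rfl
        · exact ((hb.comp (measurable_id.sub_const _)).sub hb).enorm

/-- The DiPerna–Lions commutator. -/
noncomputable def dpComm (ε : ℝ) (b : R3 → ℝ) (v : R3 → R3) (Dv : R3 → R3 →L[ℝ] R3) (x : R3) : ℝ :=
  ∫ z, commKernel ε b v Dv x z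

/-- The derivative of a smooth compactly supported field is globally Lipschitz; the mean value
inequality on the ball of radius `‖h‖` about `x` gives the quadratic remainder, uniformly in `x`. -/
theorem exists_taylor_bound {φ : R3 → R3} (hφ : ContDiff ℝ ∞ φ) (hc : HasCompactSupport φ) :
    ∃ L : NNReal, ∀ x h, ‖φ x - φ (x - h) - fderiv ℝ φ x h‖ ≤ L * ‖h‖ ^ 2 := by
  obtain ⟨L, hL⟩ := ((contDiff_infty_iff_fderiv.1 hφ).2.of_le (n := ∞) (m := 1) (by simp)).lipschitzWith_of_hasCompactSupport
    (hc.fderiv ℝ) (by simp)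
  refine ⟨L, fun x h => ?_⟩
  have key := (convex_closedBall x ‖h‖).norm_image_sub_le_of_norm_fderiv_le' (𝕜 := ℝ) (f := φ)
    (C := L * ‖h‖) (φ := fderiv ℝ φ x) (x := x - h) (y := x)
    (fun y _ => (hφ.differentiable (by simp)) y) (fun y hy => ?_) ?_ ?_
  · rw [sub_sub_cancel] at key
    calc _ ≤ _ := key
      _ = _ := by ring
  · rw [← dist_eq_norm]
    exact (hL.dist_le_mul y x).trans (mul_le_mul_of_nonneg_left hy L.2)
  · simp
  · simp

/-- After `b x` times an integral that vanishes is subtracted, two errors remain: the increment of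
`b` against a bounded kernel, and the Taylor remainder of `φ`, which is of order `ε` after division
by `ε`. -/
theorem enorm_dpComm_le_of_smooth {φ : R3 → R3} {L : NNReal} {M : NNReal} {b : R3 → ℝ} {ε : ℝ}
    (hε : 0 < ε) (hL : ∀ x h, ‖φ x - φ (x - h) - fderiv ℝ φ x h‖ ≤ L * ‖h‖ ^ 2)
    (hM : ∀ x, ‖fderiv ℝ φ x‖ ≤ M) (x : R3) :
    ‖dpComm ε b φ (fderiv ℝ φ) x‖ₑ ≤ ∫⁻ z, (M * (kernelDensity z * ‖b (x - ε • z) - b x‖ₑ)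
      + L * (‖ε‖ₑ * (‖b (x - ε • z)‖ₑ * (‖fderiv ℝ bumpKernel z‖ₑ * ‖z‖ₑ ^ 2)))) := by
  -- If the integrand is not integrable, the integral defining the commutator is zero by convention.
  by_cases hi : Integrable (commKernel ε b φ (fderiv ℝ φ) x)
  swap
  · rw [dpComm, integral_undef hi]; simp
  have hk : Integrable fun z => fderiv ℝ bumpKernel z (fderiv ℝ φ x z)
      + tr3 (fderiv ℝ φ x) * bumpKernel z := by
    refine Integrable.add ?_ (integrable_bumpKernel.const_mul _)
    exact (continuous_fderiv_bumpKernel.clm_apply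
      (fderiv ℝ φ x).continuous).integrable_of_hasCompactSupport
      ((bumpKernel_hasCompactSupport.fderiv ℝ).mono fun z hz hz' => hz (by simp [hz']))
  have hcomm : dpComm ε b φ (fderiv ℝ φ) x = ∫ z, (commKernel ε b φ (fderiv ℝ φ) x z
      - b x * (fderiv ℝ bumpKernel z (fderiv ℝ φ x z) + tr3 (fderiv ℝ φ x) * bumpKernel z)) := by
    rw [integral_sub hi (hk.const_mul _), integral_const_mul, integral_fderiv_bumpKernel_apply,
      mul_zero, sub_zero, dpComm]
  rw [hcomm]
  refine (enorm_integral_le_lintegral_enorm _).trans (lintegral_mono fun z => ?_)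
  -- The difference quotient of `φ` is split into its linear part `fderiv ℝ φ x z` and the rescaled
  -- Taylor remainder.
  have e : commKernel ε b φ (fderiv ℝ φ) x z
      - b x * (fderiv ℝ bumpKernel z (fderiv ℝ φ x z) + tr3 (fderiv ℝ φ x) * bumpKernel z)
      = (b (x - ε • z) - b x) * (fderiv ℝ bumpKernel z (fderiv ℝ φ x z)
        + tr3 (fderiv ℝ φ x) * bumpKernel z) + b (x - ε • z) *
        fderiv ℝ bumpKernel z (ε⁻¹ • (φ x - φ (x - ε • z) - fderiv ℝ φ x (ε • z))) := by
    rw [commKernel, smul_sub ε⁻¹ (φ x - φ (x - ε • z)), map_smul (fderiv ℝ φ x), smul_smul,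
      inv_mul_cancel₀ hε.ne', one_smul, map_sub]
    ring
  rw [e]
  have hM' : ‖fderiv ℝ φ x‖ₑ ≤ M := by
    rw [← enorm_norm, ← ofReal_norm, norm_norm, ← ENNReal.ofReal_coe_nnreal]
    exact ENNReal.ofReal_le_ofReal (hM x)
  have hL' : ‖ε⁻¹ • (φ x - φ (x - ε • z) - fderiv ℝ φ x (ε • z))‖ₑ ≤ L * (‖ε‖ₑ * ‖z‖ₑ ^ 2) := by
    have h1 : ‖ε⁻¹ • (φ x - φ (x - ε • z) - fderiv ℝ φ x (ε • z))‖ ≤ L * (ε * ‖z‖ ^ 2) := by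
      rw [norm_smul, norm_inv, Real.norm_of_nonneg hε.le, inv_mul_le_iff₀ hε]
      refine (hL x (ε • z)).trans (le_of_eq ?_)
      rw [norm_smul, Real.norm_of_nonneg hε.le]
      ring
    rw [← ofReal_norm]
    refine (ENNReal.ofReal_le_ofReal h1).trans (le_of_eq ?_)
    rw [ENNReal.ofReal_mul L.coe_nonneg, ENNReal.ofReal_mul hε.le, ENNReal.ofReal_pow (norm_nonneg _),
      ofReal_norm, Real.enorm_of_nonneg hε.le, ENNReal.ofReal_coe_nnreal]
  calc _ ≤ ‖b (x - ε • z) - b x‖ₑ * (‖fderiv ℝ bumpKernel z‖ₑ * (M * ‖z‖ₑ)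
        + 3 * M * ‖bumpKernel z‖ₑ) + ‖b (x - ε • z)‖ₑ *
          (‖fderiv ℝ bumpKernel z‖ₑ * (L * (‖ε‖ₑ * ‖z‖ₑ ^ 2))) := by
        refine (enorm_add_le _ _).trans (add_le_add ?_ ?_)
        · rw [enorm_mul]
          gcongr
          refine (enorm_add_le _ _).trans (add_le_add ?_ ?_)
          · refine ((fderiv ℝ bumpKernel z).le_opENorm _).trans ?_
            gcongr
            refine ((fderiv ℝ φ x).le_opENorm _).trans ?_
            gcongr
          · rw [enorm_mul]
            gcongr
            refine (enorm_tr3_le _).trans ?_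
            gcongr
        · rw [enorm_mul]
          gcongr
          refine ((fderiv ℝ bumpKernel z).le_opENorm _).trans ?_
          gcongr
    _ = _ := by rw [kernelDensity]; ring

/-- The commutator with a smooth field tends to zero in `L¹`. -/
theorem tendsto_lintegral_dpComm_of_smooth {φ : R3 → R3} (hφ : ContDiff ℝ ∞ φ)
    (hc : HasCompactSupport φ) {b : R3 → ℝ} (hb : Measurable b) (hbi : Integrable b) :
    Tendsto (fun ε : ℝ => ∫⁻ x, ‖dpComm ε b φ (fderiv ℝ φ) x‖ₑ) (𝓝[>] 0) (𝓝 0) := by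
  obtain ⟨L, hL⟩ := exists_taylor_bound hφ hc
  obtain ⟨M₀, hM₀⟩ :=
    (hφ.continuous_fderiv (by simp)).bounded_above_of_compact_support (hc.fderiv ℝ)
  obtain ⟨M, hM⟩ : ∃ M : NNReal, ∀ x, ‖fderiv ℝ φ x‖ ≤ M :=
    ⟨M₀.toNNReal, fun x => (hM₀ x).trans (Real.le_coe_toNNReal _)⟩
  have hκ2 : Measurable fun z => ‖fderiv ℝ bumpKernel z‖ₑ * ‖z‖ₑ ^ 2 :=
    continuous_fderiv_bumpKernel.enorm.measurable.mul (measurable_enorm.pow_const 2)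
  have hfin := lintegral_fderiv_bumpKernel_pow_lt_top 2
  have t1 := tendsto_lintegral_l1Modulus hb hbi measurable_kernelDensity
    lintegral_kernelDensity_lt_top
  have t2 : Tendsto (fun ε : ℝ => ‖ε‖ₑ) (𝓝[>] 0) (𝓝 0) := by
    have : Tendsto (fun ε : ℝ => ‖ε‖ₑ) (𝓝 0) (𝓝 ‖(0 : ℝ)‖ₑ) := continuous_enorm.tendsto 0
    rw [enorm_zero] at this
    exact this.mono_left nhdsWithin_le_nhds
  have t3 := (ENNReal.Tendsto.const_mul t1 (Or.inr (ENNReal.coe_ne_top (r := M)))).add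
    (ENNReal.Tendsto.const_mul (ENNReal.Tendsto.mul_const t2
      (Or.inr (ENNReal.mul_lt_top hbi.2 hfin).ne)) (Or.inr (ENNReal.coe_ne_top (r := L))))
  simp only [mul_zero, zero_mul, add_zero] at t3
  refine tendsto_of_tendsto_of_tendsto_of_le_of_le' tendsto_const_nhds t3
    (Eventually.of_forall fun _ => zero_le) ?_
  filter_upwards [self_mem_nhdsWithin] with ε hε
  have hε : 0 < ε := hε
  have m1 : Measurable (Function.uncurry fun x z : R3 =>
      kernelDensity z * ‖b (x - ε • z) - b x‖ₑ) :=
    (measurable_kernelDensity.comp measurable_snd).mul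
      ((measurable_comp_sub_smul hb ε).sub (hb.comp measurable_fst)).enorm
  have m2 : Measurable (Function.uncurry fun x z : R3 =>
      ‖b (x - ε • z)‖ₑ * (‖fderiv ℝ bumpKernel z‖ₑ * ‖z‖ₑ ^ 2)) :=
    (measurable_comp_sub_smul hb ε).enorm.mul (hκ2.comp measurable_snd)
  have s1 : ∀ x, Measurable fun z => kernelDensity z * ‖b (x - ε • z) - b x‖ₑ := fun x =>
    m1.of_uncurry_left
  have s2 : ∀ x, Measurable fun z =>
      ‖b (x - ε • z)‖ₑ * (‖fderiv ℝ bumpKernel z‖ₑ * ‖z‖ₑ ^ 2) := fun x =>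
    m2.of_uncurry_left
  refine (lintegral_mono fun x => enorm_dpComm_le_of_smooth hε hL hM x).trans ?_
  have e1 : ∀ x, ∫⁻ z, (M * (kernelDensity z * ‖b (x - ε • z) - b x‖ₑ)
      + L * (‖ε‖ₑ * (‖b (x - ε • z)‖ₑ * (‖fderiv ℝ bumpKernel z‖ₑ * ‖z‖ₑ ^ 2))))
      = M * (∫⁻ z, kernelDensity z * ‖b (x - ε • z) - b x‖ₑ)
      + L * (‖ε‖ₑ * ∫⁻ z, ‖b (x - ε • z)‖ₑ * (‖fderiv ℝ bumpKernel z‖ₑ * ‖z‖ₑ ^ 2)) := fun x => by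
    rw [lintegral_add_left ((s1 x).const_mul _), lintegral_const_mul _ (s1 x),
      lintegral_const_mul _ ((s2 x).const_mul _), lintegral_const_mul _ (s2 x)]
  simp only [e1]
  have r1 : Measurable fun x => ∫⁻ z, kernelDensity z * ‖b (x - ε • z) - b x‖ₑ :=
    m1.lintegral_prod_right'
  have r2 : Measurable fun x => ∫⁻ z,
      ‖b (x - ε • z)‖ₑ * (‖fderiv ℝ bumpKernel z‖ₑ * ‖z‖ₑ ^ 2) := m2.lintegral_prod_right'
  rw [lintegral_add_left (r1.const_mul _), lintegral_const_mul _ r1,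
    lintegral_const_mul _ (r2.const_mul _), lintegral_const_mul _ r2]
  rw [lintegral_lintegral_swap m1.aemeasurable, lintegral_lintegral_swap m2.aemeasurable]
  have f1 : ∀ z, ∫⁻ x, kernelDensity z * ‖b (x - ε • z) - b x‖ₑ
      = kernelDensity z * l1Modulus b (ε • z) := fun z => by
    have : Measurable fun x => ‖b (x - ε • z) - b x‖ₑ :=
      ((hb.comp (measurable_id.sub_const _)).sub hb).enorm
    rw [lintegral_const_mul _ this]; rfl
  have f2 : ∀ z, ∫⁻ x, ‖b (x - ε • z)‖ₑ * (‖fderiv ℝ bumpKernel z‖ₑ * ‖z‖ₑ ^ 2)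
      = (∫⁻ x, ‖b x‖ₑ) * (‖fderiv ℝ bumpKernel z‖ₑ * ‖z‖ₑ ^ 2) := fun z => by
    have : Measurable fun x => ‖b (x - ε • z)‖ₑ := (hb.comp (measurable_id.sub_const _)).enorm
    rw [lintegral_mul_const _ this,
      lintegral_sub_right_eq_self (fun x => ‖b x‖ₑ)]
  simp only [f1, f2]
  rw [lintegral_const_mul _ hκ2]

/-- Linearity in the field allows replacing a rough velocity by a smooth one at the cost of a
commutator with their difference. -/
theorem commKernel_sub (ε : ℝ) (b : R3 → ℝ) (v φ : R3 → R3) (Dv Dφ : R3 → R3 →L[ℝ] R3)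
    (x z : R3) : commKernel ε b (fun x => v x - φ x) (fun x => Dv x - Dφ x) x z
      = commKernel ε b v Dv x z - commKernel ε b φ Dφ x z := by
  simp only [commKernel, map_sub, map_smul, smul_eq_mul]
  ring

theorem IsH10.sub {Ω : Set R3} {v w : R3 → R3} {Dv Dw : R3 → R3 →L[ℝ] R3} (h : IsH10 Ω v Dv)
    (h' : IsH10 Ω w Dw) : IsH10 Ω (fun x => v x - w x) (fun x => Dv x - Dw x) := by
  obtain ⟨m1, m2, φ, hφ, t1, t2⟩ := h
  obtain ⟨m1', m2', ψ, hψ, t1', t2'⟩ := h'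
  refine ⟨m1.sub m1', m2.sub m2', fun j x => φ j x - ψ j x, fun j => ⟨(hφ j).1.sub (hψ j).1,
    (hφ j).2.1.sub (hψ j).2.1,
    (tsupport_sub _ _).trans (union_subset (hφ j).2.2 (hψ j).2.2)⟩, ?_, ?_⟩
  · have := t1.add t1'
    rw [add_zero] at this
    refine tendsto_of_tendsto_of_tendsto_of_le_of_le tendsto_const_nhds this
      (fun _ => zero_le) fun j => ?_
    have e : (fun x => φ j x - ψ j x - (v x - w x))
        = (fun x => φ j x - v x) - fun x => ψ j x - w x := by
      ext1 x; simp only [Pi.sub_apply]; abel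
    rw [e]
    exact eLpNorm_sub_le ((hφ j).1.continuous.aestronglyMeasurable.sub m1.1)
      ((hψ j).1.continuous.aestronglyMeasurable.sub m1'.1) (by norm_num)
  · have := t2.add t2'
    rw [add_zero] at this
    refine tendsto_of_tendsto_of_tendsto_of_le_of_le tendsto_const_nhds this
      (fun _ => zero_le) fun j => ?_
    have e : (fun x => fderiv ℝ (fun x => φ j x - ψ j x) x - (Dv x - Dw x))
        = (fun x => fderiv ℝ (φ j) x - Dv x) - fun x => fderiv ℝ (ψ j) x - Dw x := by
      ext1 x
      rw [fderiv_fun_sub ((hφ j).1.differentiable (by simp) x)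
        ((hψ j).1.differentiable (by simp) x)]
      simp only [Pi.sub_apply]; abel
    rw [e]
    exact eLpNorm_sub_le
      (((hφ j).1.continuous_fderiv (by simp)).aestronglyMeasurable.sub m2.1)
      (((hψ j).1.continuous_fderiv (by simp)).aestronglyMeasurable.sub m2'.1) (by norm_num)

theorem eLpNorm_sub_self_fun {α E : Type*} [MeasurableSpace α] [NormedAddCommGroup E]
    (f : α → E) (p : ENNReal) (μ : Measure α) : eLpNorm (fun x => f x - f x) p μ = 0 := by
  have : (fun x => f x - f x) = (0 : α → E) := by ext; simp
  rw [this, eLpNorm_zero]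

theorem isH10_of_smooth {Ω : Set R3} {φ : R3 → R3} (hφ : ContDiff ℝ ∞ φ)
    (hc : HasCompactSupport φ) (hs : tsupport φ ⊆ Ω) : IsH10 Ω φ (fderiv ℝ φ) := by
  have hφ' : Continuous (fderiv ℝ φ) := hφ.continuous_fderiv (by simp)
  have m1 : MemLp φ 2 (volume : Measure R3) := hφ.continuous.memLp_of_hasCompactSupport hc
  have m2 : MemLp (fderiv ℝ φ) 2 (volume : Measure R3) :=
    hφ'.memLp_of_hasCompactSupport (hc.fderiv ℝ)
  refine ⟨m1.restrict Ω, m2.restrict Ω, fun _ => φ, fun _ => ⟨hφ, hc, hs⟩, ?_, ?_⟩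
  · simp only [eLpNorm_sub_self_fun]
    exact tendsto_const_nhds
  · simp only [eLpNorm_sub_self_fun]
    exact tendsto_const_nhds

/-- The `L¹` bound for the commutator. -/
theorem lintegral_dpComm_le {ε : ℝ} (hε : 0 < ε) {b : R3 → ℝ} {v : R3 → R3}
    {Dv : R3 → R3 →L[ℝ] R3} (hb : Measurable b) (hv : Measurable v) (hDv : Measurable Dv)
    (htr : ∀ z, eLpNorm (fun x => v (x - z) - v x) 2 volume ≤ ‖z‖ₑ * eLpNorm Dv 2 volume) :
    ∫⁻ x, ‖dpComm ε b v Dv x‖ₑ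
      ≤ (∫⁻ z, kernelDensity z) * (eLpNorm b 2 volume * eLpNorm Dv 2 volume) :=
  (lintegral_mono fun _ => enorm_integral_le_lintegral_enorm _).trans
    (lintegral_commKernel_le hε hb hv hDv htr)

theorem IsH10.translate_volume {Ω : Set R3} (hΩ : MeasurableSet Ω) {v : R3 → R3}
    {Dv : R3 → R3 →L[ℝ] R3} (h : IsH10 Ω v Dv) (hv : ∀ x, x ∉ Ω → v x = 0)
    (hDv : ∀ x, x ∉ Ω → Dv x = 0) (z : R3) :
    eLpNorm (fun x => v (x - z) - v x) 2 volume ≤ ‖z‖ₑ * eLpNorm Dv 2 volume := by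
  rw [← eLpNorm_restrict_of_support hΩ hDv]
  exact h.eLpNorm_sub_translate_le hΩ hv z

/-- The commutator of a square integrable function with a field in `H¹₀` tends to zero
in `L¹`. -/
theorem tendsto_lintegral_dpComm {Ω : Set R3} (hΩ : MeasurableSet Ω) {b : R3 → ℝ} {v : R3 → R3}
    {Dv : R3 → R3 →L[ℝ] R3} (hb : Measurable b) (hbi : Integrable b) (hb2 : MemLp b 2 volume)
    (hv : Measurable v) (hDv : Measurable Dv) (h : IsH10 Ω v Dv) (hv0 : ∀ x, x ∉ Ω → v x = 0)
    (hDv0 : ∀ x, x ∉ Ω → Dv x = 0) :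
    Tendsto (fun ε : ℝ => ∫⁻ x, ‖dpComm ε b v Dv x‖ₑ) (𝓝[>] 0) (𝓝 0) := by
  obtain ⟨φ, hφ, -, h2⟩ := h.exists_approx hΩ hv0 hDv0
  set A : ENNReal := (∫⁻ z, kernelDensity z) * eLpNorm b 2 volume with hA
  have hAfin : A ≠ ⊤ := (ENNReal.mul_lt_top lintegral_kernelDensity_lt_top hb2.2).ne
  -- Density argument: the commutator with `v - φ j` is bounded uniformly in `ε` by the `L²`
  -- distance of the derivatives.
  have hbound : ∀ j, ∀ ε : ℝ, 0 < ε → ∫⁻ x, ‖dpComm ε b v Dv x‖ₑ ≤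
      (∫⁻ x, ‖dpComm ε b (φ j) (fderiv ℝ (φ j)) x‖ₑ)
        + A * eLpNorm (fun x => fderiv ℝ (φ j) x - Dv x) 2 volume := by
    intro j ε hε
    have hφm : Measurable (φ j) := (hφ j).1.continuous.measurable
    have hφD : Measurable (fderiv ℝ (φ j)) := ((hφ j).1.continuous_fderiv (by simp)).measurable
    have z1 : ∀ x, x ∉ Ω → φ j x = 0 := fun x hx =>
      image_eq_zero_of_notMem_tsupport fun hm => hx ((hφ j).2.2 hm)
    have z2 : ∀ x, x ∉ Ω → fderiv ℝ (φ j) x = 0 := fun x hx =>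
      image_eq_zero_of_notMem_tsupport fun hm => hx ((hφ j).2.2 (tsupport_fderiv_subset ℝ hm))
    have hφH := isH10_of_smooth (hφ j).1 (hφ j).2.1 (hφ j).2.2
    have hd := h.sub hφH
    have k1 := lintegral_commKernel_le hε hb (v := fun x => v x - φ j x)
      (Dv := fun x => Dv x - fderiv ℝ (φ j) x) (hv.sub hφm) (hDv.sub hφD)
      (hd.translate_volume hΩ (fun x hx => by rw [hv0 x hx, z1 x hx, sub_zero])
        (fun x hx => by rw [hDv0 x hx, z2 x hx, sub_zero]))
    have k2 := lintegral_commKernel_le hε hb hφm hφD (hφH.translate_volume hΩ z1 z2)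
    have k3 := lintegral_commKernel_le hε hb hv hDv (h.translate_volume hΩ hv0 hDv0)
    have mφ := measurable_commKernel (ε := ε) hb hφm hφD
    have mv := measurable_commKernel (ε := ε) hb hv hDv
    -- Finiteness at almost every `x` is what allows the integral of the difference of two kernels
    -- to be split.
    have iv : ∀ᵐ x, ∫⁻ z, ‖commKernel ε b v Dv x z‖ₑ < ⊤ :=
      ae_lt_top mv.enorm.lintegral_prod_right' (lt_of_le_of_lt k3 (ENNReal.mul_lt_top
        lintegral_kernelDensity_lt_top (ENNReal.mul_lt_top hb2.2
          (by rw [← eLpNorm_restrict_of_support hΩ hDv0]; exact h.2.1.2)))).ne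
    have iφ : ∀ᵐ x, ∫⁻ z, ‖commKernel ε b (φ j) (fderiv ℝ (φ j)) x z‖ₑ < ⊤ :=
      ae_lt_top mφ.enorm.lintegral_prod_right' (lt_of_le_of_lt k2 (ENNReal.mul_lt_top
        lintegral_kernelDensity_lt_top (ENNReal.mul_lt_top hb2.2
          (by rw [← eLpNorm_restrict_of_support hΩ z2]; exact hφH.2.1.2)))).ne
    calc ∫⁻ x, ‖dpComm ε b v Dv x‖ₑ ≤ ∫⁻ x, (‖dpComm ε b (φ j) (fderiv ℝ (φ j)) x‖ₑ + ∫⁻ z,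
          ‖commKernel ε b (fun x => v x - φ j x) (fun x => Dv x - fderiv ℝ (φ j) x) x z‖ₑ) := by
          refine lintegral_mono_ae ?_
          filter_upwards [iv, iφ] with x h1 h2
          have I1 : Integrable (commKernel ε b v Dv x) :=
            ⟨(mv.comp measurable_prodMk_left).aestronglyMeasurable, h1⟩
          have I2 : Integrable (commKernel ε b (φ j) (fderiv ℝ (φ j)) x) :=
            ⟨(mφ.comp measurable_prodMk_left).aestronglyMeasurable, h2⟩
          have e : dpComm ε b v Dv x = dpComm ε b (φ j) (fderiv ℝ (φ j)) x + ∫ z,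
              commKernel ε b (fun x => v x - φ j x) (fun x => Dv x - fderiv ℝ (φ j) x) x z := by
            simp only [commKernel_sub]
            rw [integral_sub I1 I2, dpComm, dpComm]; ring
          rw [e]
          exact (enorm_add_le _ _).trans
            (add_le_add_right (enorm_integral_le_lintegral_enorm _) _)
      _ = _ := lintegral_add_right _
          (measurable_commKernel hb (hv.sub hφm) (hDv.sub hφD)).enorm.lintegral_prod_right'
      _ ≤ _ := by
          refine add_le_add_right (k1.trans (le_of_eq ?_)) _
          rw [hA, mul_assoc]
          congr 2
          exact eLpNorm_sub_comm Dv (fderiv ℝ (φ j)) 2 volume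
  rw [ENNReal.tendsto_nhds_zero]
  intro δ hδ
  have h3 : Tendsto (fun j => A * eLpNorm (fun x => fderiv ℝ (φ j) x - Dv x) 2 volume) atTop
      (𝓝 0) := by
    have := ENNReal.Tendsto.const_mul h2 (Or.inr hAfin)
    rwa [mul_zero] at this
  have hδ2 : 0 < δ / 2 := ENNReal.half_pos hδ.ne'
  -- The smooth field is fixed first, and only then is `ε` taken small.
  obtain ⟨j, hj⟩ := ((ENNReal.tendsto_nhds_zero.1 h3) (δ / 2) hδ2).exists
  have h4 := (ENNReal.tendsto_nhds_zero.1
    (tendsto_lintegral_dpComm_of_smooth (hφ j).1 (hφ j).2.1 hb hbi)) (δ / 2) hδ2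
  filter_upwards [h4, self_mem_nhdsWithin] with ε h5 hε
  calc _ ≤ _ := hbound j ε hε
    _ ≤ δ / 2 + δ / 2 := add_le_add h5 hj
    _ = δ := ENNReal.add_halves δ

/-! ### The mollified equation and its renormalization -/

/-- The flux of `b v` through the mollifying kernel centred at `x`, that is `-div (b v)_ε`. -/
noncomputable def mollFlux (ε : ℝ) (b : R3 → ℝ) (v : R3 → R3) (x : R3) : ℝ :=
  ∫ y, fderiv ℝ (fun y => mollKernel ε (x - y)) y (b y • v y)

theorem fderiv_mollKernel_sub (ε : ℝ) (x y V : R3) :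
    fderiv ℝ (fun y => mollKernel ε (x - y)) y V
      = -(ε⁻¹ ^ 3 * (ε⁻¹ * fderiv ℝ bumpKernel (ε⁻¹ • (x - y)) V)) := by
  rw [← fderiv_mollKernel]
  have h1 : HasFDerivAt (fun y : R3 => x - y) (-ContinuousLinearMap.id ℝ R3) y :=
    (hasFDerivAt_id y).const_sub x
  have h2 := (((mollKernel_contDiff ε).differentiable (by simp)) (x - y)).hasFDerivAt.comp y h1
  have h3 : fderiv ℝ (fun y => mollKernel ε (x - y)) y = _ := h2.fderiv
  rw [h3]
  simp

theorem mollFlux_eq {ε : ℝ} (hε : 0 < ε) (b : R3 → ℝ) (v : R3 → R3) (x : R3) :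
    mollFlux ε b v x
      = -(ε⁻¹ * ∫ z, fderiv ℝ bumpKernel z (b (x - ε • z) • v (x - ε • z))) := by
  simp only [mollFlux, fderiv_mollKernel_sub]
  rw [integral_rescale hε x
    (fun y z => -(ε⁻¹ ^ 3 * (ε⁻¹ * fderiv ℝ bumpKernel z (b y • v y))))]
  simp only [integral_neg, integral_const_mul, smul_eq_mul, mul_neg]
  rw [← mul_assoc, ← mul_pow, mul_inv_cancel₀ hε.ne', one_pow, one_mul]

theorem integrable_fderiv_bumpKernel_apply {g : R3 → R3} (hg : Integrable g) :
    Integrable fun z => fderiv ℝ bumpKernel z (g z) := by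
  obtain ⟨C, hC⟩ := continuous_fderiv_bumpKernel.bounded_above_of_compact_support
    (bumpKernel_hasCompactSupport.fderiv ℝ)
  refine (hg.norm.const_mul C).mono' ?_ (Eventually.of_forall fun z => ?_)
  · exact (isBoundedBilinearMap_apply (𝕜 := ℝ) (E := R3) (F := ℝ)).continuous.comp_aestronglyMeasurable
      (continuous_fderiv_bumpKernel.aestronglyMeasurable.prodMk hg.aestronglyMeasurable)
  · exact ((fderiv ℝ bumpKernel z).le_opNorm _).trans
      (mul_le_mul_of_nonneg_right (hC z) (norm_nonneg _))

theorem integrable_mul_fderiv_bumpKernel {g : R3 → ℝ} (hg : Integrable g) (V : R3) :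
    Integrable fun z => g z * fderiv ℝ bumpKernel z V := by
  have := integrable_fderiv_bumpKernel_apply (hg.smul_const V)
  simpa only [map_smul, smul_eq_mul] using this

theorem integrable_mul_bumpKernel {g : R3 → ℝ} (hg : Integrable g) :
    Integrable fun z => g z * bumpKernel z := by
  obtain ⟨c, hc⟩ :=
    bumpKernel_continuous.bounded_above_of_compact_support bumpKernel_hasCompactSupport
  exact hg.mul_bdd bumpKernel_continuous.aestronglyMeasurable (Eventually.of_forall hc)

/-- The mollified density satisfies `∂ₜ b_ε + v · ∇b_ε + b_ε div v = r_ε`, where `r_ε` is the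
commutator: the right-hand side here is this time derivative. -/
theorem mollFlux_eq_dpComm {ε : ℝ} (hε : 0 < ε) {b : R3 → ℝ} {v : R3 → R3}
    (Dv : R3 → R3 →L[ℝ] R3) (hb : Integrable b) (hbv : Integrable fun y => b y • v y) (x : R3) :
    mollFlux ε b v x = dpComm ε b v Dv x - fderiv ℝ (moll ε b) x (v x)
      - tr3 (Dv x) * moll ε b x := by
  have i0 := integrable_comp_sub_smul hb hε x
  have i1 := (integrable_mul_fderiv_bumpKernel i0 (v x)).const_mul ε⁻¹
  have i2 := (integrable_fderiv_bumpKernel_apply (integrable_comp_sub_smul hbv hε x)).const_mul ε⁻¹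
  have i3 := (integrable_mul_bumpKernel i0).const_mul (tr3 (Dv x))
  have e : ∀ z, commKernel ε b v Dv x z = ε⁻¹ * (b (x - ε • z) * fderiv ℝ bumpKernel z (v x))
      - ε⁻¹ * fderiv ℝ bumpKernel z (b (x - ε • z) • v (x - ε • z))
      + tr3 (Dv x) * (b (x - ε • z) * bumpKernel z) := by
    intro z
    simp only [commKernel, map_sub, map_smul, smul_eq_mul]
    ring
  simp only [dpComm, e]
  have i12 : Integrable fun z => ε⁻¹ * (b (x - ε • z) * fderiv ℝ bumpKernel z (v x))
      - ε⁻¹ * fderiv ℝ bumpKernel z (b (x - ε • z) • v (x - ε • z)) := i1.sub i2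
  rw [integral_add i12 i3, integral_sub i1 i2, integral_const_mul, integral_const_mul,
    integral_const_mul, mollFlux_eq hε, fderiv_moll hε hb.locallyIntegrable, moll_eq hε]
  simp only [mul_comm (bumpKernel _)]
  ring

theorem hasCompactSupport_of_isBounded {E : Type*} [Zero E] {Ω : Set R3}
    (hΩ : Bornology.IsBounded Ω) {f : R3 → E} (hf : ∀ x, x ∉ Ω → f x = 0) : HasCompactSupport f :=
  HasCompactSupport.of_support_subset_isCompact hΩ.isCompact_closure fun x hx =>
    subset_closure (by_contra fun h => hx (hf x h))

theorem moll_hasCompactSupport {ε : ℝ} (hε : 0 < ε) {f : R3 → ℝ} (hf : HasCompactSupport f) :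
    HasCompactSupport (moll ε f) := by
  rw [moll_eq_convolution]
  exact hf.convolution (ContinuousLinearMap.mul ℝ ℝ) (mollKernel_hasCompactSupport hε)

theorem moll_nonneg {ε : ℝ} (hε : 0 < ε) {f : R3 → ℝ} (hf : ∀ x, 0 ≤ f x) (x : R3) :
    0 ≤ moll ε f x :=
  integral_nonneg fun y => mul_nonneg (mollKernel_nonneg hε _) (hf y)

theorem integrable_mollKernel_mul {ε : ℝ} (hε : 0 < ε) {f : R3 → ℝ} (hf : Integrable f) (x : R3) :
    Integrable fun y => mollKernel ε (x - y) * f y := by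
  obtain ⟨C, hC⟩ := (mollKernel_contDiff ε).continuous.bounded_above_of_compact_support
    (mollKernel_hasCompactSupport hε)
  exact hf.bdd_mul ((mollKernel_contDiff ε).continuous.comp
    (continuous_const.sub continuous_id)).aestronglyMeasurable
    (Eventually.of_forall fun y => hC (x - y))

theorem moll_mono {ε : ℝ} (hε : 0 < ε) {f g : R3 → ℝ} (hf : Integrable f) (hg : Integrable g)
    (h : ∀ x, f x ≤ g x) (x : R3) : moll ε f x ≤ moll ε g x :=
  integral_mono (integrable_mollKernel_mul hε hf x) (integrable_mollKernel_mul hε hg x)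
    fun y => mul_le_mul_of_nonneg_left (h y) (mollKernel_nonneg hε _)

theorem integrable_fderiv_apply_of_memLp {F : R3 → ℝ} (hF : ContDiff ℝ 1 F)
    (hc : HasCompactSupport F) {w : R3 → R3} (hw : MemLp w 2 volume) :
    Integrable fun x => fderiv ℝ F x (w x) := by
  have hF' : Continuous (fderiv ℝ F) := hF.continuous_fderiv (by simp)
  have h2 : MemLp (fderiv ℝ F) 2 (volume : Measure R3) :=
    hF'.memLp_of_hasCompactSupport (hc.fderiv ℝ)
  refine ⟨(isBoundedBilinearMap_apply (𝕜 := ℝ) (E := R3) (F := ℝ)).continuous.comp_aestronglyMeasurable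
      (hF'.aestronglyMeasurable.prodMk hw.aestronglyMeasurable), ?_⟩
  refine lt_of_le_of_lt (lintegral_mono fun x => (fderiv ℝ F x).le_opENorm (w x)) ?_
  exact lt_of_le_of_lt (lintegral_enorm_mul_le h2.1 hw.1) (ENNReal.mul_lt_top h2.2 hw.2)

theorem integrable_mul_tr3_of_memLp {F : R3 → ℝ} (hF : MemLp F 2 volume)
    {A : R3 → R3 →L[ℝ] R3} (hA : MemLp A 2 volume) : Integrable fun x => F x * tr3 (A x) := by
  refine ⟨hF.1.mul (tr3.continuous.comp_aestronglyMeasurable hA.1), ?_⟩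
  have hm : MemLp (fun x => tr3 (A x)) 2 volume := by
    refine ⟨tr3.continuous.comp_aestronglyMeasurable hA.1, ?_⟩
    refine lt_of_le_of_lt (eLpNorm_le_mul_eLpNorm_of_ae_le_mul (c := 3)
      (Eventually.of_forall fun x => norm_tr3_le (A x)) 2) ?_
    exact ENNReal.mul_lt_top ENNReal.ofReal_lt_top hA.2
  refine lt_of_le_of_lt (le_of_eq ?_) (lt_of_le_of_lt (lintegral_enorm_mul_le hF.1 hm.1)
    (ENNReal.mul_lt_top hF.2 hm.2))
  exact lintegral_congr fun x => enorm_mul _ _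

/-- Integration by parts against a field in `H¹₀`. -/
theorem IsH10.integral_fderiv_apply_eq {Ω : Set R3} (hΩ : MeasurableSet Ω) {v : R3 → R3}
    {Dv : R3 → R3 →L[ℝ] R3} (h : IsH10 Ω v Dv) (hv : ∀ x, x ∉ Ω → v x = 0)
    (hDv : ∀ x, x ∉ Ω → Dv x = 0) {F : R3 → ℝ} (hF : ContDiff ℝ 1 F)
    (hc : HasCompactSupport F) :
    ∫ x, fderiv ℝ F x (v x) = - ∫ x, F x * tr3 (Dv x) := by
  obtain ⟨φ, hφ, h1, h2⟩ := h.exists_approx hΩ hv hDv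
  have hF' : Continuous (fderiv ℝ F) := hF.continuous_fderiv (by simp)
  have mF : MemLp F 2 (volume : Measure R3) := hF.continuous.memLp_of_hasCompactSupport hc
  have mF' : MemLp (fderiv ℝ F) 2 (volume : Measure R3) :=
    hF'.memLp_of_hasCompactSupport (hc.fderiv ℝ)
  have mv : MemLp v 2 volume := ⟨aestronglyMeasurable_of_support hΩ hv h.1.1, by
    rw [← eLpNorm_restrict_of_support hΩ hv]; exact h.1.2⟩
  have mDv : MemLp Dv 2 volume := ⟨aestronglyMeasurable_of_support hΩ hDv h.2.1.1, by
    rw [← eLpNorm_restrict_of_support hΩ hDv]; exact h.2.1.2⟩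
  have mφ : ∀ j, MemLp (φ j) 2 (volume : Measure R3) := fun j =>
    (hφ j).1.continuous.memLp_of_hasCompactSupport (hφ j).2.1
  have mφ' : ∀ j, MemLp (fderiv ℝ (φ j)) 2 (volume : Measure R3) := fun j =>
    ((hφ j).1.continuous_fderiv (by simp)).memLp_of_hasCompactSupport ((hφ j).2.1.fderiv ℝ)
  have t1 : Tendsto (fun j => ∫ x, fderiv ℝ F x (φ j x)) atTop
      (𝓝 (∫ x, fderiv ℝ F x (v x))) := by
    refine tendsto_integral_of_L1 _ (integrable_fderiv_apply_of_memLp hF hc mv).1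
      (Eventually.of_forall fun j => integrable_fderiv_apply_of_memLp hF hc (mφ j)) ?_
    have := ENNReal.Tendsto.const_mul h1 (Or.inr mF'.2.ne)
    rw [mul_zero] at this
    refine tendsto_of_tendsto_of_tendsto_of_le_of_le tendsto_const_nhds this
      (fun _ => zero_le) fun j => ?_
    refine le_trans (lintegral_mono fun x => ?_)
      (lintegral_enorm_mul_le mF'.1 ((mφ j).1.sub mv.1))
    rw [← map_sub]
    exact (fderiv ℝ F x).le_opENorm _
  have t2 : Tendsto (fun j => ∫ x, F x * tr3 (fderiv ℝ (φ j) x)) atTop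
      (𝓝 (∫ x, F x * tr3 (Dv x))) := by
    refine tendsto_integral_of_L1 _ (integrable_mul_tr3_of_memLp mF mDv).1
      (Eventually.of_forall fun j => integrable_mul_tr3_of_memLp mF (mφ' j)) ?_
    have := ENNReal.Tendsto.const_mul h2
      (Or.inr (ENNReal.mul_lt_top (show (3 : ENNReal) < ⊤ by simp) mF.2).ne)
    rw [mul_zero] at this
    refine tendsto_of_tendsto_of_tendsto_of_le_of_le tendsto_const_nhds this
      (fun _ => zero_le) fun j => ?_
    have hm : AEMeasurable (fun x => ‖F x‖ₑ * ‖fderiv ℝ (φ j) x - Dv x‖ₑ) volume :=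
      mF.1.enorm.mul ((mφ' j).1.sub mDv.1).enorm
    calc _ ≤ ∫⁻ x, 3 * (‖F x‖ₑ * ‖fderiv ℝ (φ j) x - Dv x‖ₑ) := by
          refine lintegral_mono fun x => ?_
          rw [← mul_sub, ← map_sub, enorm_mul]
          calc _ ≤ ‖F x‖ₑ * (3 * ‖fderiv ℝ (φ j) x - Dv x‖ₑ) := by
                gcongr; exact enorm_tr3_le _
            _ = _ := by ring
      _ ≤ _ := by
          rw [lintegral_const_mul'' _ hm, mul_assoc]
          gcongr
          exact lintegral_enorm_mul_le mF.1 ((mφ' j).1.sub mDv.1)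
  refine tendsto_nhds_unique t1 ?_
  refine t2.neg.congr fun j => ?_
  exact (_root_.integral_fderiv_apply_eq hF ((hφ j).1.of_le (by simp)) (Or.inl hc)).symm

theorem measurable_dpComm {ε : ℝ} {b : R3 → ℝ} {v : R3 → R3} {Dv : R3 → R3 →L[ℝ] R3}
    (hb : Measurable b) (hv : Measurable v) (hDv : Measurable Dv) :
    Measurable (dpComm ε b v Dv) :=
  (measurable_commKernel hb hv hDv).stronglyMeasurable.integral_prod_right.measurable

/-- The space integral of the mollified renormalized equation is controlled by the
commutators. -/
theorem enorm_integral_mollFlux_le {Ω : Set R3} (hΩ : MeasurableSet Ω)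
    (hΩb : Bornology.IsBounded Ω) {b d : R3 → ℝ} {v : R3 → R3} {Dv : R3 → R3 →L[ℝ] R3}
    (hb : Measurable b) (hd : Measurable d) (hv : Measurable v) (hDv : Measurable Dv)
    (hb0 : ∀ x, x ∉ Ω → b x = 0) (hv0 : ∀ x, x ∉ Ω → v x = 0)
    (hDv0 : ∀ x, x ∉ Ω → Dv x = 0) (hbpos : ∀ x, 0 ≤ b x) (hbd : ∀ x, b x ≤ d x)
    (hbi : Integrable b) (hdi : Integrable d) (hb2 : MemLp b 2 volume) (hd2 : MemLp d 2 volume)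
    (hH : IsH10 Ω v Dv) (hDvi : Integrable Dv) {ε δ : ℝ} (hε : 0 < ε) (hδ : 0 < δ) :
    ‖∫ x, (2 * (moll ε b x / (moll ε d x + δ)) * mollFlux ε b v x
      - (moll ε b x / (moll ε d x + δ)) ^ 2 * mollFlux ε d v x)‖ₑ
      ≤ 2 * (∫⁻ x, ‖dpComm ε b v Dv x‖ₑ) + (∫⁻ x, ‖dpComm ε d v Dv x‖ₑ)
        + 3 * ENNReal.ofReal δ * ∫⁻ x, ‖Dv x‖ₑ := by
  have mv : MemLp v 2 volume := ⟨aestronglyMeasurable_of_support hΩ hv0 hH.1.1, by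
    rw [← eLpNorm_restrict_of_support hΩ hv0]; exact hH.1.2⟩
  have mDv : MemLp Dv 2 volume := ⟨aestronglyMeasurable_of_support hΩ hDv0 hH.2.1.1, by
    rw [← eLpNorm_restrict_of_support hΩ hDv0]; exact hH.2.1.2⟩
  have ibv : ∀ {f : R3 → ℝ}, MemLp f 2 volume → Integrable fun y => f y • v y := fun hf =>
    memLp_one_iff_integrable.1 (mv.smul hf)
  set B := moll ε b with hB
  set D := moll ε d with hD
  have cB : ContDiff ℝ 1 B := (moll_contDiff hε hbi.locallyIntegrable).of_le (by simp)
  have cD : ContDiff ℝ 1 D := (moll_contDiff hε hdi.locallyIntegrable).of_le (by simp)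
  have B0 : ∀ x, 0 ≤ B x := moll_nonneg hε hbpos
  have D0 : ∀ x, 0 ≤ D x := moll_nonneg hε fun x => (hbpos x).trans (hbd x)
  have BD : ∀ x, B x ≤ D x := moll_mono hε hbi hdi hbd
  have Dδ : ∀ x, 0 < D x + δ := fun x => by linarith [D0 x]
  -- The partial derivatives of `B² / (D + δ)` are `2a` and `-a²`; since `0 ≤ a ≤ 1` they are
  -- bounded independently of `δ`.
  set a : R3 → ℝ := fun x => B x / (D x + δ) with ha
  have a0 : ∀ x, 0 ≤ a x := fun x => div_nonneg (B0 x) (Dδ x).le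
  have a1 : ∀ x, a x ≤ 1 := fun x => (div_le_one (Dδ x)).2 (by linarith [BD x])
  have ca : Continuous a := cB.continuous.div (cD.continuous.add continuous_const)
    fun x => (Dδ x).ne'
  set F : R3 → ℝ := fun x => B x ^ 2 / (D x + δ) with hF
  have cF : ContDiff ℝ 1 F := (cB.pow 2).div (cD.add contDiff_const) fun x => (Dδ x).ne'
  -- Boundedness of `Ω` makes the support compact, so no term at infinity appears in the integration
  -- by parts below.
  have sF : HasCompactSupport F :=
    (moll_hasCompactSupport hε (hasCompactSupport_of_isBounded hΩb hb0)).mono fun x hx hx' => hx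
      (by simp only [hF, hB, hx']; simp)
  have dF : ∀ x V, fderiv ℝ F x V = 2 * a x * fderiv ℝ B x V - a x ^ 2 * fderiv ℝ D x V := by
    intro x V
    have h1 := ((cB.differentiable (by simp)) x).hasFDerivAt
    have h2 := ((cD.differentiable (by simp)) x).hasFDerivAt
    have h3 := (h1.pow 2).mul ((hasDerivAt_inv (Dδ x).ne').comp_hasFDerivAt x (h2.add_const δ))
    have h4 : (fun y => B y ^ 2) * ((fun y => y⁻¹) ∘ fun y => D y + δ) = F := by
      ext y; simp [hF, div_eq_mul_inv]
    rw [h4] at h3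
    rw [h3.fderiv]
    have := (Dδ x).ne'
    simp [ha]
    field_simp
    ring
  -- The transport terms combine to the divergence of `F v`. The quotient fails to be homogeneous of
  -- degree one by `δ a²`, which leaves the extra term `δ a² div v`.
  have hpt : ∀ x, 2 * a x * mollFlux ε b v x - a x ^ 2 * mollFlux ε d v x
      = (2 * a x * dpComm ε b v Dv x - a x ^ 2 * dpComm ε d v Dv x - δ * a x ^ 2 * tr3 (Dv x))
        - (fderiv ℝ F x (v x) + F x * tr3 (Dv x)) := by
    intro x
    rw [mollFlux_eq_dpComm hε Dv hbi (ibv hb2), mollFlux_eq_dpComm hε Dv hdi (ibv hd2), dF]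
    have e : F x = 2 * a x * B x - a x ^ 2 * D x - δ * a x ^ 2 := by
      have := (Dδ x).ne'
      simp only [hF, ha]
      field_simp
      ring
    rw [e]
    ring
  have mF : MemLp F 2 (volume : Measure R3) := cF.continuous.memLp_of_hasCompactSupport sF
  have htr := hH.translate_volume hΩ hv0 hDv0
  have icomm : ∀ {f : R3 → ℝ}, Measurable f → MemLp f 2 volume →
      Integrable (dpComm ε f v Dv) := fun hf hf2 =>
    ⟨(measurable_dpComm hf hv hDv).aestronglyMeasurable,
      lt_of_le_of_lt (lintegral_dpComm_le hε hf hv hDv htr) (ENNReal.mul_lt_top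
        lintegral_kernelDensity_lt_top (ENNReal.mul_lt_top hf2.2 mDv.2))⟩
  have ea : ∀ x, ‖a x‖ₑ ≤ 1 := fun x => by
    rw [Real.enorm_of_nonneg (a0 x)]
    exact ENNReal.ofReal_le_one.2 (a1 x)
  have na : ∀ x, ‖a x‖ ≤ 1 := fun x => by rw [Real.norm_of_nonneg (a0 x)]; exact a1 x
  have j1 : Integrable fun x => 2 * a x * dpComm ε b v Dv x := by
    refine (icomm hb hb2).bdd_mul (c := 2) (continuous_const.mul ca).aestronglyMeasurable
      (Eventually.of_forall fun x => ?_)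
    rw [norm_mul, Real.norm_two]; linarith [na x]
  have j2 : Integrable fun x => a x ^ 2 * dpComm ε d v Dv x := by
    refine (icomm hd hd2).bdd_mul (c := 1) (ca.pow 2).aestronglyMeasurable
      (Eventually.of_forall fun x => ?_)
    rw [norm_pow]; exact pow_le_one₀ (norm_nonneg _) (na x)
  have j3 : Integrable fun x => δ * a x ^ 2 * tr3 (Dv x) := by
    refine (tr3.integrable_comp hDvi).bdd_mul (c := δ)
      (continuous_const.mul (ca.pow 2)).aestronglyMeasurable
      (Eventually.of_forall fun x => ?_)
    rw [norm_mul, Real.norm_of_nonneg hδ.le, norm_pow]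
    exact mul_le_of_le_one_right hδ.le (pow_le_one₀ (norm_nonneg _) (na x))
  have j4 := integrable_fderiv_apply_of_memLp cF sF mv
  have j5 := integrable_mul_tr3_of_memLp mF mDv
  change ‖∫ x, (2 * a x * mollFlux ε b v x - a x ^ 2 * mollFlux ε d v x)‖ₑ ≤ _
  simp only [hpt]
  have j123 : Integrable fun x => 2 * a x * dpComm ε b v Dv x - a x ^ 2 * dpComm ε d v Dv x
      - δ * a x ^ 2 * tr3 (Dv x) := (j1.sub j2).sub j3
  have j45 : Integrable fun x => fderiv ℝ F x (v x) + F x * tr3 (Dv x) := j4.add j5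
  -- The integral of the divergence of `F v` vanishes since `v` is in `H¹₀`; only the commutators
  -- and the `δ` term remain.
  rw [integral_sub j123 j45, integral_add j4 j5,
    hH.integral_fderiv_apply_eq hΩ hv0 hDv0 cF sF, neg_add_cancel, sub_zero]
  refine (enorm_integral_le_lintegral_enorm _).trans ?_
  have m1 := (measurable_dpComm (ε := ε) hb hv hDv).enorm
  have m2 := (measurable_dpComm (ε := ε) hd hv hDv).enorm
  calc _ ≤ ∫⁻ x, (2 * ‖dpComm ε b v Dv x‖ₑ + ‖dpComm ε d v Dv x‖ₑ
        + 3 * ENNReal.ofReal δ * ‖Dv x‖ₑ) := by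
        refine lintegral_mono fun x => ?_
        refine enorm_sub_le.trans (add_le_add (enorm_sub_le.trans (add_le_add ?_ ?_)) ?_)
        · rw [enorm_mul, enorm_mul]
          have : ‖(2 : ℝ)‖ₑ = 2 := by simp [Real.enorm_eq_ofReal_abs]
          rw [this]
          calc _ ≤ 2 * 1 * ‖dpComm ε b v Dv x‖ₑ := by gcongr; exact ea x
            _ = _ := by rw [mul_one]
        · rw [enorm_mul, enorm_pow]
          calc _ ≤ 1 ^ 2 * ‖dpComm ε d v Dv x‖ₑ := by gcongr; exact ea x
            _ = _ := by rw [one_pow, one_mul]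
        · rw [enorm_mul, enorm_mul, enorm_pow, Real.enorm_of_nonneg hδ.le]
          calc _ ≤ ENNReal.ofReal δ * 1 ^ 2 * (3 * ‖Dv x‖ₑ) := by
                gcongr
                · exact ea x
                · exact enorm_tr3_le _
            _ = _ := by ring
    _ = _ := by
        rw [lintegral_add_right _ (hDv.enorm.const_mul _), lintegral_add_left (m1.const_mul 2),
          lintegral_const_mul _ m1, lintegral_const_mul _ hDv.enorm]

/-! ### Measurability and integrability in space-time -/

theorem lintegral_restrict_of_support {α : Type*} [MeasurableSpace α] {μ : Measure α} {Ω : Set α}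
    (hΩ : MeasurableSet Ω) {f : α → ENNReal} (hf : ∀ x, x ∉ Ω → f x = 0) :
    ∫⁻ x in Ω, f x ∂μ = ∫⁻ x, f x ∂μ := by
  rw [← lintegral_indicator hΩ]
  congr 1
  exact indicator_eq_self.2 fun x hx => by_contra fun h => hx (hf x h)

theorem integral_restrict_of_support {α E : Type*} [MeasurableSpace α] {μ : Measure α} {Ω : Set α}
    [NormedAddCommGroup E] [NormedSpace ℝ E] {f : α → E} (hf : ∀ x, x ∉ Ω → f x = 0) :
    ∫ x in Ω, f x ∂μ = ∫ x, f x ∂μ :=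
  setIntegral_eq_integral_of_forall_compl_eq_zero fun x hx => hf x hx

theorem lintegral_cylMeasure (Ω : Set R3) (T : ℝ) {f : ℝ → R3 → ENNReal}
    (hf : AEMeasurable (Function.uncurry f) (cylMeasure Ω T)) :
    ∫⁻ z, f z.1 z.2 ∂(cylMeasure Ω T) = ∫⁻ t, (∫⁻ x in Ω, f t x) ∂(timeMeasure T) := by
  rw [cylMeasure_eq_prod] at hf ⊢
  exact lintegral_prod (Function.uncurry f) hf

theorem isFiniteMeasure_cylMeasure {Ω : Set R3} (hΩb : Bornology.IsBounded Ω) (T : ℝ) :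
    IsFiniteMeasure (cylMeasure Ω T) :=
  ⟨by
    rw [cylMeasure, Measure.restrict_apply_univ]
    exact ((Metric.isBounded_Ioo 0 T).prod hΩb).measure_lt_top⟩

theorem isFiniteMeasure_restrict_of_isBounded {Ω : Set R3} (hΩb : Bornology.IsBounded Ω) :
    IsFiniteMeasure (volume.restrict Ω) :=
  ⟨by rw [Measure.restrict_apply_univ]; exact hΩb.measure_lt_top⟩

theorem measurable_moll_param {b : ℝ → R3 → ℝ} (hb : Measurable (Function.uncurry b)) (ε : ℝ) :
    Measurable fun p : ℝ × R3 => moll ε (b p.1) p.2 := by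
  have h : Measurable (Function.uncurry fun (p : ℝ × R3) (y : R3) =>
      mollKernel ε (p.2 - y) * b p.1 y) := by
    refine Measurable.mul ?_ ?_
    · exact ((mollKernel_contDiff ε).continuous.comp
        (by fun_prop : Continuous fun q : (ℝ × R3) × R3 => q.1.2 - q.2)).measurable
    · exact hb.comp ((measurable_fst.comp measurable_fst).prodMk measurable_snd)
  exact h.stronglyMeasurable.integral_prod_right.measurable

theorem measurable_mollFlux_param {b : ℝ → R3 → ℝ} {u : ℝ → R3 → R3}
    (hb : Measurable (Function.uncurry b)) (hu : Measurable (Function.uncurry u)) (ε : ℝ) :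
    Measurable fun p : ℝ × R3 => mollFlux ε (b p.1) (u p.1) p.2 := by
  have hs : Measurable fun q : (ℝ × R3) × R3 => (q.1.1, q.2) :=
    (measurable_fst.comp measurable_fst).prodMk measurable_snd
  have h : Measurable (Function.uncurry fun (p : ℝ × R3) (y : R3) =>
      -(ε⁻¹ ^ 3 * (ε⁻¹ * fderiv ℝ bumpKernel (ε⁻¹ • (p.2 - y)) (b p.1 y • u p.1 y)))) := by
    have h1 : Measurable fun q : (ℝ × R3) × R3 => fderiv ℝ bumpKernel (ε⁻¹ • (q.1.2 - q.2)) :=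
      (continuous_fderiv_bumpKernel.comp
        (by fun_prop : Continuous fun q : (ℝ × R3) × R3 => ε⁻¹ • (q.1.2 - q.2))).measurable
    have h2 : Measurable fun q : (ℝ × R3) × R3 => b q.1.1 q.2 • u q.1.1 q.2 :=
      (hb.comp hs).smul (hu.comp hs)
    have h3 := (isBoundedBilinearMap_apply (𝕜 := ℝ) (E := R3) (F := ℝ)).continuous.measurable.comp
      (h1.prodMk h2)
    exact ((h3.const_mul ε⁻¹).const_mul (ε⁻¹ ^ 3)).neg
  have := h.stronglyMeasurable.integral_prod_right (ν := (volume : Measure R3))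
  simp only [mollFlux, fderiv_mollKernel_sub]
  exact this.measurable

theorem measurable_dpComm_param {b : ℝ → R3 → ℝ} {u : ℝ → R3 → R3} {Du : ℝ → R3 → R3 →L[ℝ] R3}
    (hb : Measurable (Function.uncurry b)) (hu : Measurable (Function.uncurry u))
    (hDu : Measurable (Function.uncurry Du)) (ε : ℝ) :
    Measurable fun p : ℝ × R3 => dpComm ε (b p.1) (u p.1) (Du p.1) p.2 := by
  have hs : Measurable fun q : (ℝ × R3) × R3 => (q.1.1, q.1.2 - ε • q.2) :=
    (by fun_prop : Continuous fun q : (ℝ × R3) × R3 => (q.1.1, q.1.2 - ε • q.2)).measurable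
  have h2 : Measurable fun q : (ℝ × R3) × R3 => fderiv ℝ bumpKernel q.2 :=
    (continuous_fderiv_bumpKernel.comp continuous_snd).measurable
  have h1 : Measurable fun q : (ℝ × R3) × R3 =>
      ε⁻¹ • (u q.1.1 q.1.2 - u q.1.1 (q.1.2 - ε • q.2)) :=
    ((hu.comp measurable_fst).sub (hu.comp hs)).const_smul ε⁻¹
  have h3 : Measurable fun q : (ℝ × R3) × R3 =>
      fderiv ℝ bumpKernel q.2 (ε⁻¹ • (u q.1.1 q.1.2 - u q.1.1 (q.1.2 - ε • q.2))) :=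
    (isBoundedBilinearMap_apply (𝕜 := ℝ) (E := R3) (F := ℝ)).continuous.measurable.comp
      (h2.prodMk h1)
  have h4 : Measurable fun q : (ℝ × R3) × R3 => tr3 (Du q.1.1 q.1.2) :=
    tr3.continuous.measurable.comp (hDu.comp measurable_fst)
  have h5 : Measurable fun q : (ℝ × R3) × R3 => bumpKernel q.2 :=
    bumpKernel_continuous.measurable.comp measurable_snd
  have h : Measurable (Function.uncurry fun (p : ℝ × R3) (z : R3) =>
      commKernel ε (b p.1) (u p.1) (Du p.1) p.2 z) :=
    (hb.comp hs).mul (h3.add (h4.mul h5))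
  exact h.stronglyMeasurable.integral_prod_right.measurable

theorem lintegral_enorm_moll_le {ε : ℝ} (hε : 0 < ε) {f : R3 → ℝ} (hf : Measurable f) :
    ∫⁻ x, ‖moll ε f x‖ₑ ≤ ∫⁻ x, ‖f x‖ₑ := by
  have hη := bumpKernel_continuous.enorm.measurable
  have hm : Measurable (Function.uncurry fun x z : R3 => ‖bumpKernel z‖ₑ * ‖f (x - ε • z)‖ₑ) :=
    (hη.comp measurable_snd).mul (measurable_comp_sub_smul hf ε).enorm
  calc ∫⁻ x, ‖moll ε f x‖ₑ ≤ ∫⁻ x, ∫⁻ z, ‖bumpKernel z‖ₑ * ‖f (x - ε • z)‖ₑ := by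
        refine lintegral_mono fun x => ?_
        rw [moll_eq hε]
        refine (enorm_integral_le_lintegral_enorm _).trans (le_of_eq ?_)
        simp only [enorm_mul]
    _ = ∫⁻ z, ‖bumpKernel z‖ₑ * ∫⁻ x, ‖f x‖ₑ := by
        rw [lintegral_lintegral_swap hm.aemeasurable]
        refine lintegral_congr fun z => ?_
        have : Measurable fun x => ‖f (x - ε • z)‖ₑ := (hf.comp (measurable_id.sub_const _)).enorm
        rw [lintegral_const_mul _ this, lintegral_sub_right_eq_self (fun x => ‖f x‖ₑ)]
    _ = ∫⁻ x, ‖f x‖ₑ := by rw [lintegral_mul_const _ hη, lintegral_enorm_bumpKernel, one_mul]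

/-- The growth like `ε⁻¹` is harmless: the estimate is used at fixed `ε`, to justify exchanging
integrals. -/
theorem lintegral_enorm_mollFlux_le {ε : ℝ} (hε : 0 < ε) {b : R3 → ℝ} {v : R3 → R3}
    (hb : Measurable b) (hv : Measurable v) :
    ∫⁻ x, ‖mollFlux ε b v x‖ₑ
      ≤ ‖ε⁻¹‖ₑ * ((∫⁻ z, ‖fderiv ℝ bumpKernel z‖ₑ) * ∫⁻ x, ‖b x • v x‖ₑ) := by
  have hη := continuous_fderiv_bumpKernel.enorm.measurable
  have hbv : Measurable fun x => b x • v x := hb.smul hv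
  have hm : Measurable (Function.uncurry fun x z : R3 =>
      ‖fderiv ℝ bumpKernel z‖ₑ * ‖b (x - ε • z) • v (x - ε • z)‖ₑ) :=
    (hη.comp measurable_snd).mul (measurable_comp_sub_smul hbv ε).enorm
  have hr : Measurable fun x => ∫⁻ z,
      ‖fderiv ℝ bumpKernel z‖ₑ * ‖b (x - ε • z) • v (x - ε • z)‖ₑ := hm.lintegral_prod_right'
  calc ∫⁻ x, ‖mollFlux ε b v x‖ₑ ≤ ∫⁻ x, ‖ε⁻¹‖ₑ * ∫⁻ z,
        ‖fderiv ℝ bumpKernel z‖ₑ * ‖b (x - ε • z) • v (x - ε • z)‖ₑ := by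
        refine lintegral_mono fun x => ?_
        rw [mollFlux_eq hε, enorm_neg, enorm_mul]
        gcongr
        refine (enorm_integral_le_lintegral_enorm _).trans (lintegral_mono fun z => ?_)
        exact (fderiv ℝ bumpKernel z).le_opENorm _
    _ = ‖ε⁻¹‖ₑ * ∫⁻ z, ‖fderiv ℝ bumpKernel z‖ₑ * ∫⁻ x, ‖b x • v x‖ₑ := by
        rw [lintegral_const_mul _ hr, lintegral_lintegral_swap hm.aemeasurable]
        congr 1
        refine lintegral_congr fun z => ?_
        have : Measurable fun x => ‖b (x - ε • z) • v (x - ε • z)‖ₑ :=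
          (hbv.comp (measurable_id.sub_const _)).enorm
        rw [lintegral_const_mul _ this, lintegral_sub_right_eq_self (fun x => ‖b x • v x‖ₑ)]
    _ = _ := by rw [lintegral_mul_const _ hη]

theorem integrable_flux {Ω : Set R3} {T : ℝ} {J : ℝ → R3 → R3}
    (hJ : Integrable (Function.uncurry J) (cylMeasure Ω T))
    {w : R3 → ℝ} (hw : ContDiff ℝ ∞ w) (hwc : HasCompactSupport w) :
    Integrable (fun s => ∫ x in Ω, fderiv ℝ w x (J s x)) (timeMeasure T) := by
  have hw' : Continuous (fderiv ℝ w) := hw.continuous_fderiv (by simp)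
  obtain ⟨Dw, hDw⟩ := hw'.bounded_above_of_compact_support (hwc.fderiv ℝ)
  rw [cylMeasure_eq_prod] at hJ
  have hwJ : Integrable (fun z : ℝ × R3 => fderiv ℝ w z.2 (J z.1 z.2))
      ((timeMeasure T).prod (volume.restrict Ω)) := by
    refine (hJ.norm.const_mul Dw).mono' ?_ (Eventually.of_forall fun z => ?_)
    · exact (isBoundedBilinearMap_apply (𝕜 := ℝ) (E := R3) (F := ℝ)).continuous.comp_aestronglyMeasurable
        ((hw'.comp continuous_snd).aestronglyMeasurable.prodMk hJ.aestronglyMeasurable)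
    · exact ((fderiv ℝ w z.2).le_opNorm _).trans
        (mul_le_mul_of_nonneg_right (hDw z.2) (norm_nonneg _))
  exact hwJ.integral_prod_left

theorem MemLp.integrable_of_support {E : Type*} [NormedAddCommGroup E] {Ω : Set R3}
    (hΩ : MeasurableSet Ω) (hΩb : Bornology.IsBounded Ω) {f : R3 → E} (hf : MemLp f 2 volume)
    (hf0 : ∀ x, x ∉ Ω → f x = 0) : Integrable f := by
  have := isFiniteMeasure_restrict_of_isBounded hΩb
  have h1 : IntegrableOn f Ω := (hf.restrict Ω).integrable (by norm_num)
  have : Ω.indicator f = f := indicator_eq_self.2 fun x hx => by_contra fun h => hx (hf0 x h)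
  rw [← this]
  exact h1.integrable_indicator hΩ

/-! ### The renormalization inequality at scale `ε` -/

/-- Hypotheses on a velocity field and a pair of densities, extended by zero, on which the
renormalization argument runs. -/
structure TransportData (Ω : Set R3) (T : ℝ) (b d : ℝ → R3 → ℝ) (u : ℝ → R3 → R3)
    (Du : ℝ → R3 → R3 →L[ℝ] R3) : Prop where
  isOpen : IsOpen Ω
  isBounded : Bornology.IsBounded Ω
  meas_b : Measurable (Function.uncurry b)
  meas_d : Measurable (Function.uncurry d)
  meas_u : Measurable (Function.uncurry u)
  meas_Du : Measurable (Function.uncurry Du)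
  b_zero : ∀ t x, x ∉ Ω → b t x = 0
  d_zero : ∀ t x, x ∉ Ω → d t x = 0
  u_zero : ∀ t x, x ∉ Ω → u t x = 0
  Du_zero : ∀ t x, x ∉ Ω → Du t x = 0
  b_nonneg : ∀ t x, 0 ≤ b t x
  b_le : ∀ t x, b t x ≤ d t x
  d_memLp : MemLp (Function.uncurry d) 2 (cylMeasure Ω T)
  memL2H10 : MemL2H10 Ω T u Du

namespace TransportData

variable {Ω : Set R3} {T : ℝ} {b d : ℝ → R3 → ℝ} {u : ℝ → R3 → R3} {Du : ℝ → R3 → R3 →L[ℝ] R3}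

/-- Every statement about `b` thereby holds for `d` as well. -/
theorem of_dd (h : TransportData Ω T b d u Du) : TransportData Ω T d d u Du :=
  { h with
    meas_b := h.meas_d
    b_zero := h.d_zero
    b_nonneg := fun t x => (h.b_nonneg t x).trans (h.b_le t x)
    b_le := fun _ _ => le_rfl }

theorem b_memLp (h : TransportData Ω T b d u Du) :
    MemLp (Function.uncurry b) 2 (cylMeasure Ω T) :=
  h.d_memLp.mono h.meas_b.aestronglyMeasurable (Eventually.of_forall fun z => by
    have h1 := h.b_nonneg z.1 z.2
    have h2 := h.b_le z.1 z.2
    simp only [Function.uncurry]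
    rw [Real.norm_of_nonneg h1, Real.norm_of_nonneg (h1.trans h2)]
    exact h2)

theorem integrable_b (h : TransportData Ω T b d u Du) :
    Integrable (Function.uncurry b) (cylMeasure Ω T) := by
  have := isFiniteMeasure_cylMeasure h.isBounded T
  exact h.b_memLp.integrable (by norm_num)

theorem integrable_flux (h : TransportData Ω T b d u Du) :
    Integrable (Function.uncurry fun t x => b t x • u t x) (cylMeasure Ω T) :=
  memLp_one_iff_integrable.1 (h.memL2H10.1.smul h.b_memLp)

theorem lintegral_eq {E : Type*} [NormedAddCommGroup E] [MeasurableSpace E] [OpensMeasurableSpace E]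
    (hΩ : IsOpen Ω) {f : ℝ → R3 → E}
    (hf : Measurable (Function.uncurry f)) (hf0 : ∀ t x, x ∉ Ω → f t x = 0) :
    ∫⁻ t, (∫⁻ x, ‖f t x‖ₑ) ∂(timeMeasure T) = ∫⁻ z, ‖f z.1 z.2‖ₑ ∂(cylMeasure Ω T) := by
  rw [lintegral_cylMeasure Ω T (f := fun t x => ‖f t x‖ₑ) hf.enorm.aemeasurable]
  refine lintegral_congr fun t => ?_
  exact (lintegral_restrict_of_support hΩ.measurableSet fun x hx => by simp [hf0 t x hx]).symm

theorem lintegral_sq_eq {E : Type*} [NormedAddCommGroup E] [MeasurableSpace E]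
    [OpensMeasurableSpace E] (hΩ : IsOpen Ω) {f : ℝ → R3 → E}
    (hf : Measurable (Function.uncurry f)) (hf0 : ∀ t x, x ∉ Ω → f t x = 0) :
    ∫⁻ t, eLpNorm (f t) 2 volume ^ 2 ∂(timeMeasure T)
      = eLpNorm (Function.uncurry f) 2 (cylMeasure Ω T) ^ 2 := by
  rw [eLpNorm_two_sq]
  have := lintegral_cylMeasure Ω T (f := fun t x => ‖f t x‖ₑ ^ 2)
    (hf.enorm.pow_const 2).aemeasurable
  refine Eq.trans ?_ this.symm
  refine lintegral_congr fun t => ?_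
  rw [eLpNorm_two_sq]
  exact (lintegral_restrict_of_support hΩ.measurableSet fun x hx => by simp [hf0 t x hx]).symm

theorem ae_memLp {E : Type*} [NormedAddCommGroup E] [MeasurableSpace E] [BorelSpace E]
    [SecondCountableTopology E] (hΩ : IsOpen Ω) {f : ℝ → R3 → E}
    (hf : Measurable (Function.uncurry f)) (hf0 : ∀ t x, x ∉ Ω → f t x = 0)
    (hf2 : MemLp (Function.uncurry f) 2 (cylMeasure Ω T)) :
    ∀ᵐ t ∂(timeMeasure T), MemLp (f t) 2 volume := by
  have h1 := lintegral_sq_eq (T := T) hΩ hf hf0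
  have hm : Measurable fun t => eLpNorm (f t) 2 volume ^ 2 := by
    simp only [eLpNorm_two_sq]
    exact (hf.enorm.pow_const 2).lintegral_prod_right'
  have h2 := ae_lt_top hm (by rw [h1]; exact (ENNReal.pow_lt_top hf2.2).ne)
  filter_upwards [h2] with t ht
  exact ⟨(hf.of_uncurry_left).aestronglyMeasurable, by
    by_contra hc
    rw [not_lt, top_le_iff] at hc
    rw [hc] at ht
    simp at ht⟩

theorem ae_memLp_b (h : TransportData Ω T b d u Du) :
    ∀ᵐ t ∂(timeMeasure T), MemLp (b t) 2 volume ∧ Integrable (b t) := by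
  filter_upwards [ae_memLp h.isOpen h.meas_b h.b_zero h.b_memLp] with t ht
  exact ⟨ht, MemLp.integrable_of_support h.isOpen.measurableSet h.isBounded ht (h.b_zero t)⟩

theorem ae_memLp_Du (h : TransportData Ω T b d u Du) :
    ∀ᵐ t ∂(timeMeasure T), MemLp (Du t) 2 volume ∧ Integrable (Du t) := by
  filter_upwards [ae_memLp h.isOpen h.meas_Du h.Du_zero h.memL2H10.2.1] with t ht
  exact ⟨ht, MemLp.integrable_of_support h.isOpen.measurableSet h.isBounded ht (h.Du_zero t)⟩

end TransportData

namespace TransportData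

variable {Ω : Set R3} {T : ℝ} {b d : ℝ → R3 → ℝ} {u : ℝ → R3 → R3} {Du : ℝ → R3 → R3 →L[ℝ] R3}

/-- The mollified slices are absolutely continuous in time. -/
theorem moll_ae_eq (h : TransportData Ω T b d u Du) (hT : 0 < T) {b₀ : R3 → ℝ}
    (hb₀ : ∀ x, x ∉ Ω → b₀ x = 0)
    (hsol : IsFluxSolution Ω T b₀ b (fun t x => b t x • u t x)) {ε : ℝ} (hε : 0 < ε) (x : R3) :
    Integrable (fun s => mollFlux ε (b s) (u s) x) (timeMeasure T) ∧
    ∀ᵐ t ∂(timeMeasure T), moll ε (b t) x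
      = moll ε b₀ x + ∫ s in (0 : ℝ)..t, mollFlux ε (b s) (u s) x := by
  -- The kernel centred at `x` serves as test function. It need not vanish on the boundary of `Ω`:
  -- the zero-flux condition is part of the weak formulation.
  have hw : ContDiff ℝ ∞ fun y => mollKernel ε (x - y) :=
    (mollKernel_contDiff ε).comp (contDiff_const.sub contDiff_id)
  have hwc : HasCompactSupport fun y => mollKernel ε (x - y) :=
    (mollKernel_hasCompactSupport hε).comp_homeomorph (Homeomorph.subLeft x)
  have e1 : ∀ s, ∫ y in Ω, fderiv ℝ (fun y => mollKernel ε (x - y)) y (b s y • u s y)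
      = mollFlux ε (b s) (u s) x := fun s =>
    integral_restrict_of_support fun y hy => by simp [h.b_zero s y hy]
  have e2 : ∀ t, ∫ y in Ω, mollKernel ε (x - y) * b t y = moll ε (b t) x := fun t =>
    integral_restrict_of_support fun y hy => by simp [h.b_zero t y hy]
  have e3 : ∫ y in Ω, b₀ y * mollKernel ε (x - y) = moll ε b₀ x := by
    rw [integral_restrict_of_support fun y hy => by simp [hb₀ y hy]]
    simp only [moll, mul_comm]
  have i := _root_.integrable_flux h.integrable_flux hw hwc
  have a := hsol.ae_eq hT h.integrable_b h.integrable_flux hw hwc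
  simp only [e1, e2, e3] at i a
  exact ⟨i, a⟩

theorem integrable_prod_of_lintegral {f : ℝ → R3 → ℝ} (hf : Measurable (Function.uncurry f))
    (hfin : ∫⁻ t, (∫⁻ x, ‖f t x‖ₑ) ∂(timeMeasure T) < ⊤) :
    Integrable (Function.uncurry f) ((timeMeasure T).prod volume) := by
  refine ⟨hf.aestronglyMeasurable, ?_⟩
  rw [HasFiniteIntegral, lintegral_prod _ hf.enorm.aemeasurable]
  exact hfin

theorem lintegral_moll_lt_top (h : TransportData Ω T b d u Du) {ε : ℝ} (hε : 0 < ε) :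
    ∫⁻ t, (∫⁻ x, ‖moll ε (b t) x‖ₑ) ∂(timeMeasure T) < ⊤ := by
  refine lt_of_le_of_lt (lintegral_mono fun t =>
    lintegral_enorm_moll_le hε h.meas_b.of_uncurry_left) ?_
  rw [lintegral_eq h.isOpen h.meas_b h.b_zero]
  exact h.integrable_b.2

theorem lintegral_mollFlux_lt_top (h : TransportData Ω T b d u Du) {ε : ℝ} (hε : 0 < ε) :
    ∫⁻ t, (∫⁻ x, ‖mollFlux ε (b t) (u t) x‖ₑ) ∂(timeMeasure T) < ⊤ := by
  have hm : Measurable (Function.uncurry fun t x => b t x • u t x) := h.meas_b.smul h.meas_u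
  have hl : Measurable fun t => ∫⁻ x, ‖b t x • u t x‖ₑ := hm.enorm.lintegral_prod_right'
  refine lt_of_le_of_lt (lintegral_mono fun t => lintegral_enorm_mollFlux_le hε
    h.meas_b.of_uncurry_left h.meas_u.of_uncurry_left) ?_
  rw [lintegral_const_mul _ (hl.const_mul _), lintegral_const_mul _ hl,
    lintegral_eq h.isOpen hm fun t x hx => by simp [h.b_zero t x hx]]
  refine ENNReal.mul_lt_top enorm_lt_top (ENNReal.mul_lt_top ?_ h.integrable_flux.2)
  have := lintegral_fderiv_bumpKernel_pow_lt_top 0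
  simpa using this

/-- The renormalized mollified equation, integrated in space and time. -/
theorem mollified_bound (h : TransportData Ω T b d u Du) (hT : 0 < T) {b₀ d₀ : R3 → ℝ}
    (hb₀m : Measurable b₀)
    (hb₀z : ∀ x, x ∉ Ω → b₀ x = 0) (hd₀z : ∀ x, x ∉ Ω → d₀ x = 0) (hb₀i : Integrable b₀)
    (hd₀i : Integrable d₀) (hb₀ : ∀ x, 0 ≤ b₀ x) (hbd₀ : ∀ x, b₀ x ≤ d₀ x)
    (hbsol : IsFluxSolution Ω T b₀ b (fun t x => b t x • u t x))
    (hdsol : IsFluxSolution Ω T d₀ d (fun t x => d t x • u t x)) {ε δ : ℝ} (hε : 0 < ε)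
    (hδ : 0 < δ) :
    ENNReal.ofReal T * ∫⁻ x, ‖moll ε b₀ x ^ 2 / (moll ε d₀ x + δ)‖ₑ
      ≤ (∫⁻ t, (∫⁻ x, ‖moll ε (b t) x ^ 2 / (moll ε (d t) x + δ)‖ₑ) ∂(timeMeasure T))
        + ENNReal.ofReal T * ∫⁻ t, (2 * (∫⁻ x, ‖dpComm ε (b t) (u t) (Du t) x‖ₑ)
          + (∫⁻ x, ‖dpComm ε (d t) (u t) (Du t) x‖ₑ)
          + 3 * ENNReal.ofReal δ * ∫⁻ x, ‖Du t x‖ₑ) ∂(timeMeasure T) := by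
  have hdd := h.of_dd
  have d_nonneg : ∀ t x, 0 ≤ d t x := hdd.b_nonneg
  have D0 : ∀ t x, 0 ≤ moll ε (d t) x := fun t => moll_nonneg hε (d_nonneg t)
  have B0 : ∀ t x, 0 ≤ moll ε (b t) x := fun t => moll_nonneg hε (h.b_nonneg t)
  have BD : ∀ᵐ t ∂(timeMeasure T), ∀ x, moll ε (b t) x ≤ moll ε (d t) x := by
    filter_upwards [h.ae_memLp_b, hdd.ae_memLp_b] with t h1 h2
    exact moll_mono hε h1.2 h2.2 (h.b_le t)
  have mB := measurable_moll_param h.meas_b ε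
  have mD := measurable_moll_param h.meas_d ε
  have mFB : Measurable (Function.uncurry fun t x => mollFlux ε (b t) (u t) x) :=
    measurable_mollFlux_param h.meas_b h.meas_u ε
  have mFD : Measurable (Function.uncurry fun t x => mollFlux ε (d t) (u t) x) :=
    measurable_mollFlux_param h.meas_d h.meas_u ε
  set Q : ℝ → R3 → ℝ := fun t x => moll ε (b t) x ^ 2 / (moll ε (d t) x + δ) with hQ
  set a : ℝ → R3 → ℝ := fun t x => moll ε (b t) x / (moll ε (d t) x + δ) with ha
  set H : ℝ → R3 → ℝ := fun t x => 2 * a t x * mollFlux ε (b t) (u t) x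
    - a t x ^ 2 * mollFlux ε (d t) (u t) x with hH
  set Q₀ : R3 → ℝ := fun x => moll ε b₀ x ^ 2 / (moll ε d₀ x + δ) with hQ₀
  have ma : Measurable (Function.uncurry a) := mB.div (mD.add_const δ)
  have mQ : Measurable (Function.uncurry Q) := (mB.pow_const 2).div (mD.add_const δ)
  have mH : Measurable (Function.uncurry H) :=
    ((ma.const_mul 2).mul mFB).sub ((ma.pow_const 2).mul mFD)
  have a1 : ∀ᵐ t ∂(timeMeasure T), ∀ x, 0 ≤ a t x ∧ a t x ≤ 1 := by
    filter_upwards [BD] with t ht x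
    have hD := D0 t x
    exact ⟨div_nonneg (B0 t x) (by linarith), (div_le_one (by linarith)).2 (by linarith [ht x])⟩
  -- The quotient equals `a` times the mollified `b`, with `0 ≤ a ≤ 1`.
  have iQ : Integrable (Function.uncurry Q) ((timeMeasure T).prod volume) := by
    refine integrable_prod_of_lintegral mQ
      (lt_of_le_of_lt (lintegral_mono_ae ?_) (h.lintegral_moll_lt_top hε))
    filter_upwards [a1] with t ht
    refine lintegral_mono fun x => ?_
    have e : Q t x = a t x * moll ε (b t) x := by simp only [hQ, ha]; ring
    rw [e, enorm_mul, Real.enorm_of_nonneg (ht x).1]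
    calc _ ≤ 1 * ‖moll ε (b t) x‖ₑ := by
          gcongr; exact ENNReal.ofReal_le_one.2 (ht x).2
      _ = _ := one_mul _
  have bH : ∀ᵐ t ∂(timeMeasure T), ∀ x, ‖H t x‖ₑ
      ≤ 2 * ‖mollFlux ε (b t) (u t) x‖ₑ + ‖mollFlux ε (d t) (u t) x‖ₑ := by
    filter_upwards [a1] with t ht x
    have h1 : ‖a t x‖ₑ ≤ 1 := by
      rw [Real.enorm_of_nonneg (ht x).1]; exact ENNReal.ofReal_le_one.2 (ht x).2
    have h2 : ‖(2 : ℝ)‖ₑ = 2 := by simp [Real.enorm_eq_ofReal_abs]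
    refine enorm_sub_le.trans (add_le_add ?_ ?_)
    · rw [enorm_mul, enorm_mul, h2]
      calc _ ≤ 2 * 1 * ‖mollFlux ε (b t) (u t) x‖ₑ := by gcongr
        _ = _ := by rw [mul_one]
    · rw [enorm_mul, enorm_pow]
      calc _ ≤ 1 ^ 2 * ‖mollFlux ε (d t) (u t) x‖ₑ := by gcongr
        _ = _ := by rw [one_pow, one_mul]
  have finH : ∫⁻ t, (∫⁻ x, ‖H t x‖ₑ) ∂(timeMeasure T) < ⊤ := by
    have m1 : Measurable fun t => ∫⁻ x, ‖mollFlux ε (b t) (u t) x‖ₑ :=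
      mFB.enorm.lintegral_prod_right'
    have m3 : ∀ t, Measurable fun x => ‖mollFlux ε (b t) (u t) x‖ₑ :=
      fun t => mFB.of_uncurry_left.enorm
    calc _ ≤ ∫⁻ t, (2 * (∫⁻ x, ‖mollFlux ε (b t) (u t) x‖ₑ)
          + ∫⁻ x, ‖mollFlux ε (d t) (u t) x‖ₑ) ∂(timeMeasure T) := by
          refine lintegral_mono_ae ?_
          filter_upwards [bH] with t ht
          refine (lintegral_mono ht).trans (le_of_eq ?_)
          rw [lintegral_add_left ((m3 t).const_mul 2), lintegral_const_mul _ (m3 t)]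
      _ < ⊤ := by
          rw [lintegral_add_left (m1.const_mul 2), lintegral_const_mul _ m1]
          exact ENNReal.add_lt_top.2 ⟨ENNReal.mul_lt_top (by simp)
            (h.lintegral_mollFlux_lt_top hε), hdd.lintegral_mollFlux_lt_top hε⟩
  have iH : Integrable (Function.uncurry H) ((timeMeasure T).prod volume) :=
    integrable_prod_of_lintegral mH finH
  have hTs : ∀ᵐ t ∂(timeMeasure T), ‖T - t‖ ≤ T := by
    filter_upwards [ae_restrict_mem measurableSet_Ioo] with t ht
    rw [Real.norm_eq_abs, abs_le]
    exact ⟨by linarith [ht.2], by linarith [ht.1]⟩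
  -- The identities in time hold point by point in `x`; joint integrability allows integrating them
  -- over space and exchanging the order.
  have iTH : Integrable (Function.uncurry fun t x => (T - t) * H t x)
      ((timeMeasure T).prod volume) := by
    refine iH.bdd_mul (c := T) (f := fun z : ℝ × R3 => T - z.1) (by fun_prop) ?_
    exact Measure.quasiMeasurePreserving_fst.ae hTs
  -- the one-dimensional identity at each point of space
  have hx : ∀ x, ∫ t, Q t x ∂(timeMeasure T)
      = T * Q₀ x + ∫ t, (T - t) * H t x ∂(timeMeasure T) := by
    intro x
    obtain ⟨i1, e1⟩ := h.moll_ae_eq hT hb₀z hbsol hε x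
    obtain ⟨i2, e2⟩ := hdd.moll_ae_eq hT hd₀z hdsol hε x
    exact integral_quotient_eq hT hδ i1 i2 e1 e2 (Eventually.of_forall fun t => D0 t x)
  have D₀0 : ∀ x, 0 ≤ moll ε d₀ x := moll_nonneg hε fun x => (hb₀ x).trans (hbd₀ x)
  have B₀0 : ∀ x, 0 ≤ moll ε b₀ x := moll_nonneg hε hb₀
  have BD₀ : ∀ x, moll ε b₀ x ≤ moll ε d₀ x := moll_mono hε hb₀i hd₀i hbd₀
  have Q₀0 : ∀ x, 0 ≤ Q₀ x := fun x => div_nonneg (sq_nonneg _) (by linarith [D₀0 x])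
  have cB₀ : Continuous (moll ε b₀) := (moll_contDiff hε hb₀i.locallyIntegrable).continuous
  have cD₀ : Continuous (moll ε d₀) := (moll_contDiff hε hd₀i.locallyIntegrable).continuous
  have iB₀ : Integrable (moll ε b₀) := ⟨cB₀.aestronglyMeasurable,
    lt_of_le_of_lt (lintegral_enorm_moll_le hε hb₀m) hb₀i.2⟩
  have iQ₀ : Integrable Q₀ := by
    refine iB₀.mono ((cB₀.pow 2).div (cD₀.add continuous_const)
      fun x => (by linarith [D₀0 x] : (0 : ℝ) < moll ε d₀ x + δ).ne').aestronglyMeasurable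
      (Eventually.of_forall fun x => ?_)
    rw [Real.norm_of_nonneg (Q₀0 x), Real.norm_of_nonneg (B₀0 x)]
    simp only [hQ₀]
    rw [div_le_iff₀ (by linarith [D₀0 x]), sq]
    exact mul_le_mul_of_nonneg_left (by linarith [BD₀ x]) (B₀0 x)
  have iQ' : Integrable fun x => ∫ t, Q t x ∂(timeMeasure T) := iQ.integral_prod_right
  have iTH' : Integrable fun x => ∫ t, (T - t) * H t x ∂(timeMeasure T) :=
    iTH.integral_prod_right
  -- After the exchange the inner integral of `H` is taken over space, where the divergence
  -- structure makes it small.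
  have hint : T * ∫ x, Q₀ x = (∫ x, (∫ t, Q t x ∂(timeMeasure T)))
      - ∫ t, (T - t) * (∫ x, H t x) ∂(timeMeasure T) := by
    have s1 : ∫ t, (T - t) * (∫ x, H t x) ∂(timeMeasure T)
        = ∫ x, ∫ t, (T - t) * H t x ∂(timeMeasure T) := by
      rw [← integral_integral_swap iTH]
      simp only [integral_const_mul]
    rw [s1, ← integral_sub iQ' iTH', ← integral_const_mul]
    refine integral_congr_ae (Eventually.of_forall fun x => ?_)
    simp only [hx x]
    ring
  have hEs : ∀ᵐ t ∂(timeMeasure T), ‖(T - t) * ∫ x, H t x‖ₑ ≤ ENNReal.ofReal T *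
      (2 * (∫⁻ x, ‖dpComm ε (b t) (u t) (Du t) x‖ₑ)
          + (∫⁻ x, ‖dpComm ε (d t) (u t) (Du t) x‖ₑ)
          + 3 * ENNReal.ofReal δ * ∫⁻ x, ‖Du t x‖ₑ) := by
    filter_upwards [hTs, h.ae_memLp_b, hdd.ae_memLp_b, h.ae_memLp_Du, h.memL2H10.2.2]
      with t h1 h2 h3 h4 h5
    rw [enorm_mul]
    refine mul_le_mul' ?_ ?_
    · rw [← ofReal_norm]; exact ENNReal.ofReal_le_ofReal h1
    · exact enorm_integral_mollFlux_le h.isOpen.measurableSet h.isBounded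
        h.meas_b.of_uncurry_left h.meas_d.of_uncurry_left h.meas_u.of_uncurry_left
        h.meas_Du.of_uncurry_left (h.b_zero t) (h.u_zero t) (h.Du_zero t) (h.b_nonneg t)
        (h.b_le t) h2.2 h3.2 h2.1 h3.1 h5 h4.2 hε hδ
  calc ENNReal.ofReal T * ∫⁻ x, ‖Q₀ x‖ₑ = ‖T * ∫ x, Q₀ x‖ₑ := by
        rw [enorm_mul, Real.enorm_of_nonneg hT.le, Real.enorm_of_nonneg (integral_nonneg Q₀0),
          ofReal_integral_eq_lintegral_ofReal iQ₀ (Eventually.of_forall Q₀0)]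
        congr 1
        exact lintegral_congr fun x => Real.enorm_of_nonneg (Q₀0 x)
    _ ≤ _ := by
        rw [hint]
        refine enorm_sub_le.trans (add_le_add ?_ ?_)
        · rw [← integral_integral_swap iQ]
          refine (enorm_integral_le_lintegral_enorm _).trans (lintegral_mono fun t => ?_)
          exact enorm_integral_le_lintegral_enorm _
        · refine (enorm_integral_le_lintegral_enorm _).trans
            ((lintegral_mono_ae hEs).trans (le_of_eq ?_))
          exact lintegral_const_mul' _ _ ENNReal.ofReal_ne_top

end TransportData

/-! ### Removal of the mollification and of `δ` -/

/-- With `a = b/(d+δ)` and `a' = b'/(d'+δ)`, the difference is exactly `(a + a')(b - b') + a a' (d'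
- d)`, and both fractions lie in `[0,1]`. No dependence on `δ` enters, and convergence in `L¹` of
numerator and denominator is enough. -/
theorem abs_sq_div_sub_sq_div_le {δ b d b' d' : ℝ} (hδ : 0 < δ) (hb : 0 ≤ b) (hbd : b ≤ d)
    (hb' : 0 ≤ b') (hbd' : b' ≤ d') :
    |b ^ 2 / (d + δ) - b' ^ 2 / (d' + δ)| ≤ 2 * |b - b'| + |d - d'| := by
  have hD : 0 < d + δ := by linarith
  have hD' : 0 < d' + δ := by linarith
  set a := b / (d + δ) with ha
  set a' := b' / (d' + δ) with ha'
  have a0 : 0 ≤ a := div_nonneg hb hD.le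
  have a1 : a ≤ 1 := (div_le_one hD).2 (by linarith)
  have a0' : 0 ≤ a' := div_nonneg hb' hD'.le
  have a1' : a' ≤ 1 := (div_le_one hD').2 (by linarith)
  have e : b ^ 2 / (d + δ) - b' ^ 2 / (d' + δ)
      = a * (b - b') + a' * (b - b') + a * a' * (d' - d) := by
    rw [ha, ha']; field_simp; ring
  rw [e]
  have h1 : |a * (b - b')| ≤ |b - b'| := by
    rw [abs_mul, abs_of_nonneg a0]; exact mul_le_of_le_one_left (abs_nonneg _) a1
  have h2 : |a' * (b - b')| ≤ |b - b'| := by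
    rw [abs_mul, abs_of_nonneg a0']; exact mul_le_of_le_one_left (abs_nonneg _) a1'
  have h3 : |a * a' * (d' - d)| ≤ |d - d'| := by
    rw [abs_mul, abs_of_nonneg (mul_nonneg a0 a0'), abs_sub_comm d]
    exact mul_le_of_le_one_left (abs_nonneg _) (mul_le_one₀ a1 a0' a1')
  linarith [abs_add_three (a * (b - b')) (a' * (b - b')) (a * a' * (d' - d))]

theorem enorm_sq_div_le {δ b d b' d' : ℝ} (hδ : 0 < δ) (hb : 0 ≤ b) (hbd : b ≤ d)
    (hb' : 0 ≤ b') (hbd' : b' ≤ d') :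
    ‖b ^ 2 / (d + δ)‖ₑ ≤ ‖b' ^ 2 / (d' + δ)‖ₑ + (2 * ‖b - b'‖ₑ + ‖d - d'‖ₑ) := by
  have h := abs_sq_div_sub_sq_div_le hδ hb hbd hb' hbd'
  have h2 : (2 : ENNReal) = ENNReal.ofReal 2 := by simp
  simp only [Real.enorm_eq_ofReal_abs]
  rw [h2, ← ENNReal.ofReal_mul (by norm_num), ← ENNReal.ofReal_add (by positivity) (by positivity),
    ← ENNReal.ofReal_add (by positivity) (by positivity)]
  refine ENNReal.ofReal_le_ofReal ?_
  linarith [abs_sub_abs_le_abs_sub (b ^ 2 / (d + δ)) (b' ^ 2 / (d' + δ))]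

theorem lintegral_enorm_sq_div_le {α : Type*} [MeasurableSpace α] {μ : Measure α}
    {δ : ℝ} {b d b' d' : α → ℝ} (hδ : 0 < δ) (hb : ∀ x, 0 ≤ b x) (hbd : ∀ x, b x ≤ d x)
    (hb' : ∀ x, 0 ≤ b' x) (hbd' : ∀ x, b' x ≤ d' x) (mb : Measurable b)
    (mb' : Measurable b') (md' : Measurable d') :
    ∫⁻ x, ‖b x ^ 2 / (d x + δ)‖ₑ ∂μ ≤ (∫⁻ x, ‖b' x ^ 2 / (d' x + δ)‖ₑ ∂μ)
      + (2 * (∫⁻ x, ‖b x - b' x‖ₑ ∂μ) + ∫⁻ x, ‖d x - d' x‖ₑ ∂μ) := by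
  have m1 : Measurable fun x => ‖b' x ^ 2 / (d' x + δ)‖ₑ :=
    ((mb'.pow_const 2).div (md'.add_const δ)).enorm
  have m2 : Measurable fun x => ‖b x - b' x‖ₑ := (mb.sub mb').enorm
  rw [← lintegral_const_mul _ m2, ← lintegral_add_left (m2.const_mul 2), ← lintegral_add_left m1]
  exact lintegral_mono fun x => enorm_sq_div_le hδ (hb x) (hbd x) (hb' x) (hbd' x)

namespace TransportData

variable {Ω : Set R3} {T : ℝ} {b d : ℝ → R3 → ℝ} {u : ℝ → R3 → R3} {Du : ℝ → R3 → R3 →L[ℝ] R3}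

theorem measurable_slice_moll_sub (h : TransportData Ω T b d u Du) (ε : ℝ) :
    Measurable (Function.uncurry fun t x => moll ε (b t) x - b t x) :=
  Measurable.sub (f := fun p : ℝ × R3 => moll ε (b p.1) p.2) (measurable_moll_param h.meas_b ε)
    h.meas_b

theorem tendsto_lintegral_lintegral_moll_sub (h : TransportData Ω T b d u Du) :
    Tendsto (fun ε => ∫⁻ t, (∫⁻ x, ‖moll ε (b t) x - b t x‖ₑ) ∂(timeMeasure T))
      (𝓝[>] 0) (𝓝 0) := by
  have mb : ∀ t, Measurable (b t) := fun t => h.meas_b.of_uncurry_left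
  have key : Tendsto (fun ε => ∫⁻ t, (∫⁻ x, ‖moll ε (b t) x - b t x‖ₑ) ∂(timeMeasure T))
      (𝓝[>] 0) (𝓝 (∫⁻ _, 0 ∂(timeMeasure T))) := by
    refine tendsto_lintegral_filter_of_dominated_convergence
      (fun t => 2 * ∫⁻ x, ‖b t x‖ₑ) ?_ ?_ ?_ ?_
    · exact Eventually.of_forall fun ε =>
        (h.measurable_slice_moll_sub ε).enorm.lintegral_prod_right'
    · filter_upwards [self_mem_nhdsWithin] with ε hε
      refine Eventually.of_forall fun t => ?_
      have m1 : Measurable fun x => ‖b t x‖ₑ := (mb t).enorm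
      calc ∫⁻ x, ‖moll ε (b t) x - b t x‖ₑ
          ≤ ∫⁻ x, (‖moll ε (b t) x‖ₑ + ‖b t x‖ₑ) := lintegral_mono fun x => enorm_sub_le
        _ = (∫⁻ x, ‖moll ε (b t) x‖ₑ) + ∫⁻ x, ‖b t x‖ₑ := lintegral_add_right _ m1
        _ ≤ _ := by
          rw [two_mul]
          exact add_le_add (lintegral_enorm_moll_le hε (mb t)) le_rfl
    · have m2 : Measurable fun t => ∫⁻ x, ‖b t x‖ₑ := h.meas_b.enorm.lintegral_prod_right'
      rw [lintegral_const_mul _ m2, lintegral_eq h.isOpen h.meas_b h.b_zero]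
      exact (ENNReal.mul_lt_top (by simp) h.integrable_b.2).ne
    · filter_upwards [h.ae_memLp_b] with t ht
      exact tendsto_lintegral_moll_sub (mb t) ht.2
  simpa using key

/-- Convergence on almost every slice, with the majorant `‖b(t)‖² + ‖Du(t)‖²`, integrable in time,
from the bound that is uniform in `ε`. -/
theorem tendsto_lintegral_lintegral_dpComm (h : TransportData Ω T b d u Du) :
    Tendsto (fun ε => ∫⁻ t, (∫⁻ x, ‖dpComm ε (b t) (u t) (Du t) x‖ₑ) ∂(timeMeasure T))
      (𝓝[>] 0) (𝓝 0) := by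
  have mb : ∀ t, Measurable (b t) := fun t => h.meas_b.of_uncurry_left
  have mu : ∀ t, Measurable (u t) := fun t => h.meas_u.of_uncurry_left
  have mDu : ∀ t, Measurable (Du t) := fun t => h.meas_Du.of_uncurry_left
  have mm : ∀ ε, Measurable (Function.uncurry fun t x => dpComm ε (b t) (u t) (Du t) x) :=
    fun ε => measurable_dpComm_param h.meas_b h.meas_u h.meas_Du ε
  have key : Tendsto (fun ε => ∫⁻ t, (∫⁻ x, ‖dpComm ε (b t) (u t) (Du t) x‖ₑ) ∂(timeMeasure T))
      (𝓝[>] 0) (𝓝 (∫⁻ _, 0 ∂(timeMeasure T))) := by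
    have m1 : Measurable fun t => eLpNorm (b t) 2 volume ^ 2 := by
      simp only [eLpNorm_two_sq]
      exact (h.meas_b.enorm.pow_const 2).lintegral_prod_right'
    have m2 : Measurable fun t => eLpNorm (Du t) 2 volume ^ 2 := by
      simp only [eLpNorm_two_sq]
      exact (h.meas_Du.enorm.pow_const 2).lintegral_prod_right'
    refine tendsto_lintegral_filter_of_dominated_convergence
      (fun t => (∫⁻ z, kernelDensity z) *
        (eLpNorm (b t) 2 volume ^ 2 + eLpNorm (Du t) 2 volume ^ 2)) ?_ ?_ ?_ ?_
    · exact Eventually.of_forall fun ε => (mm ε).enorm.lintegral_prod_right'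
    · filter_upwards [self_mem_nhdsWithin] with ε hε
      filter_upwards [h.memL2H10.2.2] with t ht
      refine (lintegral_dpComm_le hε (mb t) (mu t) (mDu t)
        (IsH10.translate_volume h.isOpen.measurableSet ht (h.u_zero t) (h.Du_zero t))).trans ?_
      gcongr
      rcases le_total (eLpNorm (b t) 2 volume) (eLpNorm (Du t) 2 volume) with hc | hc
      · exact (mul_le_mul' hc le_rfl).trans (by rw [← sq]; exact le_add_self)
      · exact (mul_le_mul' le_rfl hc).trans (by rw [← sq]; exact le_self_add)
    · have m3 : Measurable fun t => eLpNorm (b t) 2 volume ^ 2 + eLpNorm (Du t) 2 volume ^ 2 :=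
        m1.add m2
      rw [lintegral_const_mul _ m3, lintegral_add_left m1,
        lintegral_sq_eq h.isOpen h.meas_b h.b_zero, lintegral_sq_eq h.isOpen h.meas_Du h.Du_zero]
      exact (ENNReal.mul_lt_top lintegral_kernelDensity_lt_top (ENNReal.add_lt_top.2
        ⟨ENNReal.pow_lt_top h.b_memLp.2, ENNReal.pow_lt_top h.memL2H10.2.1.2⟩)).ne
    · filter_upwards [h.ae_memLp_b, h.memL2H10.2.2] with t ht ht2
      exact tendsto_lintegral_dpComm h.isOpen.measurableSet (mb t) ht.2 ht.1 (mu t) (mDu t) ht2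
        (h.u_zero t) (h.Du_zero t)
  simpa using key

/-- The limit `ε → 0` at fixed `δ`: mollification errors and commutators disappear, and the defect
of homogeneity survives as the term with `Du`. -/
theorem quotient_bound_regularized (h : TransportData Ω T b d u Du) (hT : 0 < T) {b₀ d₀ : R3 → ℝ}
    (hb₀m : Measurable b₀) (hd₀m : Measurable d₀)
    (hb₀z : ∀ x, x ∉ Ω → b₀ x = 0) (hd₀z : ∀ x, x ∉ Ω → d₀ x = 0) (hb₀i : Integrable b₀)
    (hd₀i : Integrable d₀) (hb₀ : ∀ x, 0 ≤ b₀ x) (hbd₀ : ∀ x, b₀ x ≤ d₀ x)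
    (hbsol : IsFluxSolution Ω T b₀ b (fun t x => b t x • u t x))
    (hdsol : IsFluxSolution Ω T d₀ d (fun t x => d t x • u t x)) {δ : ℝ} (hδ : 0 < δ) :
    ENNReal.ofReal T * ∫⁻ x, ‖b₀ x ^ 2 / (d₀ x + δ)‖ₑ
      ≤ (∫⁻ t, (∫⁻ x, ‖b t x ^ 2 / (d t x + δ)‖ₑ) ∂(timeMeasure T))
        + ENNReal.ofReal T * (3 * ENNReal.ofReal δ *
            ∫⁻ t, (∫⁻ x, ‖Du t x‖ₑ) ∂(timeMeasure T)) := by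
  have hdd := h.of_dd
  have d_nonneg : ∀ t x, 0 ≤ d t x := hdd.b_nonneg
  have mb : ∀ t, Measurable (b t) := fun t => h.meas_b.of_uncurry_left
  have md : ∀ t, Measurable (d t) := fun t => h.meas_d.of_uncurry_left
  have mQ : Measurable fun t => ∫⁻ x, ‖b t x ^ 2 / (d t x + δ)‖ₑ :=
    ((h.meas_b.pow_const 2).div (h.meas_d.add_const δ)).enorm.lintegral_prod_right'
  have mcb : ∀ ε, Measurable fun t => ∫⁻ x, ‖moll ε (b t) x - b t x‖ₑ := fun ε =>
    (h.measurable_slice_moll_sub ε).enorm.lintegral_prod_right'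
  have mrb : ∀ ε, Measurable fun t => ∫⁻ x, ‖dpComm ε (b t) (u t) (Du t) x‖ₑ := fun ε =>
    (measurable_dpComm_param h.meas_b h.meas_u h.meas_Du ε).enorm.lintegral_prod_right'
  have mrd : ∀ ε, Measurable fun t => ∫⁻ x, ‖dpComm ε (d t) (u t) (Du t) x‖ₑ := fun ε =>
    (measurable_dpComm_param h.meas_d h.meas_u h.meas_Du ε).enorm.lintegral_prod_right'
  set X := ∫⁻ t, (∫⁻ x, ‖b t x ^ 2 / (d t x + δ)‖ₑ) ∂(timeMeasure T)
  set Y := ∫⁻ t, (∫⁻ x, ‖Du t x‖ₑ) ∂(timeMeasure T)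
  set e1 : ℝ → ENNReal := fun ε => 2 * (∫⁻ x, ‖moll ε b₀ x - b₀ x‖ₑ)
    + ∫⁻ x, ‖moll ε d₀ x - d₀ x‖ₑ with he1
  set e2 : ℝ → ENNReal := fun ε =>
    2 * (∫⁻ t, (∫⁻ x, ‖moll ε (b t) x - b t x‖ₑ) ∂(timeMeasure T))
    + ∫⁻ t, (∫⁻ x, ‖moll ε (d t) x - d t x‖ₑ) ∂(timeMeasure T) with he2
  set e3 : ℝ → ENNReal := fun ε =>
    2 * (∫⁻ t, (∫⁻ x, ‖dpComm ε (b t) (u t) (Du t) x‖ₑ) ∂(timeMeasure T))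
    + ∫⁻ t, (∫⁻ x, ‖dpComm ε (d t) (u t) (Du t) x‖ₑ) ∂(timeMeasure T) with he3
  have l1 : Tendsto e1 (𝓝[>] 0) (𝓝 0) := by
    simpa using (ENNReal.Tendsto.const_mul (a := 2) (tendsto_lintegral_moll_sub hb₀m hb₀i)
      (by simp)).add (tendsto_lintegral_moll_sub hd₀m hd₀i)
  have l2 : Tendsto e2 (𝓝[>] 0) (𝓝 0) := by
    simpa using (ENNReal.Tendsto.const_mul (a := 2) h.tendsto_lintegral_lintegral_moll_sub
      (by simp)).add hdd.tendsto_lintegral_lintegral_moll_sub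
  have l3 : Tendsto e3 (𝓝[>] 0) (𝓝 0) := by
    simpa using (ENNReal.Tendsto.const_mul (a := 2) h.tendsto_lintegral_lintegral_dpComm
      (by simp)).add hdd.tendsto_lintegral_lintegral_dpComm
  have lim : Tendsto (fun ε => X + e2 ε + ENNReal.ofReal T * (e3 ε + 3 * ENNReal.ofReal δ * Y)
      + ENNReal.ofReal T * e1 ε) (𝓝[>] 0) (𝓝 (X + 0
        + ENNReal.ofReal T * (0 + 3 * ENNReal.ofReal δ * Y) + ENNReal.ofReal T * 0)) :=
    ((tendsto_const_nhds.add l2).add (ENNReal.Tendsto.const_mul (l3.add tendsto_const_nhds)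
      (Or.inr ENNReal.ofReal_ne_top))).add (ENNReal.Tendsto.const_mul l1
      (Or.inr ENNReal.ofReal_ne_top))
  simp only [add_zero, zero_add, mul_zero] at lim
  refine ge_of_tendsto lim ?_
  filter_upwards [self_mem_nhdsWithin] with ε hε
  have hε' : 0 < ε := hε
  have A : ∫⁻ x, ‖b₀ x ^ 2 / (d₀ x + δ)‖ₑ
      ≤ (∫⁻ x, ‖moll ε b₀ x ^ 2 / (moll ε d₀ x + δ)‖ₑ) + e1 ε := by
    have := lintegral_enorm_sq_div_le (μ := volume) hδ hb₀ hbd₀ (moll_nonneg hε' hb₀)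
      (moll_mono hε' hb₀i hd₀i hbd₀) hb₀m
      (moll_contDiff hε' hb₀i.locallyIntegrable).continuous.measurable
      (moll_contDiff hε' hd₀i.locallyIntegrable).continuous.measurable
    simpa only [he1, enorm_sub_rev] using this
  have B : ∫⁻ t, (∫⁻ x, ‖moll ε (b t) x ^ 2 / (moll ε (d t) x + δ)‖ₑ) ∂(timeMeasure T)
      ≤ X + e2 ε := by
    calc _ ≤ ∫⁻ t, ((∫⁻ x, ‖b t x ^ 2 / (d t x + δ)‖ₑ) + (2 *
          (∫⁻ x, ‖moll ε (b t) x - b t x‖ₑ) + ∫⁻ x, ‖moll ε (d t) x - d t x‖ₑ))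
          ∂(timeMeasure T) := by
          refine lintegral_mono_ae ?_
          filter_upwards [h.ae_memLp_b, hdd.ae_memLp_b] with t h1 h2
          exact lintegral_enorm_sq_div_le hδ (moll_nonneg hε' (h.b_nonneg t))
            (moll_mono hε' h1.2 h2.2 (h.b_le t)) (h.b_nonneg t) (h.b_le t)
            (moll_contDiff hε' h1.2.locallyIntegrable).continuous.measurable (mb t) (md t)
      _ = _ := by
          rw [lintegral_add_left mQ, lintegral_add_left ((mcb ε).const_mul 2),
            lintegral_const_mul _ (mcb ε)]
  have C := h.mollified_bound hT hb₀m hb₀z hd₀z hb₀i hd₀i hb₀ hbd₀ hbsol hdsol hε' hδ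
  have D : ∫⁻ t, (2 * (∫⁻ x, ‖dpComm ε (b t) (u t) (Du t) x‖ₑ)
          + (∫⁻ x, ‖dpComm ε (d t) (u t) (Du t) x‖ₑ)
          + 3 * ENNReal.ofReal δ * ∫⁻ x, ‖Du t x‖ₑ) ∂(timeMeasure T)
      = e3 ε + 3 * ENNReal.ofReal δ * Y := by
    have m3 : Measurable fun t => 2 * (∫⁻ x, ‖dpComm ε (b t) (u t) (Du t) x‖ₑ)
        + ∫⁻ x, ‖dpComm ε (d t) (u t) (Du t) x‖ₑ := ((mrb ε).const_mul 2).add (mrd ε)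
    rw [lintegral_add_left m3,
      lintegral_add_left ((mrb ε).const_mul 2), lintegral_const_mul _ (mrb ε),
      lintegral_const_mul' _ _ (ENNReal.mul_ne_top (by simp) ENNReal.ofReal_ne_top)]
  rw [D] at C
  calc _ ≤ ENNReal.ofReal T * ((∫⁻ x, ‖moll ε b₀ x ^ 2 / (moll ε d₀ x + δ)‖ₑ) + e1 ε) := by
        gcongr
    _ = ENNReal.ofReal T * (∫⁻ x, ‖moll ε b₀ x ^ 2 / (moll ε d₀ x + δ)‖ₑ)
        + ENNReal.ofReal T * e1 ε := mul_add _ _ _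
    _ ≤ _ := by
        gcongr
        exact C.trans (by gcongr)

/-- The integral of `b²/d` does not decrease along the transport equation. -/
theorem quotient_bound (h : TransportData Ω T b d u Du) (hT : 0 < T) {b₀ d₀ : R3 → ℝ}
    (hb₀m : Measurable b₀) (hd₀m : Measurable d₀)
    (hb₀z : ∀ x, x ∉ Ω → b₀ x = 0) (hd₀z : ∀ x, x ∉ Ω → d₀ x = 0) (hb₀i : Integrable b₀)
    (hd₀i : Integrable d₀) (hb₀ : ∀ x, 0 ≤ b₀ x) (hbd₀ : ∀ x, b₀ x ≤ d₀ x)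
    (hbsol : IsFluxSolution Ω T b₀ b (fun t x => b t x • u t x))
    (hdsol : IsFluxSolution Ω T d₀ d (fun t x => d t x • u t x)) :
    ENNReal.ofReal T * ∫⁻ x, ‖b₀ x ^ 2 / d₀ x‖ₑ
      ≤ ∫⁻ t, (∫⁻ x, ‖b t x ^ 2 / d t x‖ₑ) ∂(timeMeasure T) := by
  have hfin : ∫⁻ t, (∫⁻ x, ‖Du t x‖ₑ) ∂(timeMeasure T) < ⊤ := by
    rw [lintegral_eq h.isOpen h.meas_Du h.Du_zero]
    have := isFiniteMeasure_cylMeasure h.isBounded T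
    exact (h.memL2H10.2.1.integrable (by norm_num)).2
  -- Dominated convergence with majorant `b₀`, since `b₀ ≤ d₀`. Where `d₀ = 0` also `b₀ = 0`, in
  -- accordance with the convention for the quotient.
  have lL : Tendsto (fun δ => ENNReal.ofReal T * ∫⁻ x, ‖b₀ x ^ 2 / (d₀ x + δ)‖ₑ) (𝓝[>] 0)
      (𝓝 (ENNReal.ofReal T * ∫⁻ x, ‖b₀ x ^ 2 / d₀ x‖ₑ)) := by
    refine ENNReal.Tendsto.const_mul ?_ (Or.inr ENNReal.ofReal_ne_top)
    refine tendsto_lintegral_filter_of_dominated_convergence (fun x => ‖b₀ x‖ₑ) ?_ ?_ hb₀i.2.ne ?_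
    · exact Eventually.of_forall fun δ => ((hb₀m.pow_const 2).div (hd₀m.add_const δ)).enorm
    · filter_upwards [self_mem_nhdsWithin] with δ hδ
      refine Eventually.of_forall fun x => ?_
      have hδ' : 0 < δ := hδ
      have h1 := hb₀ x
      have h2 := hbd₀ x
      have h3 : 0 < d₀ x + δ := by linarith
      rw [Real.enorm_of_nonneg (div_nonneg (sq_nonneg _) h3.le), Real.enorm_of_nonneg h1]
      refine ENNReal.ofReal_le_ofReal ?_
      rw [div_le_iff₀ h3, sq]
      exact mul_le_mul_of_nonneg_left (by linarith) h1
    · refine Eventually.of_forall fun x => ?_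
      rcases eq_or_ne (d₀ x) 0 with h0 | h0
      · have : b₀ x = 0 := le_antisymm (h0 ▸ hbd₀ x) (hb₀ x)
        simp [this]
      · refine (Tendsto.enorm ?_)
        refine Tendsto.mono_left ?_ nhdsWithin_le_nhds
        have : ContinuousAt (fun δ => b₀ x ^ 2 / (d₀ x + δ)) 0 :=
          continuousAt_const.div (continuousAt_const.add continuousAt_id) (by simpa using h0)
        simpa [ContinuousAt] using this
  have lR : Tendsto (fun δ => (∫⁻ t, (∫⁻ x, ‖b t x ^ 2 / d t x‖ₑ) ∂(timeMeasure T))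
        + ENNReal.ofReal T * (3 * ENNReal.ofReal δ *
            ∫⁻ t, (∫⁻ x, ‖Du t x‖ₑ) ∂(timeMeasure T))) (𝓝[>] 0)
      (𝓝 (∫⁻ t, (∫⁻ x, ‖b t x ^ 2 / d t x‖ₑ) ∂(timeMeasure T))) := by
    have h1 : Tendsto (fun δ : ℝ => ENNReal.ofReal δ) (𝓝[>] 0) (𝓝 0) := by
      have := (ENNReal.continuous_ofReal.tendsto 0).mono_left
        (nhdsWithin_le_nhds : 𝓝[>] (0 : ℝ) ≤ 𝓝 0)
      simpa using this
    have h2 := ENNReal.Tendsto.mul_const (ENNReal.Tendsto.const_mul (a := 3) h1 (by simp))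
      (Or.inr hfin.ne)
    have h3 := (ENNReal.Tendsto.const_mul h2 (Or.inr (ENNReal.ofReal_ne_top (r := T)))).const_add
      (∫⁻ t, (∫⁻ x, ‖b t x ^ 2 / d t x‖ₑ) ∂(timeMeasure T))
    simpa using h3
  refine le_of_tendsto_of_tendsto lL lR ?_
  filter_upwards [self_mem_nhdsWithin] with δ hδ
  have hδ' : 0 < δ := hδ
  -- On the right `δ` is simply dropped from the denominator, which increases the quotient where `d
  -- > 0`; where `d = 0` both sides vanish.
  refine (h.quotient_bound_regularized hT hb₀m hd₀m hb₀z hd₀z hb₀i hd₀i hb₀ hbd₀ hbsol hdsol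
    hδ').trans (add_le_add_left (lintegral_mono fun t => lintegral_mono fun x => ?_) _)
  have h1 := h.b_nonneg t x
  have h2 := h.b_le t x
  rcases (h1.trans h2).eq_or_lt with h0 | h0
  · have : b t x = 0 := le_antisymm (h0 ▸ h2) h1
    simp [this]
  · rw [Real.enorm_of_nonneg (by positivity), Real.enorm_of_nonneg (by positivity)]
    refine ENNReal.ofReal_le_ofReal ?_
    gcongr
    linarith

end TransportData

/-! ### Weak compactness in `L²` -/

section WeakCompactness

variable {H : Type*} [NormedAddCommGroup H] [InnerProductSpace ℝ H] [CompleteSpace H]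

/-- Closed balls of the dual of a separable space are weak-* sequentially compact, and Riesz
representation identifies the dual with `H`. -/
theorem exists_weak_limit_of_bounded [TopologicalSpace.SeparableSpace H] {x : ℕ → H} {C : ℝ}
    (hx : ∀ k, ‖x k‖ ≤ C) :
    ∃ (σ : ℕ → ℕ) (y : H), StrictMono σ ∧
      ∀ z, Tendsto (fun k => inner ℝ (x (σ k)) z) atTop (𝓝 (inner ℝ y z)) := by
  have h := WeakDual.isSeqCompact_closedBall ℝ H 0 C
  have hm : ∀ k, StrongDual.toWeakDual (InnerProductSpace.toDual ℝ H (x k)) ∈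
      (WeakDual.toStrongDual ⁻¹' Metric.closedBall (0 : StrongDual ℝ H) C) := fun k => by
    simp only [mem_preimage, mem_closedBall_zero_iff]
    exact ((InnerProductSpace.toDual ℝ H).norm_map (x k)).le.trans (hx k)
  obtain ⟨a, -, σ, hσ, ha⟩ := h hm
  refine ⟨σ, (InnerProductSpace.toDual ℝ H).symm (WeakDual.toStrongDual a), hσ, fun z => ?_⟩
  have h1 := ((WeakDual.eval_continuous z).tendsto a).comp ha
  have e : inner ℝ ((InnerProductSpace.toDual ℝ H).symm (WeakDual.toStrongDual a)) z = a z :=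
    InnerProductSpace.toDual_symm_apply
  rw [e]
  exact h1

/-- Let `p` be the projection of `y` on `K`. The variational inequality `⟨x k - p, y - p⟩ ≤ 0`
passes to the weak limit and gives `‖y - p‖² ≤ 0`. -/
theorem mem_of_weak_limit {K : Set H} (hK : Convex ℝ K) (hc : IsClosed K) {x : ℕ → H} {y : H}
    (hx : ∀ k, x k ∈ K) (hw : ∀ z, Tendsto (fun k => inner ℝ (x k) z) atTop (𝓝 (inner ℝ y z))) :
    y ∈ K := by
  obtain ⟨p, hp, hmin⟩ := exists_norm_eq_iInf_of_complete_convex ⟨x 0, hx 0⟩ hc.isComplete hK y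
  have hle := (norm_eq_iInf_iff_real_inner_le_zero hK hp).1 hmin
  have h1 : Tendsto (fun k => inner ℝ (x k - p) (y - p)) atTop (𝓝 (inner ℝ (y - p) (y - p))) := by
    simp only [inner_sub_left _ p]
    exact (hw (y - p)).sub_const _
  have h2 : inner ℝ (y - p) (y - p) ≤ 0 := le_of_tendsto' h1 fun k => by
    rw [real_inner_comm]; exact hle _ (hx k)
  have h3 : y - p = 0 := inner_self_eq_zero (𝕜 := ℝ).1 (le_antisymm h2 real_inner_self_nonneg)
  rwa [sub_eq_zero.1 h3]

variable {α E : Type*} [MeasurableSpace α] [NormedAddCommGroup E] [NormedSpace ℝ E]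

/-- Weak convergence in `L²(μ; E)`. -/
def WeaklyTendsto (μ : Measure α) (f : ℕ → α → E) (g : α → E) : Prop :=
  ∀ ψ : α → E →L[ℝ] ℝ, MemLp ψ 2 μ →
    Tendsto (fun k => ∫ x, ψ x (f k x) ∂μ) atTop (𝓝 (∫ x, ψ x (g x) ∂μ))

variable {μ : Measure α}

theorem WeaklyTendsto.comp {f : ℕ → α → E} {g : α → E} (h : WeaklyTendsto μ f g) {σ : ℕ → ℕ}
    (hσ : StrictMono σ) : WeaklyTendsto μ (fun k => f (σ k)) g :=
  fun ψ hψ => (h ψ hψ).comp hσ.tendsto_atTop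

theorem WeaklyTendsto.clm {F : Type*} [NormedAddCommGroup F] [NormedSpace ℝ F]
    {f : ℕ → α → E} {g : α → E} (h : WeaklyTendsto μ f g) (L : E →L[ℝ] F) :
    WeaklyTendsto μ (fun k x => L (f k x)) (fun x => L (g x)) := fun ψ hψ =>
  h (fun x => (ψ x).comp L)
    (((ContinuousLinearMap.compL ℝ E F ℝ).flip L).comp_memLp' hψ)

theorem WeaklyTendsto.tendsto_inner {F : Type*} [NormedAddCommGroup F] [InnerProductSpace ℝ F]
    {f : ℕ → α → F} {g : α → F} (h : WeaklyTendsto μ f g) {ψ : α → F} (hψ : MemLp ψ 2 μ) :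
    Tendsto (fun k => ∫ x, inner ℝ (f k x) (ψ x) ∂μ) atTop (𝓝 (∫ x, inner ℝ (g x) (ψ x) ∂μ)) := by
  have := h (fun x => innerSL ℝ (ψ x)) ((innerSL ℝ).comp_memLp' hψ)
  simpa only [innerSL_apply_apply, real_inner_comm] using this

theorem WeaklyTendsto.tendsto_mul {f : ℕ → α → ℝ} {g : α → ℝ} (h : WeaklyTendsto μ f g) {ψ : α → ℝ}
    (hψ : MemLp ψ 2 μ) :
    Tendsto (fun k => ∫ x, f k x * ψ x ∂μ) atTop (𝓝 (∫ x, g x * ψ x ∂μ)) := by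
  have := h (fun x => ContinuousLinearMap.mul ℝ ℝ (ψ x))
    ((ContinuousLinearMap.mul ℝ ℝ).comp_memLp' hψ)
  simpa only [ContinuousLinearMap.mul_apply', mul_comm] using this

theorem WeaklyTendsto.congr {f f' : ℕ → α → E} {g g' : α → E} (h : WeaklyTendsto μ f g)
    (hf : ∀ k, f k =ᵐ[μ] f' k) (hg : g =ᵐ[μ] g') : WeaklyTendsto μ f' g' := by
  intro ψ hψ
  have := h ψ hψ
  have e1 : ∀ k, ∫ x, ψ x (f k x) ∂μ = ∫ x, ψ x (f' k x) ∂μ := fun k =>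
    integral_congr_ae ((hf k).mono fun x hx => by simp only [hx])
  have e2 : ∫ x, ψ x (g x) ∂μ = ∫ x, ψ x (g' x) ∂μ :=
    integral_congr_ae (hg.mono fun x hx => by simp only [hx])
  simpa only [e1, e2] using this

variable [FiniteDimensional ℝ E]

/-- The norm of `E` need not come from an inner product (operator and product norms occur). A linear
isomorphism with a Euclidean space moves the problem to a Hilbert space; this identity translates
its inner product into the pairing used for weak convergence. -/
theorem inner_toLp_toEuclidean {f : α → E} (hf : MemLp (fun x => toEuclidean (f x)) 2 μ)
    (h : Lp (EuclideanSpace ℝ (Fin (Module.finrank ℝ E))) 2 μ) :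
    inner ℝ (hf.toLp _) h
      = ∫ x, ((innerSL ℝ (h x)).comp (toEuclidean (E := E)).toContinuousLinearMap) (f x) ∂μ := by
  rw [L2.inner_def]
  refine integral_congr_ae (hf.coeFn_toLp.mono fun x hx => ?_)
  simp only [hx, ContinuousLinearMap.comp_apply, innerSL_apply_apply]
  exact real_inner_comm _ _

theorem memLp_innerSL_comp_toEuclidean (h : Lp (EuclideanSpace ℝ (Fin (Module.finrank ℝ E))) 2 μ) :
    MemLp (fun x => (innerSL ℝ (h x)).comp (toEuclidean (E := E)).toContinuousLinearMap) 2 μ :=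
  (((ContinuousLinearMap.compL ℝ E (EuclideanSpace ℝ (Fin (Module.finrank ℝ E))) ℝ).flip
    (toEuclidean (E := E)).toContinuousLinearMap).comp (innerSL ℝ)).comp_memLp' (Lp.memLp h)

theorem exists_weaklyTendsto [IsSeparable μ] {f : ℕ → α → E} (hf : ∀ k, MemLp (f k) 2 μ)
    {C : ENNReal} (hC : C ≠ ⊤) (hb : ∀ k, eLpNorm (f k) 2 μ ≤ C) :
    ∃ (σ : ℕ → ℕ) (g : α → E), StrictMono σ ∧ MemLp g 2 μ ∧
      WeaklyTendsto μ (fun k => f (σ k)) g := by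
  have : Fact ((2 : ENNReal) ≠ ⊤) := ⟨by simp⟩
  set Φ := (toEuclidean (E := E))
  have hm : ∀ {f : α → E}, MemLp f 2 μ → MemLp (fun x => Φ (f x)) 2 μ := fun hf =>
    Φ.toContinuousLinearMap.comp_memLp' hf
  set x : ℕ → Lp (EuclideanSpace ℝ (Fin (Module.finrank ℝ E))) 2 μ := fun k => (hm (hf k)).toLp _
  obtain ⟨B, hB⟩ : ∃ B : ℝ, ∀ k, ‖x k‖ ≤ B := by
    refine ⟨‖Φ.toContinuousLinearMap‖ * C.toReal, fun k => ?_⟩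
    rw [Lp.norm_toLp]
    have h1 : eLpNorm (fun y => Φ (f k y)) 2 μ ≤ ‖Φ.toContinuousLinearMap‖ₑ * C := by
      refine (eLpNorm_le_nnreal_smul_eLpNorm_of_ae_le_mul (c := ‖Φ.toContinuousLinearMap‖₊)
        (g := f k) (Eventually.of_forall fun y => ?_) 2).trans ?_
      · exact Φ.toContinuousLinearMap.le_opNNNorm _
      · rw [ENNReal.smul_def, smul_eq_mul]
        exact mul_le_mul' le_rfl (hb k)
    refine (ENNReal.toReal_mono (ENNReal.mul_ne_top enorm_ne_top hC) h1).trans ?_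
    rw [ENNReal.toReal_mul]
    simp
  obtain ⟨σ, y, hσ, hy⟩ := exists_weak_limit_of_bounded hB
  have hg : MemLp (fun z => Φ.symm (y z)) 2 μ :=
    Φ.symm.toContinuousLinearMap.comp_memLp' (Lp.memLp y)
  refine ⟨σ, fun z => Φ.symm (y z), hσ, hg, fun ψ hψ => ?_⟩
  -- A test functional on `E`, transported to the Euclidean space, becomes a vector by Riesz
  -- representation.
  set R := (InnerProductSpace.toDual ℝ (EuclideanSpace ℝ (Fin (Module.finrank ℝ E)))).symm
  have hR : MemLp (fun z => R ((ψ z).comp Φ.symm.toContinuousLinearMap)) 2 μ := by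
    have := ((ContinuousLinearMap.compL ℝ (EuclideanSpace ℝ (Fin (Module.finrank ℝ E))) E ℝ).flip
      Φ.symm.toContinuousLinearMap).comp_memLp' hψ
    refine this.of_le (R.continuous.comp_aestronglyMeasurable this.1)
      (Eventually.of_forall fun z => ?_)
    exact (R.norm_map _).le
  have e : ∀ (h : α → E) (hh : MemLp h 2 μ),
      inner ℝ ((hm hh).toLp _) (hR.toLp _) = ∫ z, ψ z (h z) ∂μ := by
    intro h hh
    rw [L2.inner_def]
    refine integral_congr_ae ?_
    filter_upwards [(hm hh).coeFn_toLp, hR.coeFn_toLp] with z h1 h2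
    rw [h1, h2, real_inner_comm, InnerProductSpace.toDual_symm_apply]
    simp
  have key := hy (hR.toLp _)
  have ey : (hm hg).toLp _ = y := by
    refine Lp.ext ((hm hg).coeFn_toLp.trans (Eventually.of_forall fun z => ?_))
    simp
  rw [← ey, e _ hg] at key
  simpa only [x, e _ (hf _)] using key

/-- Weak limits stay in convex classes of functions that are closed in `L²`. -/
theorem WeaklyTendsto.mem_of_convex {f : ℕ → α → E} {g : α → E} (h : WeaklyTendsto μ f g)
    (hf : ∀ k, MemLp (f k) 2 μ) (hg : MemLp g 2 μ) {P : (α → E) → Prop}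
    (hP : ∀ u v, u =ᵐ[μ] v → P u → P v)
    (hconv : ∀ u v, P u → P v → ∀ a b : ℝ, 0 ≤ a → 0 ≤ b → a + b = 1 →
      P fun x => a • u x + b • v x)
    (hclosed : ∀ (u : ℕ → α → E) (v : α → E), (∀ k, MemLp (u k) 2 μ) → MemLp v 2 μ →
      (∀ k, P (u k)) → Tendsto (fun k => eLpNorm (fun x => u k x - v x) 2 μ) atTop (𝓝 0) → P v)
    (hfP : ∀ k, P (f k)) : P g := by
  set Φ := (toEuclidean (E := E))
  have hm : ∀ {f : α → E}, MemLp f 2 μ → MemLp (fun x => Φ (f x)) 2 μ := fun hf =>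
    Φ.toContinuousLinearMap.comp_memLp' hf
  -- The class `P` becomes a closed convex set in the Hilbert space, to which `mem_of_weak_limit`
  -- applies.
  set K : Set (Lp (EuclideanSpace ℝ (Fin (Module.finrank ℝ E))) 2 μ) :=
    {y | P fun x => Φ.symm (y x)} with hK
  have mem : ∀ {u : α → E} (hu : MemLp u 2 μ), (hm hu).toLp _ ∈ K ↔ P u := by
    intro u hu
    have : (fun x => Φ.symm ((hm hu).toLp _ x)) =ᵐ[μ] u :=
      (hm hu).coeFn_toLp.mono fun x hx => by simp only [hx]; simp
    exact ⟨hP _ _ this, hP _ _ this.symm⟩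
  rw [← mem hg]
  refine mem_of_weak_limit (x := fun k => (hm (hf k)).toLp _) ?_ ?_ (fun k => (mem (hf k)).2 (hfP k))
    fun z => ?_
  · intro y hy z hz a b ha hb hab
    refine hP _ _ ?_ (hconv _ _ hy hz a b ha hb hab)
    filter_upwards [Lp.coeFn_add (a • y) (b • z), Lp.coeFn_smul a y, Lp.coeFn_smul b z]
      with x h1 h2 h3
    rw [h1, Pi.add_apply, h2, h3]
    simp
  · refine IsSeqClosed.isClosed fun y z hy hz => ?_
    have hz' := (Lp.tendsto_Lp_iff_tendsto_eLpNorm' y z).1 hz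
    have hs : ∀ w : Lp (EuclideanSpace ℝ (Fin (Module.finrank ℝ E))) 2 μ,
        MemLp (fun x => Φ.symm (w x)) 2 μ := fun w =>
      Φ.symm.toContinuousLinearMap.comp_memLp' (Lp.memLp w)
    refine hclosed (fun k x => Φ.symm (y k x)) _ (fun k => hs _) (hs z) hy ?_
    have hlim : Tendsto (fun k => (‖Φ.symm.toContinuousLinearMap‖₊ : ENNReal) *
        eLpNorm (⇑(y k) - ⇑z) 2 μ) atTop (𝓝 0) := by
      simpa using ENNReal.Tendsto.const_mul hz' (Or.inr ENNReal.coe_ne_top)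
    refine tendsto_of_tendsto_of_tendsto_of_le_of_le tendsto_const_nhds hlim
      (fun _ => zero_le) fun k => ?_
    refine (eLpNorm_le_nnreal_smul_eLpNorm_of_ae_le_mul (c := ‖Φ.symm.toContinuousLinearMap‖₊)
        (g := ⇑(y k) - ⇑z) (Eventually.of_forall fun x => ?_) 2)
    rw [← map_sub]
    exact Φ.symm.toContinuousLinearMap.le_opNNNorm _
  · have e : ∀ {u : α → E} (hu : MemLp u 2 μ), inner ℝ ((hm hu).toLp _) z
        = ∫ x, ((innerSL ℝ (z x)).comp Φ.toContinuousLinearMap) (u x) ∂μ := fun hu =>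
      inner_toLp_toEuclidean (hm hu) z
    rw [e hg]
    refine Tendsto.congr (fun k => (e (hf k)).symm) ?_
    exact h _ (memLp_innerSL_comp_toEuclidean z)

end WeakCompactness

/-! ### Time slices and `L^∞(0,T;L²(Ω))` -/

/-- Interchange of limits: used for truncation of test functions, averaging in time, and
mollification in space. -/
theorem tendsto_of_uniform_approx {a : ℕ → ℝ} {l : ℝ}
    (h : ∀ η > 0, ∃ (b : ℕ → ℝ) (m : ℝ), (∀ k, |a k - b k| ≤ η) ∧ |l - m| ≤ η ∧
      Tendsto b atTop (𝓝 m)) : Tendsto a atTop (𝓝 l) := by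
  rw [Metric.tendsto_atTop]
  intro ε hε
  obtain ⟨b, m, h1, h2, h3⟩ := h (ε / 4) (by positivity)
  obtain ⟨N, hN⟩ := Metric.tendsto_atTop.1 h3 (ε / 4) (by positivity)
  refine ⟨N, fun k hk => ?_⟩
  have h4 := hN k hk
  rw [Real.dist_eq] at h4 ⊢
  have h5 := h1 k
  rw [abs_le] at h5 h2
  rw [abs_lt] at h4 ⊢
  constructor <;> linarith [h4.1, h4.2, h5.1, h5.2, h2.1, h2.2]

theorem tendsto_zero_of_tendsto_sq {ι : Type*} {l : Filter ι} {a : ι → ENNReal}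
    (h : Tendsto (fun i => a i ^ 2) l (𝓝 0)) : Tendsto a l (𝓝 0) := by
  have h4 := (ENNReal.continuous_rpow_const (y := (1 / 2 : ℝ))).tendsto 0 |>.comp h
  rw [ENNReal.zero_rpow_of_pos (by norm_num)] at h4
  refine h4.congr fun k => ?_
  simp only [Function.comp_apply]
  rw [← ENNReal.rpow_natCast, ← ENNReal.rpow_mul]
  norm_num

section Slices

variable {Ω : Set R3} {T : ℝ} {E : Type*} [NormedAddCommGroup E]

theorem ae_ae_of_ae_cylMeasure {p : ℝ × R3 → Prop} (h : ∀ᵐ z ∂(cylMeasure Ω T), p z) :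
    ∀ᵐ t ∂(timeMeasure T), ∀ᵐ x ∂(volume.restrict Ω), p (t, x) := by
  rw [cylMeasure_eq_prod] at h
  exact Measure.ae_ae_of_ae_prod h

theorem ae_aestronglyMeasurable_slice {f : ℝ × R3 → E}
    (hf : AEStronglyMeasurable f (cylMeasure Ω T)) :
    ∀ᵐ t ∂(timeMeasure T), AEStronglyMeasurable (fun x => f (t, x)) (volume.restrict Ω) := by
  rw [cylMeasure_eq_prod] at hf
  exact hf.prodMk_left

theorem aemeasurable_eLpNorm_slice {f : ℝ × R3 → E}
    (hf : AEStronglyMeasurable f (cylMeasure Ω T)) :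
    AEMeasurable (fun t => eLpNorm (fun x => f (t, x)) 2 (volume.restrict Ω)) (timeMeasure T) := by
  rw [cylMeasure_eq_prod] at hf
  have h := ((hf.enorm.pow_const (2 : ℝ)).lintegral_prod_right').pow_const (1 / 2 : ℝ)
  refine h.congr (Eventually.of_forall fun t => ?_)
  simp only
  rw [eLpNorm_eq_lintegral_rpow_enorm_toReal (by norm_num) (by norm_num)]
  simp

theorem eLpNorm_cylMeasure_sq {f : ℝ × R3 → E} (hf : AEStronglyMeasurable f (cylMeasure Ω T)) :
    eLpNorm f 2 (cylMeasure Ω T) ^ 2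
      = ∫⁻ t, eLpNorm (fun x => f (t, x)) 2 (volume.restrict Ω) ^ 2 ∂(timeMeasure T) := by
  rw [eLpNorm_two_sq]
  simp only [eLpNorm_two_sq]
  exact lintegral_cylMeasure Ω T (f := fun t x => ‖f (t, x)‖ₑ ^ 2) (hf.enorm.pow_const 2)

theorem exists_subseq_slices_tendsto {u : ℕ → ℝ × R3 → E} {v : ℝ × R3 → E}
    (hu : ∀ k, AEStronglyMeasurable (u k) (cylMeasure Ω T))
    (hv : AEStronglyMeasurable v (cylMeasure Ω T))
    (h : Tendsto (fun k => eLpNorm (fun z => u k z - v z) 2 (cylMeasure Ω T)) atTop (𝓝 0)) :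
    ∃ σ : ℕ → ℕ, StrictMono σ ∧ ∀ᵐ t ∂(timeMeasure T), Tendsto (fun k =>
      eLpNorm (fun x => u (σ k) (t, x) - v (t, x)) 2 (volume.restrict Ω)) atTop (𝓝 0) := by
  have h2 : Tendsto (fun k => eLpNorm (fun z => u k z - v z) 2 (cylMeasure Ω T) ^ 2) atTop
      (𝓝 0) := by
    simpa using ENNReal.Tendsto.pow (n := 2) h
  -- Squared distances at most `2⁻ⁿ` are summable; integrated in time, this makes the sum over the
  -- subsequence of squared slice distances finite at almost every time, so its terms tend to zero
  -- there.
  obtain ⟨σ, hσ, hle⟩ := extraction_forall_of_eventually fun n : ℕ =>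
    (h2.eventually_le_const (u := (2⁻¹ : ENNReal) ^ n) (ENNReal.pow_pos (by simp) n))
  refine ⟨σ, hσ, ?_⟩
  set G : ℕ → ℝ → ENNReal := fun k t =>
    eLpNorm (fun x => u (σ k) (t, x) - v (t, x)) 2 (volume.restrict Ω) with hG
  have hm : ∀ k, AEMeasurable (fun t => G k t ^ 2) (timeMeasure T) := fun k =>
    (aemeasurable_eLpNorm_slice (f := fun z => u (σ k) z - v z) ((hu (σ k)).sub hv)).pow_const 2
  have hI : ∀ k, ∫⁻ t, G k t ^ 2 ∂(timeMeasure T) ≤ (2⁻¹ : ENNReal) ^ k := fun k => by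
    refine le_of_eq_of_le ?_ (hle k)
    exact (eLpNorm_cylMeasure_sq (f := fun z => u (σ k) z - v z) ((hu (σ k)).sub hv)).symm
  have hsum : ∫⁻ t, (∑' k, G k t ^ 2) ∂(timeMeasure T) ≠ ⊤ := by
    rw [lintegral_tsum hm]
    refine ne_top_of_le_ne_top ?_ (ENNReal.tsum_le_tsum hI)
    rw [ENNReal.tsum_geometric]
    simp
  filter_upwards [ae_lt_top' (AEMeasurable.tsum hm) hsum] with t ht
  have h3 := ENNReal.tendsto_atTop_zero_of_tsum_ne_top ht.ne
  exact tendsto_zero_of_tendsto_sq h3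

theorem normLinfL2_le_iff {f : ℝ → R3 → ℝ} {C : ENNReal} :
    normLinfL2 Ω T f ≤ C ↔
      ∀ᵐ t ∂(timeMeasure T), eLpNorm (f t) 2 (volume.restrict Ω) ≤ C :=
  ⟨fun h => (ENNReal.ae_le_essSup _).mono fun _ ht => ht.trans h, fun h => essSup_le_of_ae_le C h⟩

theorem eLpNorm_le_of_normLinfL2_le {f : ℝ → R3 → ℝ}
    (hf : AEStronglyMeasurable (Function.uncurry f) (cylMeasure Ω T)) {C : ENNReal}
    (h : normLinfL2 Ω T f ≤ C) :
    eLpNorm (Function.uncurry f) 2 (cylMeasure Ω T) ^ 2 ≤ C ^ 2 * ENNReal.ofReal T := by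
  rw [eLpNorm_cylMeasure_sq hf]
  calc _ ≤ ∫⁻ _, C ^ 2 ∂(timeMeasure T) := by
        refine lintegral_mono_ae ((normLinfL2_le_iff.1 h).mono fun t ht => ?_)
        exact pow_le_pow_left' ht 2
    _ = _ := by simp [timeMeasure]

theorem memLp_of_normLinfL2_le {f : ℝ → R3 → ℝ}
    (hf : AEStronglyMeasurable (Function.uncurry f) (cylMeasure Ω T)) {C : ENNReal} (hC : C ≠ ⊤)
    (h : normLinfL2 Ω T f ≤ C) : MemLp (Function.uncurry f) 2 (cylMeasure Ω T) := by
  refine ⟨hf, ?_⟩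
  have h1 := eLpNorm_le_of_normLinfL2_le hf h
  have h2 : C ^ 2 * ENNReal.ofReal T < ⊤ :=
    ENNReal.mul_lt_top (ENNReal.pow_lt_top hC.lt_top) ENNReal.ofReal_lt_top
  by_contra hc
  rw [not_lt, top_le_iff] at hc
  rw [hc] at h1
  exact absurd (h1.trans_lt h2) (by simp)

/-- A bound on almost every slice is a convex condition, and it is closed in `L²` because a
subsequence converges on almost every slice. Weak limits therefore inherit it. -/
theorem normLinfL2_le_of_weaklyTendsto {f : ℕ → ℝ → R3 → ℝ} {g : ℝ → R3 → ℝ} {C : ENNReal}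
    (hw : WeaklyTendsto (cylMeasure Ω T) (fun k => Function.uncurry (f k)) (Function.uncurry g))
    (hf : ∀ k, MemLp (Function.uncurry (f k)) 2 (cylMeasure Ω T))
    (hg : MemLp (Function.uncurry g) 2 (cylMeasure Ω T)) (hfC : ∀ k, normLinfL2 Ω T (f k) ≤ C) :
    normLinfL2 Ω T g ≤ C := by
  rw [normLinfL2_le_iff]
  refine hw.mem_of_convex (P := fun u => AEStronglyMeasurable u (cylMeasure Ω T) ∧
    ∀ᵐ t ∂(timeMeasure T),
    eLpNorm (fun x => u (t, x)) 2 (volume.restrict Ω) ≤ C) hf hg ?_ ?_ ?_ (fun k => ⟨(hf k).1,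
      normLinfL2_le_iff.1 (hfC k)⟩) |>.2
  · rintro u v huv ⟨hu1, hu⟩
    refine ⟨hu1.congr huv, ?_⟩
    filter_upwards [ae_ae_of_ae_cylMeasure huv, hu] with t h1 h2
    rwa [← eLpNorm_congr_ae h1]
  · rintro u v ⟨hu1, hu⟩ ⟨hv1, hv⟩ a b ha hb hab
    refine ⟨(hu1.const_smul a).add (hv1.const_smul b), ?_⟩
    filter_upwards [hu, hv, ae_aestronglyMeasurable_slice hu1, ae_aestronglyMeasurable_slice hv1]
      with t h1 h2 m1 m2
    calc _ ≤ eLpNorm (fun x => a • u (t, x)) 2 (volume.restrict Ω)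
          + eLpNorm (fun x => b • v (t, x)) 2 (volume.restrict Ω) :=
        eLpNorm_add_le (m1.const_smul a) (m2.const_smul b) (by norm_num)
      _ ≤ ENNReal.ofReal a * C + ENNReal.ofReal b * C := by
        have e1 := eLpNorm_const_smul a (fun x => u (t, x)) 2 (volume.restrict Ω)
        have e2 := eLpNorm_const_smul b (fun x => v (t, x)) 2 (volume.restrict Ω)
        simp only [Pi.smul_def] at e1 e2
        rw [e1, e2, Real.enorm_of_nonneg ha, Real.enorm_of_nonneg hb]
        gcongr
      _ = C := by
        rw [← add_mul, ← ENNReal.ofReal_add ha hb, hab, ENNReal.ofReal_one, one_mul]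
  · intro u v hu hv hP hlim
    obtain ⟨σ, hσ, hs⟩ := exists_subseq_slices_tendsto (fun k => (hu k).1) hv.1 hlim
    refine ⟨hv.1, ?_⟩
    filter_upwards [hs, ae_all_iff.2 fun k => (hP (σ k)).2, ae_aestronglyMeasurable_slice hv.1,
      ae_all_iff.2 fun k => ae_aestronglyMeasurable_slice (hu (σ k)).1] with t h1 h2 m1 m2
    have h3 := h1.add_const C
    rw [zero_add] at h3
    refine ge_of_tendsto' h3 fun k => ?_
    refine (eLpNorm_le_sub_add m1 (m2 k) (by norm_num)).trans (add_le_add (le_of_eq ?_) (h2 k))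
    exact eLpNorm_sub_comm _ _ _ _

theorem ae_nonneg_of_weaklyTendsto {α : Type*} [MeasurableSpace α] {μ : Measure α}
    {f : ℕ → α → ℝ} {g : α → ℝ} (hw : WeaklyTendsto μ f g) (hf : ∀ k, MemLp (f k) 2 μ)
    (hg : MemLp g 2 μ) (h : ∀ k, ∀ᵐ z ∂μ, 0 ≤ f k z) : ∀ᵐ z ∂μ, 0 ≤ g z := by
  refine hw.mem_of_convex (P := fun u => ∀ᵐ z ∂μ, 0 ≤ u z) hf hg ?_ ?_ ?_ h
  · intro u v huv hu
    filter_upwards [huv, hu] with z h1 h2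
    rwa [← h1]
  · intro u v hu hv a b ha hb _
    filter_upwards [hu, hv] with z h1 h2
    exact add_nonneg (mul_nonneg ha h1) (mul_nonneg hb h2)
  · intro u v hu hv hP hlim
    have hm : TendstoInMeasure μ u atTop v :=
      tendstoInMeasure_of_tendsto_eLpNorm (by norm_num) (fun k => (hu k).1) hv.1 hlim
    obtain ⟨σ, -, hσ⟩ := hm.exists_seq_tendsto_ae
    filter_upwards [hσ, ae_all_iff.2 hP] with z h1 h2
    exact ge_of_tendsto' h1 fun k => h2 _

theorem lintegral_enorm_mul_le_of_normLinfL2_le {f ψ : ℝ → R3 → ℝ} {C : ENNReal}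
    (hf : AEStronglyMeasurable (Function.uncurry f) (cylMeasure Ω T))
    (hψ : AEStronglyMeasurable (Function.uncurry ψ) (cylMeasure Ω T))
    (hC : normLinfL2 Ω T f ≤ C) (hC' : C ≠ ⊤) :
    ∫⁻ z, ‖f z.1 z.2 * ψ z.1 z.2‖ₑ ∂(cylMeasure Ω T)
      ≤ C * ∫⁻ t, eLpNorm (ψ t) 2 (volume.restrict Ω) ∂(timeMeasure T) := by
  rw [lintegral_cylMeasure Ω T (f := fun t x => ‖f t x * ψ t x‖ₑ) (hf.mul hψ).enorm,
    ← lintegral_const_mul' _ _ hC']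
  refine lintegral_mono_ae ?_
  filter_upwards [normLinfL2_le_iff.1 hC, ae_aestronglyMeasurable_slice hf,
    ae_aestronglyMeasurable_slice hψ] with t h1 m1 m2
  simp only [enorm_mul]
  exact (lintegral_enorm_mul_le m1 m2).trans (mul_le_mul' h1 le_rfl)

end Slices

/-- A test function in `L¹(0,T;L²)` need not be square integrable in space-time. It is cut off to
the times at which its slice norm is at most `M`: that part is square integrable, and the rest is
small in `L¹(0,T;L²)`, hence negligible uniformly in `k` by the bound `C`. -/
theorem tendstoWeakStar_of_weaklyTendsto {Ω : Set R3} {T : ℝ}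
    {f : ℕ → ℝ → R3 → ℝ} {g : ℝ → R3 → ℝ} {C : ENNReal} (hC : C ≠ ⊤)
    (hw : WeaklyTendsto (cylMeasure Ω T) (fun k => Function.uncurry (f k)) (Function.uncurry g))
    (hf : ∀ k, AEStronglyMeasurable (Function.uncurry (f k)) (cylMeasure Ω T))
    (hg : AEStronglyMeasurable (Function.uncurry g) (cylMeasure Ω T))
    (hfC : ∀ k, normLinfL2 Ω T (f k) ≤ C) (hgC : normLinfL2 Ω T g ≤ C) :
    TendstoWeakStar Ω T f g := by
  rintro ψ ⟨hψm, hψ⟩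
  have hN := aemeasurable_eLpNorm_slice hψm
  set N : ℝ → ENNReal := fun t => eLpNorm (ψ t) 2 (volume.restrict Ω) with hNdef
  have hN' : AEMeasurable N (timeMeasure T) := hN
  -- A measurable version of the slice norm, so that the truncation sets are measurable.
  set N' : ℝ → ENNReal := hN'.mk N
  have mN' : Measurable N' := hN'.measurable_mk
  have eN : N =ᵐ[timeMeasure T] N' := hN'.ae_eq_mk
  set A : ℕ → Set ℝ := fun M => {t | N' t ≤ M} with hA
  have mA : ∀ M, MeasurableSet (A M) := fun M => measurableSet_le mN' measurable_const
  set ψ₁ : ℕ → ℝ → R3 → ℝ := fun M t x => (A M).indicator (fun t => ψ t x) t with hψ₁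
  set ψ₂ : ℕ → ℝ → R3 → ℝ := fun M t x => (A M)ᶜ.indicator (fun t => ψ t x) t with hψ₂
  have m₁ : ∀ M, AEStronglyMeasurable (Function.uncurry (ψ₁ M)) (cylMeasure Ω T) := fun M => by
    have := hψm.indicator ((mA M).prod MeasurableSet.univ)
    refine this.congr (Eventually.of_forall fun z => ?_)
    by_cases hz : z.1 ∈ A M <;> simp [hψ₁, Function.uncurry, hz, indicator, mem_prod]
  have m₂ : ∀ M, AEStronglyMeasurable (Function.uncurry (ψ₂ M)) (cylMeasure Ω T) := fun M => by
    have := hψm.indicator ((mA M).compl.prod MeasurableSet.univ)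
    refine this.congr (Eventually.of_forall fun z => ?_)
    by_cases hz : z.1 ∈ A M <;> simp [hψ₂, Function.uncurry, hz, indicator, mem_prod]
  have hadd : ∀ M t x, ψ t x = ψ₁ M t x + ψ₂ M t x := fun M t x => by
    by_cases hz : t ∈ A M <;> simp [hψ₁, hψ₂, hz]
  have e₂ : ∀ M t, eLpNorm (ψ₂ M t) 2 (volume.restrict Ω) = (A M)ᶜ.indicator N t := fun M t => by
    by_cases hz : t ∈ A M
    · have : ψ₂ M t = fun _ => 0 := by funext x; simp [hψ₂, hz]
      simp [this, hz]
    · have : ψ₂ M t = ψ t := by funext x; simp [hψ₂, hz]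
      simp [this, hz, hNdef]
  have hr : Tendsto (fun M => C * ∫⁻ t, eLpNorm (ψ₂ M t) 2 (volume.restrict Ω) ∂(timeMeasure T))
      atTop (𝓝 0) := by
    have h0 : Tendsto (fun M => ∫⁻ t, (A M)ᶜ.indicator N t ∂(timeMeasure T)) atTop
        (𝓝 (∫⁻ _, 0 ∂(timeMeasure T))) := by
      refine tendsto_lintegral_of_dominated_convergence' N
        (fun M => hN'.indicator (mA M).compl)
        (fun M => Eventually.of_forall fun t => indicator_le_self _ _ _) hψ.ne ?_
      filter_upwards [ae_lt_top' hN' hψ.ne, eN] with t ht he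
      refine tendsto_const_nhds.congr' ?_
      obtain ⟨M, hM⟩ := ENNReal.exists_nat_gt ht.ne
      filter_upwards [eventually_ge_atTop M] with M' hM'
      rw [indicator_of_notMem]
      simp only [hA, mem_compl_iff, mem_ofPred_eq, not_not, ← he]
      exact hM.le.trans (by exact_mod_cast hM')
    simp only [e₂]
    have := ENNReal.Tendsto.const_mul h0 (Or.inr hC)
    simpa using this
  have hL2 : ∀ M, MemLp (Function.uncurry (ψ₁ M)) 2 (cylMeasure Ω T) := fun M => by
    refine ⟨m₁ M, ?_⟩
    -- On the truncation set `N² ≤ M N`, and `N` is integrable in time.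
    have h1 : eLpNorm (Function.uncurry (ψ₁ M)) 2 (cylMeasure Ω T) ^ 2
        ≤ M * ∫⁻ t, N t ∂(timeMeasure T) := by
      rw [eLpNorm_cylMeasure_sq (m₁ M), ← lintegral_const_mul' _ _ (by simp)]
      refine lintegral_mono_ae (eN.mono fun t ht => ?_)
      by_cases hz : t ∈ A M
      · have : (fun x => Function.uncurry (ψ₁ M) (t, x)) = ψ t := by
          funext x; simp [hψ₁, hz]
        rw [this, sq]
        refine mul_le_mul' ?_ le_rfl
        have : N' t ≤ M := hz
        rwa [← ht] at this
      · have : (fun x => Function.uncurry (ψ₁ M) (t, x)) = fun _ => 0 := by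
          funext x; simp [hψ₁, hz]
        rw [this]
        simp
    have h2 : (M : ENNReal) * ∫⁻ t, N t ∂(timeMeasure T) < ⊤ := ENNReal.mul_lt_top (by simp) hψ
    by_contra hc
    rw [not_lt, top_le_iff] at hc
    rw [hc] at h1
    exact absurd (h1.trans_lt h2) (by simp)
  have key : ∀ {h : ℝ → R3 → ℝ}, AEStronglyMeasurable (Function.uncurry h) (cylMeasure Ω T) →
      normLinfL2 Ω T h ≤ C → ∀ M (η : ℝ), 0 < η →
      C * ∫⁻ t, eLpNorm (ψ₂ M t) 2 (volume.restrict Ω) ∂(timeMeasure T) ≤ ENNReal.ofReal η →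
      |(∫ z, h z.1 z.2 * ψ z.1 z.2 ∂(cylMeasure Ω T))
        - ∫ z, h z.1 z.2 * ψ₁ M z.1 z.2 ∂(cylMeasure Ω T)| ≤ η := by
    intro h hm hh M η hη hle
    have b2 := lintegral_enorm_mul_le_of_normLinfL2_le hm (m₂ M) hh hC
    have i1 : Integrable (fun z : ℝ × R3 => h z.1 z.2 * ψ₁ M z.1 z.2) (cylMeasure Ω T) :=
      memLp_one_iff_integrable.1 ((hL2 M).mul (memLp_of_normLinfL2_le hm hC hh))
    have i2 : Integrable (fun z : ℝ × R3 => h z.1 z.2 * ψ₂ M z.1 z.2) (cylMeasure Ω T) :=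
      ⟨hm.mul (m₂ M), (b2.trans hle).trans_lt ENNReal.ofReal_lt_top⟩
    have e : ∫ z, h z.1 z.2 * ψ z.1 z.2 ∂(cylMeasure Ω T)
        = (∫ z, h z.1 z.2 * ψ₁ M z.1 z.2 ∂(cylMeasure Ω T))
          + ∫ z, h z.1 z.2 * ψ₂ M z.1 z.2 ∂(cylMeasure Ω T) := by
      rw [← integral_add i1 i2]
      refine integral_congr_ae (Eventually.of_forall fun z => ?_)
      simp only [hadd M z.1 z.2]
      ring
    rw [e, add_sub_cancel_left]
    have := (enorm_integral_le_lintegral_enorm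
      (fun z : ℝ × R3 => h z.1 z.2 * ψ₂ M z.1 z.2)).trans (b2.trans hle)
    rw [Real.enorm_eq_ofReal_abs] at this
    exact (ENNReal.ofReal_le_ofReal_iff hη.le).1 this
  refine tendsto_of_uniform_approx fun η hη => ?_
  obtain ⟨M, hM⟩ := (hr.eventually_le_const (u := ENNReal.ofReal η) (by simpa using hη)).exists
  refine ⟨fun k => ∫ z, f k z.1 z.2 * ψ₁ M z.1 z.2 ∂(cylMeasure Ω T),
    ∫ z, g z.1 z.2 * ψ₁ M z.1 z.2 ∂(cylMeasure Ω T), fun k => key (hf k) (hfC k) M η hη hM,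
    key hg hgC M η hη hM, ?_⟩
  exact hw.tendsto_mul (hL2 M)

/-! ### Weak limits in `L²(0,T;H¹₀)` -/

section

variable {Ω : Set R3} {v w : R3 → R3} {Dv Dw : R3 → R3 →L[ℝ] R3}

theorem IsH10.congr_ae (h : IsH10 Ω v Dv) (hv : v =ᵐ[volume.restrict Ω] w)
    (hDv : Dv =ᵐ[volume.restrict Ω] Dw) : IsH10 Ω w Dw := by
  obtain ⟨m1, m2, φ, hφ, t1, t2⟩ := h
  refine ⟨m1.ae_eq hv, m2.ae_eq hDv, φ, hφ, t1.congr fun j => ?_, t2.congr fun j => ?_⟩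
  · exact eLpNorm_congr_ae (hv.mono fun x hx => by simp only [hx])
  · exact eLpNorm_congr_ae (hDv.mono fun x hx => by simp only [hx])

theorem IsH10.const_smul (h : IsH10 Ω v Dv) (a : ℝ) :
    IsH10 Ω (fun x => a • v x) (fun x => a • Dv x) := by
  obtain ⟨m1, m2, φ, hφ, t1, t2⟩ := h
  refine ⟨m1.const_smul a, m2.const_smul a, fun j x => a • φ j x, fun j =>
    ⟨(hφ j).1.const_smul a, (hφ j).2.1.smul_left (f := fun _ => a), (tsupport_smul_subset_right (fun _ => a) (φ j)).trans (hφ j).2.2⟩,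
    ?_, ?_⟩
  · have := ENNReal.Tendsto.const_mul t1 (Or.inr (enorm_ne_top (x := a)))
    rw [mul_zero] at this
    refine this.congr fun j => ?_
    rw [← eLpNorm_const_smul]
    refine eLpNorm_congr_ae (Eventually.of_forall fun x => ?_)
    simp only [Pi.smul_apply, smul_sub]
  · have := ENNReal.Tendsto.const_mul t2 (Or.inr (enorm_ne_top (x := a)))
    rw [mul_zero] at this
    refine this.congr fun j => ?_
    rw [← eLpNorm_const_smul]
    refine eLpNorm_congr_ae (Eventually.of_forall fun x => ?_)
    have : fderiv ℝ (fun x => a • φ j x) x = a • fderiv ℝ (φ j) x :=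
      fderiv_const_smul (((hφ j).1.differentiable (by simp)) x) a
    simp only [Pi.smul_apply, smul_sub, this]

/-- Diagonal choice: from the `k`-th approximating sequence a term within `1/(k+1)`, for the field
and its derivative at once. -/
theorem IsH10.of_tendsto {v' : ℕ → R3 → R3} {Dv' : ℕ → R3 → R3 →L[ℝ] R3}
    (h : ∀ k, IsH10 Ω (v' k) (Dv' k)) (hv : AEStronglyMeasurable v (volume.restrict Ω))
    (hDv : AEStronglyMeasurable Dv (volume.restrict Ω))
    (h1 : Tendsto (fun k => eLpNorm (fun x => v' k x - v x) 2 (volume.restrict Ω)) atTop (𝓝 0))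
    (h2 : Tendsto (fun k => eLpNorm (fun x => Dv' k x - Dv x) 2 (volume.restrict Ω)) atTop (𝓝 0)) :
    IsH10 Ω v Dv := by
  have mem : ∀ {E : Type} [NormedAddCommGroup E] {f' : ℕ → R3 → E} {f : R3 → E},
      (∀ k, MemLp (f' k) 2 (volume.restrict Ω)) → AEStronglyMeasurable f (volume.restrict Ω) →
      Tendsto (fun k => eLpNorm (fun x => f' k x - f x) 2 (volume.restrict Ω)) atTop (𝓝 0) →
      MemLp f 2 (volume.restrict Ω) := by
    intro E _ f' f hf' hf ht
    obtain ⟨k, hk⟩ := (ht.eventually_le_const (u := 1) (by simp)).exists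
    have m : MemLp (fun x => f' k x - f x) 2 (volume.restrict Ω) :=
      ⟨(hf' k).1.sub hf, hk.trans_lt (by simp)⟩
    have := (hf' k).sub m
    refine this.ae_eq (Eventually.of_forall fun x => ?_)
    simp
  choose m1 m2 φ hφ t1 t2 using h
  have pos : ∀ k : ℕ, (0 : ENNReal) < ((k : ENNReal) + 1)⁻¹ := fun k => by simp
  have hex : ∀ k, ∃ j, eLpNorm (fun x => φ k j x - v' k x) 2 (volume.restrict Ω)
      ≤ ((k : ENNReal) + 1)⁻¹ ∧ eLpNorm (fun x => fderiv ℝ (φ k j) x - Dv' k x) 2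
        (volume.restrict Ω) ≤ ((k : ENNReal) + 1)⁻¹ := fun k =>
    (((t1 k).eventually_le_const (pos k)).and ((t2 k).eventually_le_const (pos k))).exists
  choose j hj1 hj2 using hex
  have lim0 : Tendsto (fun k : ℕ => ((k : ENNReal) + 1)⁻¹) atTop (𝓝 0) := by
    have := (ENNReal.tendsto_inv_nat_nhds_zero).comp (tendsto_add_atTop_nat 1)
    refine this.congr fun k => ?_
    simp
  refine ⟨mem m1 hv h1, mem m2 hDv h2, fun k => φ k (j k), fun k => hφ k (j k), ?_, ?_⟩
  · have := lim0.add h1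
    rw [add_zero] at this
    refine tendsto_of_tendsto_of_tendsto_of_le_of_le tendsto_const_nhds this
      (fun _ => zero_le) fun k => ?_
    refine le_trans (le_of_eq_of_le ?_ (eLpNorm_add_le (((hφ k (j k)).1.continuous.aestronglyMeasurable).sub
      (m1 k).1) ((m1 k).1.sub hv) (by norm_num))) (add_le_add (hj1 k) le_rfl)
    refine eLpNorm_congr_ae (Eventually.of_forall fun x => ?_)
    simp only [Pi.add_apply, Pi.sub_apply]
    abel
  · have := lim0.add h2
    rw [add_zero] at this
    refine tendsto_of_tendsto_of_tendsto_of_le_of_le tendsto_const_nhds this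
      (fun _ => zero_le) fun k => ?_
    refine le_trans (le_of_eq_of_le ?_ (eLpNorm_add_le
      ((((hφ k (j k)).1.continuous_fderiv (by simp)).aestronglyMeasurable).sub
      (m2 k).1) ((m2 k).1.sub hDv) (by norm_num))) (add_le_add (hj2 k) le_rfl)
    refine eLpNorm_congr_ae (Eventually.of_forall fun x => ?_)
    simp only [Pi.add_apply, Pi.sub_apply]
    abel

end

/-- The field and its derivative are treated as one function with values in a product. Belonging to
`H¹₀` on almost every slice, with the given derivative, is then a single convex condition closed in
`L²`, and the weak limit of the pair satisfies it. -/
theorem exists_weakly_convergent_subseq_of_memL2H10 {Ω : Set R3} {T : ℝ}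
    {u : ℕ → ℝ → R3 → R3} {Du : ℕ → ℝ → R3 → R3 →L[ℝ] R3} {C : ENNReal} (hC : C ≠ ⊤)
    (hu : ∀ K, MemL2H10 Ω T (u K) (Du K))
    (hub : ∀ K, eLpNorm (Function.uncurry (u K)) 2 (cylMeasure Ω T) ≤ C)
    (hDub : ∀ K, eLpNorm (Function.uncurry (Du K)) 2 (cylMeasure Ω T) ≤ C) :
    ∃ (σ : ℕ → ℕ) (v : ℝ → R3 → R3) (Dv : ℝ → R3 → R3 →L[ℝ] R3), StrictMono σ ∧
      MemL2H10 Ω T v Dv ∧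
      WeaklyTendsto (cylMeasure Ω T) (fun K => Function.uncurry (u (σ K))) (Function.uncurry v) ∧
      WeaklyTendsto (cylMeasure Ω T) (fun K => Function.uncurry (Du (σ K)))
        (Function.uncurry Dv) := by
  set f : ℕ → ℝ × R3 → R3 × (R3 →L[ℝ] R3) := fun K z => (u K z.1 z.2, Du K z.1 z.2) with hf
  have hb : ∀ K, eLpNorm (f K) 2 (cylMeasure Ω T) ≤ C + C := fun K => by
    have h1 : eLpNorm (f K) 2 (cylMeasure Ω T) ≤ eLpNorm (fun z => ‖u K z.1 z.2‖ + ‖Du K z.1 z.2‖) 2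
        (cylMeasure Ω T) := by
      refine eLpNorm_mono fun z => ?_
      rw [Real.norm_of_nonneg (by positivity), Prod.norm_def]
      exact max_le (le_add_of_nonneg_right (norm_nonneg _)) (le_add_of_nonneg_left (norm_nonneg _))
    refine h1.trans ((eLpNorm_add_le (hu K).1.1.norm (hu K).2.1.1.norm (by norm_num)).trans ?_)
    have e1 := eLpNorm_norm (p := 2) (μ := cylMeasure Ω T) (Function.uncurry (u K))
    have e2 := eLpNorm_norm (p := 2) (μ := cylMeasure Ω T) (Function.uncurry (Du K))
    exact add_le_add (e1.le.trans (hub K)) (e2.le.trans (hDub K))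
  have hm : ∀ K, MemLp (f K) 2 (cylMeasure Ω T) := fun K =>
    ⟨(hu K).1.1.prodMk (hu K).2.1.1, (hb K).trans_lt (ENNReal.add_lt_top.2 ⟨hC.lt_top, hC.lt_top⟩)⟩
  obtain ⟨σ, g, hσ, hg, hw⟩ := exists_weaklyTendsto hm (ENNReal.add_ne_top.2 ⟨hC, hC⟩) hb
  have hP := hw.mem_of_convex (fun K => hm (σ K)) hg
    (P := fun F => ∀ᵐ t ∂(timeMeasure T), IsH10 Ω (fun x => (F (t, x)).1) fun x => (F (t, x)).2)
    (by
      intro F G hFG hF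
      filter_upwards [ae_ae_of_ae_cylMeasure hFG, hF] with t h1 h2
      exact h2.congr_ae (h1.mono fun x hx => by simp only [hx])
        (h1.mono fun x hx => by simp only [hx]))
    (by
      intro F G hF hG a b _ _ _
      filter_upwards [hF, hG] with t h1 h2
      have := (h1.const_smul a).sub (h2.const_smul (-b))
      refine this.congr_ae (Eventually.of_forall fun x => ?_) (Eventually.of_forall fun x => ?_)
      · simp
      · change a • (F (t, x)).2 - (-b) • (G (t, x)).2 = a • (F (t, x)).2 + b • (G (t, x)).2
        module)
    (by
      intro F G hF hG hFP hlim
      obtain ⟨τ, -, hτ⟩ := exists_subseq_slices_tendsto (fun k => (hF k).1) hG.1 hlim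
      filter_upwards [hτ, ae_all_iff.2 fun k => hFP (τ k), ae_aestronglyMeasurable_slice hG.1]
        with t h1 h2 h3
      refine IsH10.of_tendsto h2 (continuous_fst.comp_aestronglyMeasurable h3)
        (continuous_snd.comp_aestronglyMeasurable h3) ?_ ?_
      · refine tendsto_of_tendsto_of_tendsto_of_le_of_le tendsto_const_nhds h1
          (fun _ => zero_le) fun k => eLpNorm_mono fun x => norm_fst_le (F (τ k) (t, x) - G (t, x))
      · refine tendsto_of_tendsto_of_tendsto_of_le_of_le tendsto_const_nhds h1
          (fun _ => zero_le) fun k => eLpNorm_mono fun x => norm_snd_le (F (τ k) (t, x) - G (t, x)))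
    (fun K => (hu (σ K)).2.2)
  exact ⟨σ, fun t x => (g (t, x)).1, fun t x => (g (t, x)).2, hσ,
    ⟨(ContinuousLinearMap.fst ℝ R3 (R3 →L[ℝ] R3)).comp_memLp' hg,
      (ContinuousLinearMap.snd ℝ R3 (R3 →L[ℝ] R3)).comp_memLp' hg, hP⟩,
    hw.clm (ContinuousLinearMap.fst ℝ R3 (R3 →L[ℝ] R3)),
    hw.clm (ContinuousLinearMap.snd ℝ R3 (R3 →L[ℝ] R3))⟩

theorem tendstoWeakL2H10_of_weaklyTendsto {Ω : Set R3} {T : ℝ}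
    {u : ℕ → ℝ → R3 → R3} {Du : ℕ → ℝ → R3 → R3 →L[ℝ] R3} {v : ℝ → R3 → R3}
    {Dv : ℝ → R3 → R3 →L[ℝ] R3}
    (h : WeaklyTendsto (cylMeasure Ω T) (fun K => Function.uncurry (u K)) (Function.uncurry v))
    (hD : WeaklyTendsto (cylMeasure Ω T) (fun K => Function.uncurry (Du K))
      (Function.uncurry Dv)) : TendstoWeakL2H10 Ω T u Du v Dv :=
  ⟨fun _ hψ => h.tendsto_inner hψ, fun e _ hψ =>
    (hD.clm (ContinuousLinearMap.apply ℝ R3 e)).tendsto_inner hψ⟩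

/-! ### Compactness in time -/

/-- Averages over `(t, t+δ)` converge by hypothesis. They are within `M √δ` of the values at `t`,
uniformly in `K`, and by Lebesgue differentiation those of `q` tend to `q t`. -/
theorem ae_tendsto_of_equicontinuous {T : ℝ} (hT : 0 < T) {p P : ℕ → ℝ → ℝ} {q : ℝ → ℝ} {M : ℝ}
    (hp : ∀ K, Integrable (p K) (timeMeasure T)) (hq : Integrable q (timeMeasure T))
    (hP : ∀ K, p K =ᵐ[timeMeasure T] P K)
    (hPc : ∀ K s t, 0 ≤ s → s ≤ t → t ≤ T → |P K t - P K s| ≤ M * √(t - s))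
    (hM : 0 ≤ M)
    (hlim : ∀ s t, 0 ≤ s → s ≤ t → t ≤ T →
      Tendsto (fun K => ∫ x in s..t, p K x) atTop (𝓝 (∫ x in s..t, q x))) :
    ∀ᵐ t ∂(timeMeasure T), Tendsto (fun K => p K t) atTop (𝓝 (q t)) := by
  have hq' : IntervalIntegrable q volume 0 T := (intervalIntegrable_iff_timeMeasure hT.le).2 hq
  have sub : ∀ {s t}, 0 ≤ s → s ≤ t → t ≤ T → Ioc s t ⊆ Ioc 0 T := fun h1 _ h3 =>
    Ioc_subset_Ioc h1 h3
  have ii : ∀ {h : ℝ → ℝ}, Integrable h (timeMeasure T) → ∀ {s t}, 0 ≤ s → s ≤ t → t ≤ T →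
      IntervalIntegrable h volume s t := fun hh s t h1 h2 h3 => by
    have := (intervalIntegrable_iff_timeMeasure hT.le).2 hh
    exact this.mono_set (by rw [uIcc_of_le h2, uIcc_of_le hT.le]; exact Icc_subset_Icc h1 h3)
  filter_upwards [ae_restrict_of_ae hq'.ae_hasDerivAt_integral, ae_all_iff.2 hP,
    ae_restrict_mem measurableSet_Ioo] with t hd hPt ht
  have hd' := (hd (by rw [uIcc_of_le hT.le]; exact ⟨ht.1.le, ht.2.le⟩) 0
    (by rw [uIcc_of_le hT.le]; exact ⟨le_rfl, hT.le⟩)).tendsto_slope_zero_right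
  refine tendsto_of_uniform_approx fun η hη => ?_
  have ev1 : ∀ᶠ δ in 𝓝[>] (0 : ℝ), M * √δ ≤ η := by
    have : Tendsto (fun δ : ℝ => M * √δ) (𝓝[>] 0) (𝓝 (M * √0)) :=
      (Continuous.tendsto (by fun_prop) 0).mono_left nhdsWithin_le_nhds
    rw [Real.sqrt_zero, mul_zero] at this
    exact this.eventually_le_const hη
  have ev2 : ∀ᶠ δ in 𝓝[>] (0 : ℝ), δ ≤ T - t := by
    have : Tendsto (fun δ : ℝ => δ) (𝓝[>] 0) (𝓝 0) := nhdsWithin_le_nhds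
    exact this.eventually_le_const (by linarith [ht.2])
  -- The length `δ` is small for the differentiation of `q` and for the modulus `M √δ`, and keeps
  -- the interval inside `(0,T)` up to its endpoint.
  obtain ⟨δ, ⟨⟨⟨h1, h2⟩, h3⟩, hδ⟩⟩ := (((hd'.eventually (Metric.closedBall_mem_nhds _ hη)).and
    ev1).and ev2 |>.and self_mem_nhdsWithin).exists
  have hδ0 : 0 < δ := hδ
  have hsplit : (∫ x in (0 : ℝ)..(t + δ), q x) - ∫ x in (0 : ℝ)..t, q x = ∫ x in t..(t + δ), q x :=
    intervalIntegral.integral_interval_sub_left (ii hq le_rfl (by linarith [ht.1]) (by linarith))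
      (ii hq le_rfl ht.1.le ht.2.le)
  rw [hsplit, Real.dist_eq, smul_eq_mul] at h1
  refine ⟨fun K => δ⁻¹ * ∫ x in t..(t + δ), p K x, δ⁻¹ * ∫ x in t..(t + δ), q x, fun K => ?_,
    by rwa [abs_sub_comm], (hlim t (t + δ) ht.1.le (by linarith) (by linarith)).const_mul _⟩
  have hae : ∀ᵐ x, x ∈ Ioc t (t + δ) → p K x = P K x := by
    have := hP K
    rw [timeMeasure, restrict_Ioo_eq_Ioc] at this
    filter_upwards [(ae_restrict_iff' measurableSet_Ioc).1 this] with x hx hm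
    exact hx (sub ht.1.le (by linarith) (by linarith) hm)
  have hb : ‖∫ x in t..(t + δ), (p K x - P K t)‖ ≤ M * √δ * |t + δ - t| := by
    refine intervalIntegral.norm_integral_le_of_norm_le_const_ae ?_
    filter_upwards [hae] with x hx hm
    rw [uIoc_of_le (by linarith)] at hm
    rw [hx hm, Real.norm_eq_abs]
    refine (hPc K t x ht.1.le hm.1.le (by linarith [hm.2])).trans ?_
    gcongr
    linarith [hm.2]
  rw [intervalIntegral.integral_sub (ii (hp K) ht.1.le (by linarith) (by linarith))
    (by simp), intervalIntegral.integral_const, Real.norm_eq_abs, add_sub_cancel_left,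
    abs_of_pos hδ0, smul_eq_mul] at hb
  rw [hPt K, abs_sub_comm]
  have e : δ⁻¹ * (∫ x in t..(t + δ), p K x) - P K t
      = δ⁻¹ * ((∫ x in t..(t + δ), p K x) - δ * P K t) := by field_simp
  rw [e, abs_mul, abs_of_pos (inv_pos.2 hδ0)]
  calc _ ≤ δ⁻¹ * (M * √δ * δ) := by gcongr
    _ = M * √δ := by field_simp
    _ ≤ η := h2

theorem intervalIntegral_eq_integral_timeMeasure {T : ℝ} {s t : ℝ} (hs : 0 ≤ s)
    (hst : s ≤ t) (ht : t ≤ T) (p : ℝ → ℝ) :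
    ∫ x in s..t, p x = ∫ x, (Ioc s t).indicator 1 x * p x ∂(timeMeasure T) := by
  have e : ∀ x, (Ioc s t).indicator 1 x * p x = (Ioc s t).indicator p x := fun x => by
    by_cases hx : x ∈ Ioc s t <;> simp [hx]
  simp only [e]
  rw [integral_indicator measurableSet_Ioc, timeMeasure, restrict_Ioo_eq_Ioc,
    Measure.restrict_restrict measurableSet_Ioc, inter_eq_left.2 (Ioc_subset_Ioc hs ht),
    intervalIntegral.integral_of_le hst]

/-- Flux solutions with equi-integrable fluxes converging weakly converge, tested with smooth
functions of space, at almost every time. -/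
theorem IsFluxSolution.ae_tendsto {Ω : Set R3} {T : ℝ} (hT : 0 < T)
    (hΩb : Bornology.IsBounded Ω) {f₀ : R3 → ℝ} {f : ℕ → ℝ → R3 → ℝ} {J : ℕ → ℝ → R3 → R3}
    {g : ℝ → R3 → ℝ} {M : ℝ} (hM : 0 ≤ M) (h : ∀ K, IsFluxSolution Ω T f₀ (f K) (J K))
    (hf : ∀ K, MemLp (Function.uncurry (f K)) 2 (cylMeasure Ω T))
    (hg : MemLp (Function.uncurry g) 2 (cylMeasure Ω T))
    (hweak : WeaklyTendsto (cylMeasure Ω T) (fun K => Function.uncurry (f K)) (Function.uncurry g))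
    (hJ : ∀ K, Integrable (Function.uncurry (J K)) (cylMeasure Ω T))
    (hJM : ∀ K s t, 0 ≤ s → s ≤ t → t ≤ T →
      ∫⁻ r in Ioc s t, (∫⁻ x in Ω, ‖J K r x‖ₑ) ≤ ENNReal.ofReal (M * √(t - s)))
    {w : R3 → ℝ} (hw : ContDiff ℝ ∞ w) (hwc : HasCompactSupport w) :
    ∀ᵐ t ∂(timeMeasure T), Tendsto (fun K => ∫ x in Ω, w x * f K t x) atTop
      (𝓝 (∫ x in Ω, w x * g t x)) := by
  have := isFiniteMeasure_cylMeasure hΩb T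
  obtain ⟨Cw, hCw⟩ := hw.continuous.bounded_above_of_compact_support hwc
  have hw' : Continuous (fderiv ℝ w) := hw.continuous_fderiv (by simp)
  obtain ⟨Dw, hDw⟩ := hw'.bounded_above_of_compact_support (hwc.fderiv ℝ)
  have hDw0 : 0 ≤ Dw := (norm_nonneg _).trans (hDw 0)
  have mw : AEStronglyMeasurable (fun z : ℝ × R3 => w z.2) (cylMeasure Ω T) :=
    (hw.continuous.comp continuous_snd).aestronglyMeasurable
  have iw : ∀ {v : ℝ → R3 → ℝ}, MemLp (Function.uncurry v) 2 (cylMeasure Ω T) →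
      Integrable (fun z : ℝ × R3 => w z.2 * v z.1 z.2) (cylMeasure Ω T) := fun hv =>
    (hv.integrable (by norm_num)).bdd_mul mw (Eventually.of_forall fun z => hCw z.2)
  have iw' : ∀ {v : ℝ → R3 → ℝ}, MemLp (Function.uncurry v) 2 (cylMeasure Ω T) →
      Integrable (fun t => ∫ x in Ω, w x * v t x) (timeMeasure T) := fun hv => by
    have := iw hv
    rw [cylMeasure_eq_prod] at this
    exact this.integral_prod_left
  have hae := fun K => (h K).ae_eq hT ((hf K).integrable (by norm_num)) (hJ K) hw hwc
  have hflux := fun K => integrable_flux (hJ K) hw hwc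
  refine ae_tendsto_of_equicontinuous (M := Dw * M) hT (fun K => iw' (hf K)) (iw' hg) hae ?_
    (by positivity) ?_
  · intro K s t hs hst ht
    -- The increment of the continuous version is the integral of the tested flux over `(s,t)`,
    -- controlled by `hJM`.
    have ii := (intervalIntegrable_iff_timeMeasure hT.le).2 (hflux K)
    have i1 : ∀ {r}, 0 ≤ r → r ≤ T → IntervalIntegrable
        (fun s => ∫ x in Ω, fderiv ℝ w x (J K s x)) volume 0 r := fun h1 h2 =>
      ii.mono_set (by rw [uIcc_of_le h1, uIcc_of_le hT.le]; exact Icc_subset_Icc le_rfl h2)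
    rw [add_sub_add_left_eq_sub, intervalIntegral.integral_interval_sub_left
      (i1 (hs.trans hst) ht) (i1 hs (hst.trans ht)), intervalIntegral.integral_of_le hst]
    have hb : ‖∫ r in Ioc s t, ∫ x in Ω, fderiv ℝ w x (J K r x)‖ₑ
        ≤ ENNReal.ofReal (Dw * M * √(t - s)) := by
      calc _ ≤ ∫⁻ r in Ioc s t, ‖∫ x in Ω, fderiv ℝ w x (J K r x)‖ₑ :=
            enorm_integral_le_lintegral_enorm _
        _ ≤ ∫⁻ r in Ioc s t, ENNReal.ofReal Dw * (∫⁻ x in Ω, ‖J K r x‖ₑ) := by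
            refine lintegral_mono fun r => ?_
            rw [← lintegral_const_mul' _ _ ENNReal.ofReal_ne_top]
            refine (enorm_integral_le_lintegral_enorm _).trans (lintegral_mono fun x => ?_)
            refine ((fderiv ℝ w x).le_opENorm _).trans (mul_le_mul' ?_ le_rfl)
            rw [← ofReal_norm]
            exact ENNReal.ofReal_le_ofReal (hDw x)
        _ ≤ ENNReal.ofReal Dw * ENNReal.ofReal (M * √(t - s)) := by
            rw [lintegral_const_mul' _ _ ENNReal.ofReal_ne_top]
            exact mul_le_mul' le_rfl (hJM K s t hs hst ht)
        _ = _ := by rw [← ENNReal.ofReal_mul hDw0, mul_assoc]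
    rw [Real.enorm_eq_ofReal_abs] at hb
    exact (ENNReal.ofReal_le_ofReal_iff (by positivity)).1 hb
  · intro s t hs hst ht
    -- The time integral of a tested slice is the pairing with an indicator in time times `w` in
    -- space, an admissible test function for weak convergence.
    have hψ : MemLp (fun z : ℝ × R3 => (Ioc s t).indicator (1 : ℝ → ℝ) z.1 * w z.2) 2
        (cylMeasure Ω T) := by
      refine MemLp.of_bound (C := Cw) ?_ (Eventually.of_forall fun z => ?_)
      · exact (((measurable_one.indicator measurableSet_Ioc).comp
          measurable_fst).aestronglyMeasurable).mul mw
      · by_cases hz : z.1 ∈ Ioc s t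
        · simpa [hz] using hCw z.2
        · simpa [hz] using (norm_nonneg _).trans (hCw z.2)
    have e : ∀ {v : ℝ → R3 → ℝ}, MemLp (Function.uncurry v) 2 (cylMeasure Ω T) →
        ∫ r in s..t, ∫ x in Ω, w x * v r x = ∫ z, Function.uncurry v z *
          ((Ioc s t).indicator (1 : ℝ → ℝ) z.1 * w z.2) ∂(cylMeasure Ω T) := by
      intro v hv
      have i3 : Integrable (fun z => Function.uncurry v z *
          ((Ioc s t).indicator (1 : ℝ → ℝ) z.1 * w z.2)) (cylMeasure Ω T) :=
        memLp_one_iff_integrable.1 (hψ.mul hv)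
      rw [intervalIntegral_eq_integral_timeMeasure hs hst ht]
      rw [cylMeasure_eq_prod] at i3 ⊢
      rw [integral_prod _ i3]
      refine integral_congr_ae (Eventually.of_forall fun r => ?_)
      simp only [Function.uncurry]
      rw [← integral_const_mul]
      refine integral_congr_ae (Eventually.of_forall fun x => ?_)
      simp only
      ring
    rw [e hg]
    simp only [e (hf _)]
    exact hweak.tendsto_mul hψ

/-! ### Products of weakly convergent sequences -/

theorem isProbabilityMeasure_withDensity_bumpKernel :
    IsProbabilityMeasure ((volume : Measure R3).withDensity fun z => ‖bumpKernel z‖ₑ) :=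
  ⟨by rw [withDensity_apply _ MeasurableSet.univ, Measure.restrict_univ,
    lintegral_enorm_bumpKernel]⟩

/-- Jensen for the probability density `bumpKernel`. Only `‖z‖ < 1` contributes, so the translates
involved have length at most `ε`. -/
theorem eLpNorm_moll_sub_le {f : R3 → ℝ} (hf : Measurable f) (hfi : Integrable f) {A : ENNReal}
    (h : ∀ z, eLpNorm (fun x => f (x - z) - f x) 2 volume ≤ ‖z‖ₑ * A) {ε : ℝ} (hε : 0 < ε) :
    eLpNorm (fun x => moll ε f x - f x) 2 volume ≤ ENNReal.ofReal ε * A := by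
  have hη := bumpKernel_continuous.enorm.measurable
  have := isProbabilityMeasure_withDensity_bumpKernel
  have hd : Measurable (Function.uncurry fun x z : R3 => f (x - ε • z) - f x) :=
    (measurable_comp_sub_smul hf ε).sub (hf.comp measurable_fst)
  have hm : Measurable (Function.uncurry fun (x z : R3) =>
      ‖bumpKernel z‖ₑ * ‖f (x - ε • z) - f x‖ₑ ^ 2) :=
    (hη.comp measurable_snd).mul (hd.enorm.pow_const 2)
  have hsq : ∀ x, ‖moll ε f x - f x‖ₑ ^ 2
      ≤ ∫⁻ z, ‖bumpKernel z‖ₑ * ‖f (x - ε • z) - f x‖ₑ ^ 2 := by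
    intro x
    have m1 : Measurable fun z => ‖f (x - ε • z) - f x‖ₑ := hd.of_uncurry_left.enorm
    have h1 := sq_lintegral_le (μ := (volume : Measure R3).withDensity fun z => ‖bumpKernel z‖ₑ)
      m1.aemeasurable
    rw [lintegral_withDensity_eq_lintegral_mul _ hη m1,
      lintegral_withDensity_eq_lintegral_mul _ hη (m1.pow_const 2)] at h1
    refine le_trans (pow_le_pow_left' ?_ 2) h1
    rw [moll_sub_eq hfi hε]
    refine (enorm_integral_le_lintegral_enorm _).trans (le_of_eq ?_)
    simp only [enorm_mul, Pi.mul_apply]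
  refine (ENNReal.pow_right_strictMono two_ne_zero).le_iff_le.1 ?_
  rw [eLpNorm_two_sq]
  calc _ ≤ ∫⁻ x, ∫⁻ z, ‖bumpKernel z‖ₑ * ‖f (x - ε • z) - f x‖ₑ ^ 2 := lintegral_mono hsq
    _ = ∫⁻ z, ‖bumpKernel z‖ₑ * eLpNorm (fun x => f (x - ε • z) - f x) 2 volume ^ 2 := by
        rw [lintegral_lintegral_swap hm.aemeasurable]
        refine lintegral_congr fun z => ?_
        have m2 : Measurable fun x => ‖f (x - ε • z) - f x‖ₑ ^ 2 :=
          hd.of_uncurry_right.enorm.pow_const 2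
        rw [lintegral_const_mul _ m2, eLpNorm_two_sq]
    _ ≤ ∫⁻ z, ‖bumpKernel z‖ₑ * (ENNReal.ofReal ε * A) ^ 2 := by
        refine lintegral_mono fun z => ?_
        rcases le_or_gt 1 ‖z‖ with hz | hz
        · simp [bumpKernel_eq_zero hz]
        · refine mul_le_mul' le_rfl (pow_le_pow_left' ((h (ε • z)).trans (mul_le_mul' ?_ le_rfl)) 2)
          rw [← ofReal_norm, norm_smul, Real.norm_of_nonneg hε.le]
          exact ENNReal.ofReal_le_ofReal (mul_le_of_le_one_right hε.le hz.le)
    _ = _ := by rw [lintegral_mul_const _ hη, lintegral_enorm_bumpKernel, one_mul]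

theorem mollKernel_neg (ε : ℝ) (z : R3) : mollKernel ε (-z) = mollKernel ε z := by
  simp only [mollKernel, smul_neg]
  congr 1
  exact ContDiffBump.normed_neg _ _

/-- The kernel is even, so mollification is self-adjoint; this lets the mollifier move from the
density to the velocity. -/
theorem integral_mul_moll {ε : ℝ} (hε : 0 < ε) {f g : R3 → ℝ} (hf : Integrable f)
    (hg : Integrable g) : ∫ x, f x * moll ε g x = ∫ x, moll ε f x * g x := by
  obtain ⟨c, hc⟩ := (mollKernel_contDiff ε).continuous.bounded_above_of_compact_support
    (mollKernel_hasCompactSupport hε)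
  have hi : Integrable (Function.uncurry fun x y : R3 => mollKernel ε (x - y) * (f x * g y))
      (volume.prod volume) :=
    (hf.mul_prod hg).bdd_mul (((mollKernel_contDiff ε).continuous.comp
      (by fun_prop : Continuous fun p : R3 × R3 => p.1 - p.2)).aestronglyMeasurable)
      (Eventually.of_forall fun p => hc _)
  have e1 : ∀ x, f x * moll ε g x = ∫ y, mollKernel ε (x - y) * (f x * g y) := fun x => by
    rw [moll, ← integral_const_mul]
    refine integral_congr_ae (Eventually.of_forall fun y => ?_)
    simp only
    ring
  have e2 : ∀ y, moll ε f y * g y = ∫ x, mollKernel ε (x - y) * (f x * g y) := fun y => by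
    rw [moll, ← integral_mul_const]
    refine integral_congr_ae (Eventually.of_forall fun x => ?_)
    simp only
    rw [← mollKernel_neg, neg_sub]
    ring
  simp only [e1, e2]
  exact integral_integral_swap hi

theorem abs_integral_mul_le {α : Type*} [MeasurableSpace α] {μ : Measure α} {f g : α → ℝ}
    (hf : AEStronglyMeasurable f μ) (hg : AEStronglyMeasurable g μ) {c : ℝ} (hc : 0 ≤ c)
    (h : eLpNorm f 2 μ * eLpNorm g 2 μ ≤ ENNReal.ofReal c) : |∫ x, f x * g x ∂μ| ≤ c := by
  have h1 := (enorm_integral_le_lintegral_enorm (μ := μ) fun x => f x * g x)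
  simp only [enorm_mul] at h1
  have h2 := h1.trans ((lintegral_enorm_mul_le hf hg).trans h)
  rw [Real.enorm_eq_ofReal_abs] at h2
  exact (ENNReal.ofReal_le_ofReal_iff hc).1 h2

/-- The product of a strongly and a weakly convergent sequence. -/
theorem tendsto_integral_mul_of_strong_weak {α : Type*} [MeasurableSpace α] {μ : Measure α}
    {a v : ℕ → α → ℝ} {a' v' : α → ℝ} (ha : ∀ k, MemLp (a k) 2 μ) (ha' : MemLp a' 2 μ)
    (hv : ∀ k, MemLp (v k) 2 μ) {B : ENNReal} (hB : B ≠ ⊤) (hvB : ∀ k, eLpNorm (v k) 2 μ ≤ B)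
    (hs : Tendsto (fun k => eLpNorm (fun x => a k x - a' x) 2 μ) atTop (𝓝 0))
    (hw : WeaklyTendsto μ v v') :
    Tendsto (fun k => ∫ x, a k x * v k x ∂μ) atTop (𝓝 (∫ x, a' x * v' x ∂μ)) := by
  have h1 := hw.tendsto_mul ha'
  have h2 : Tendsto (fun k => ∫ x, (a k x - a' x) * v k x ∂μ) atTop (𝓝 0) := by
    have h3 : Tendsto (fun k => ‖∫ x, (a k x - a' x) * v k x ∂μ‖ₑ) atTop (𝓝 0) := by
      have h4 := ENNReal.Tendsto.mul_const hs (Or.inr hB)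
      rw [zero_mul] at h4
      refine tendsto_of_tendsto_of_tendsto_of_le_of_le tendsto_const_nhds h4
        (fun _ => zero_le) fun k => ?_
      refine (enorm_integral_le_lintegral_enorm _).trans ?_
      simp only [enorm_mul]
      exact (lintegral_enorm_mul_le ((ha k).1.sub ha'.1) (hv k).1).trans
        (mul_le_mul' le_rfl (hvB k))
    exact tendsto_zero_iff_enorm_tendsto_zero.2 h3
  have h5 := h2.add h1
  rw [zero_add] at h5
  simp only [mul_comm (v' _)] at h5
  refine h5.congr fun k => ?_
  have i1 : Integrable (fun x => (a k x - a' x) * v k x) μ :=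
    memLp_one_iff_integrable.1 ((hv k).mul ((ha k).sub ha'))
  have i2 : Integrable (fun x => v k x * a' x) μ := memLp_one_iff_integrable.1 (ha'.mul (hv k))
  rw [← integral_add i1 i2]
  refine integral_congr_ae (Eventually.of_forall fun x => ?_)
  simp only
  ring

theorem enorm_moll_le {ε : ℝ} {c : ℝ} (hc : ∀ z, ‖mollKernel ε z‖ ≤ c) (f : R3 → ℝ) (x : R3) :
    ‖moll ε f x‖ₑ ≤ ENNReal.ofReal c * ∫⁻ y, ‖f y‖ₑ := by
  rw [← lintegral_const_mul' _ _ ENNReal.ofReal_ne_top]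
  refine (enorm_integral_le_lintegral_enorm _).trans (lintegral_mono fun y => ?_)
  rw [enorm_mul]
  refine mul_le_mul' ?_ le_rfl
  rw [← ofReal_norm]
  exact ENNReal.ofReal_le_ofReal (hc _)

theorem lintegral_enorm_le_of_eLpNorm_le {Ω : Set R3} (hΩ : IsOpen Ω) {f : R3 → ℝ}
    (hf : Measurable f) (hf0 : ∀ x, x ∉ Ω → f x = 0) {C : ENNReal}
    (hC : eLpNorm f 2 (volume.restrict Ω) ≤ C) :
    ∫⁻ x, ‖f x‖ₑ ≤ C * eLpNorm (fun _ : R3 => (1 : ℝ)) 2 (volume.restrict Ω) := by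
  rw [← lintegral_restrict_of_support hΩ.measurableSet fun x hx => by simp [hf0 x hx]]
  have := lintegral_enorm_mul_le (μ := volume.restrict Ω) (f := f) (g := fun _ => (1 : ℝ))
    hf.aestronglyMeasurable aestronglyMeasurable_const
  simp only [enorm_one, mul_one] at this
  exact this.trans (mul_le_mul' hC le_rfl)

theorem ae_cylMeasure_of_ae {Ω : Set R3} {T : ℝ} {p : ℝ → Prop}
    (h : ∀ᵐ t ∂(timeMeasure T), p t) : ∀ᵐ z ∂(cylMeasure Ω T), p z.1 := by
  rw [cylMeasure_eq_prod]
  exact Measure.quasiMeasurePreserving_fst.ae h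

/-- A measurable function, extended by zero, bounded in `L^∞(0,T;L²(Ω))`. -/
structure BoundedDensity (Ω : Set R3) (T : ℝ) (f : ℝ → R3 → ℝ) (C : ENNReal) : Prop where
  meas : Measurable (Function.uncurry f)
  zero : ∀ t x, x ∉ Ω → f t x = 0
  norm_le : normLinfL2 Ω T f ≤ C

namespace BoundedDensity

variable {Ω : Set R3} {T : ℝ} {f : ℝ → R3 → ℝ} {C : ENNReal}

theorem memLp (h : BoundedDensity Ω T f C) (hC : C ≠ ⊤) :
    MemLp (Function.uncurry f) 2 (cylMeasure Ω T) :=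
  memLp_of_normLinfL2_le h.meas.aestronglyMeasurable hC h.norm_le

theorem ae_integrable (h : BoundedDensity Ω T f C) (hC : C ≠ ⊤) (hΩ : IsOpen Ω)
    (hΩb : Bornology.IsBounded Ω) : ∀ᵐ t ∂(timeMeasure T), Integrable (f t) :=
  (TransportData.ae_memLp hΩ h.meas h.zero (h.memLp hC)).mono fun t ht =>
    MemLp.integrable_of_support hΩ.measurableSet hΩb ht (h.zero t)

theorem ae_enorm_moll_le (h : BoundedDensity Ω T f C) (hΩ : IsOpen Ω) {ε c : ℝ}
    (hc : ∀ z, ‖mollKernel ε z‖ ≤ c) : ∀ᵐ z ∂(cylMeasure Ω T), ‖moll ε (f z.1) z.2‖ₑ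
      ≤ ENNReal.ofReal c * (C * eLpNorm (fun _ : R3 => (1 : ℝ)) 2 (volume.restrict Ω)) := by
  have h1 : ∀ᵐ t ∂(timeMeasure T), ∀ x, ‖moll ε (f t) x‖ₑ
      ≤ ENNReal.ofReal c * (C * eLpNorm (fun _ : R3 => (1 : ℝ)) 2 (volume.restrict Ω)) := by
    filter_upwards [normLinfL2_le_iff.1 h.norm_le] with t ht x
    exact (enorm_moll_le hc (f t) x).trans (mul_le_mul' le_rfl
      (lintegral_enorm_le_of_eLpNorm_le hΩ h.meas.of_uncurry_left (h.zero t) ht))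
  exact (ae_cylMeasure_of_ae h1).mono fun z hz => hz z.2

end BoundedDensity

/-- Mollification in space turns convergence at almost every time, tested with smooth functions
of space, into strong convergence. -/
theorem tendsto_eLpNorm_moll_sub {Ω : Set R3} {T : ℝ} (hΩ : IsOpen Ω)
    (hΩb : Bornology.IsBounded Ω) {f : ℕ → ℝ → R3 → ℝ} {g : ℝ → R3 → ℝ} {C : ENNReal}
    (hC : C ≠ ⊤) (hf : ∀ K, BoundedDensity Ω T (f K) C) (hg : BoundedDensity Ω T g C)
    (hlim : ∀ w : R3 → ℝ, ContDiff ℝ ∞ w → HasCompactSupport w →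
      ∀ᵐ t ∂(timeMeasure T), Tendsto (fun K => ∫ x in Ω, w x * f K t x) atTop
        (𝓝 (∫ x in Ω, w x * g t x))) {ε : ℝ} (hε : 0 < ε) :
    Tendsto (fun K => eLpNorm (fun z : ℝ × R3 => moll ε (f K z.1) z.2 - moll ε (g z.1) z.2) 2
      (cylMeasure Ω T)) atTop (𝓝 0) := by
  have := isFiniteMeasure_cylMeasure hΩb T
  have := isFiniteMeasure_restrict_of_isBounded hΩb
  obtain ⟨c, hc⟩ := (mollKernel_contDiff ε).continuous.bounded_above_of_compact_support
    (mollKernel_hasCompactSupport hε)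
  set D := ENNReal.ofReal c * (C * eLpNorm (fun _ : R3 => (1 : ℝ)) 2 (volume.restrict Ω)) with hD
  have hDfin : D < ⊤ := ENNReal.mul_lt_top ENNReal.ofReal_lt_top
    (ENNReal.mul_lt_top hC.lt_top (memLp_const (1 : ℝ)).2)
  have mf : ∀ K, Measurable fun p : ℝ × R3 => moll ε (f K p.1) p.2 := fun K =>
    measurable_moll_param (hf K).meas ε
  have mg : Measurable fun p : ℝ × R3 => moll ε (g p.1) p.2 := measurable_moll_param hg.meas ε
  have hae : ∀ᵐ z ∂(cylMeasure Ω T), Tendsto (fun K => moll ε (f K z.1) z.2) atTop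
      (𝓝 (moll ε (g z.1) z.2)) := by
    have hS := measurableSet_tendsto_fun (l := atTop) mf mg
    have h1 : ∀ y : R3, ∀ᵐ t ∂(timeMeasure T), Tendsto (fun K => moll ε (f K t) y) atTop
        (𝓝 (moll ε (g t) y)) := by
      intro y
      have hw : ContDiff ℝ ∞ fun x => mollKernel ε (y - x) :=
        (mollKernel_contDiff ε).comp (contDiff_const.sub contDiff_id)
      have hwc : HasCompactSupport fun x => mollKernel ε (y - x) :=
        (mollKernel_hasCompactSupport hε).comp_homeomorph (Homeomorph.subLeft y)
      filter_upwards [hlim _ hw hwc] with t ht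
      have e : ∀ {h : ℝ → R3 → ℝ}, (∀ t x, x ∉ Ω → h t x = 0) →
          ∫ x in Ω, mollKernel ε (y - x) * h t x = moll ε (h t) y := fun h0 =>
        integral_restrict_of_support fun x hx => by simp [h0 t x hx]
      rw [e hg.zero] at ht
      exact ht.congr fun K => e (hf K).zero
    rw [cylMeasure_eq_prod]
    -- For each `y` the kernel centred at `y` is a test function, but the exceptional null set of
    -- times depends on `y`. Measurability of the convergence set allows the quantifiers to be
    -- exchanged.
    refine (Measure.ae_prod_mem_iff_ae_ae_mem hS).2 ?_
    refine (Measure.ae_ae_comm (p := fun t y => Tendsto (fun K => moll ε (f K t) y) atTop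
        (𝓝 (moll ε (g t) y))) hS).2 (Eventually.of_forall h1)
  refine tendsto_zero_of_tendsto_sq ?_
  simp only [eLpNorm_two_sq]
  have key := tendsto_lintegral_of_dominated_convergence (μ := cylMeasure Ω T)
    (F := fun K z => ‖moll ε (f K z.1) z.2 - moll ε (g z.1) z.2‖ₑ ^ 2) (f := fun _ => 0)
    (fun _ => (D + D) ^ 2) (fun K => ((mf K).sub mg).enorm.pow_const 2) (fun K => ?_) ?_ ?_
  · simpa using key
  · filter_upwards [(hf K).ae_enorm_moll_le hΩ hc, hg.ae_enorm_moll_le hΩ hc] with z h1 h2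
    exact pow_le_pow_left' (enorm_sub_le.trans (add_le_add h1 h2)) 2
  · rw [lintegral_const]
    exact (ENNReal.mul_lt_top (ENNReal.pow_lt_top (ENNReal.add_lt_top.2 ⟨hDfin, hDfin⟩))
      (measure_lt_top _ _)).ne
  · filter_upwards [hae] with z hz
    have h1 := (hz.sub_const (moll ε (g z.1) z.2)).enorm
    have h2 := ENNReal.Tendsto.pow (n := 2) h1
    simpa using h2

/-- A measurable square integrable function, extended by zero, with an integrated bound on
its translates in space. -/
structure TranslateBounded (Ω : Set R3) (T : ℝ) (v : ℝ → R3 → ℝ) (B : ENNReal) : Prop where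
  meas : Measurable (Function.uncurry v)
  zero : ∀ t x, x ∉ Ω → v t x = 0
  norm_lt_top : eLpNorm (Function.uncurry v) 2 (cylMeasure Ω T) < ⊤
  translate : ∃ A : ℝ → ENNReal, (∀ᵐ t ∂(timeMeasure T), ∀ z,
    eLpNorm (fun x => v t (x - z) - v t x) 2 volume ≤ ‖z‖ₑ * A t) ∧
    ∫⁻ t, A t ^ 2 ∂(timeMeasure T) ≤ B ^ 2

namespace TranslateBounded

variable {Ω : Set R3} {T : ℝ} {v : ℝ → R3 → ℝ} {B : ENNReal}

theorem memLp (h : TranslateBounded Ω T v B) : MemLp (Function.uncurry v) 2 (cylMeasure Ω T) :=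
  ⟨h.meas.aestronglyMeasurable, h.norm_lt_top⟩

theorem ae_integrable (h : TranslateBounded Ω T v B) (hΩ : IsOpen Ω)
    (hΩb : Bornology.IsBounded Ω) : ∀ᵐ t ∂(timeMeasure T), Integrable (v t) :=
  (TransportData.ae_memLp hΩ h.meas h.zero h.memLp).mono fun t ht =>
    MemLp.integrable_of_support hΩ.measurableSet hΩb ht (h.zero t)

theorem eLpNorm_moll_sub_le (h : TranslateBounded Ω T v B) (hΩ : IsOpen Ω)
    (hΩb : Bornology.IsBounded Ω) {ε : ℝ} (hε : 0 < ε) :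
    eLpNorm (fun z : ℝ × R3 => moll ε (v z.1) z.2 - v z.1 z.2) 2 (cylMeasure Ω T)
      ≤ ENNReal.ofReal ε * B := by
  obtain ⟨A, hA, hAB⟩ := h.translate
  have hm : Measurable fun z : ℝ × R3 => moll ε (v z.1) z.2 - v z.1 z.2 :=
    (measurable_moll_param h.meas ε).sub h.meas
  refine (ENNReal.pow_right_strictMono two_ne_zero).le_iff_le.1 ?_
  rw [eLpNorm_cylMeasure_sq hm.aestronglyMeasurable]
  calc _ ≤ ∫⁻ t, ENNReal.ofReal ε ^ 2 * A t ^ 2 ∂(timeMeasure T) := by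
        refine lintegral_mono_ae ?_
        filter_upwards [hA, h.ae_integrable hΩ hΩb] with t h1 h2
        rw [← mul_pow]
        exact pow_le_pow_left' ((eLpNorm_mono_measure _ Measure.restrict_le_self).trans
          (_root_.eLpNorm_moll_sub_le h.meas.of_uncurry_left h2 h1 hε)) 2
    _ ≤ _ := by
        rw [lintegral_const_mul' _ _ (by simp), mul_pow]
        exact mul_le_mul' le_rfl hAB

theorem memLp_moll (h : TranslateBounded Ω T v B) (hB : B ≠ ⊤) (hΩ : IsOpen Ω)
    (hΩb : Bornology.IsBounded Ω) {ε : ℝ} (hε : 0 < ε) :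
    MemLp (fun z : ℝ × R3 => moll ε (v z.1) z.2) 2 (cylMeasure Ω T) := by
  have m : MemLp (fun z : ℝ × R3 => moll ε (v z.1) z.2 - v z.1 z.2) 2 (cylMeasure Ω T) :=
    ⟨((measurable_moll_param h.meas ε).sub h.meas).aestronglyMeasurable,
      (h.eLpNorm_moll_sub_le hΩ hΩb hε).trans_lt (ENNReal.mul_lt_top ENNReal.ofReal_lt_top
        hB.lt_top)⟩
  refine (m.add h.memLp).ae_eq (Eventually.of_forall fun z => ?_)
  simp [Function.uncurry]

theorem integral_mul_moll (h : TranslateBounded Ω T v B) (hB : B ≠ ⊤) (hΩ : IsOpen Ω)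
    (hΩb : Bornology.IsBounded Ω) {f : ℝ → R3 → ℝ} {C : ENNReal} (hC : C ≠ ⊤)
    (hf : BoundedDensity Ω T f C) (hfm : ∀ ε > 0, MemLp (fun z : ℝ × R3 => moll ε (f z.1) z.2) 2
      (cylMeasure Ω T)) {ε : ℝ} (hε : 0 < ε) :
    ∫ z, f z.1 z.2 * moll ε (v z.1) z.2 ∂(cylMeasure Ω T)
      = ∫ z, moll ε (f z.1) z.2 * v z.1 z.2 ∂(cylMeasure Ω T) := by
  have i1 : Integrable (fun z : ℝ × R3 => f z.1 z.2 * moll ε (v z.1) z.2) (cylMeasure Ω T) :=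
    memLp_one_iff_integrable.1 ((h.memLp_moll hB hΩ hΩb hε).mul (hf.memLp hC))
  have i2 : Integrable (fun z : ℝ × R3 => moll ε (f z.1) z.2 * v z.1 z.2) (cylMeasure Ω T) :=
    memLp_one_iff_integrable.1 (h.memLp.mul (hfm ε hε))
  rw [cylMeasure_eq_prod] at i1 i2 ⊢
  rw [integral_prod _ i1, integral_prod _ i2]
  refine integral_congr_ae ?_
  filter_upwards [hf.ae_integrable hC hΩ hΩb, h.ae_integrable hΩ hΩb] with t h1 h2
  rw [integral_restrict_of_support fun x hx => by simp [hf.zero t x hx],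
    integral_restrict_of_support fun x hx => by simp [h.zero t x hx]]
  exact _root_.integral_mul_moll hε h1 h2

end TranslateBounded

/-- Products of a sequence that is compact in time, and a sequence that is compact in space. -/
theorem tendsto_integral_mul_of_compact_time_space {Ω : Set R3} {T : ℝ} (hΩ : IsOpen Ω)
    (hΩb : Bornology.IsBounded Ω) {f : ℕ → ℝ → R3 → ℝ} {g : ℝ → R3 → ℝ} {C : ENNReal}
    (hC : C ≠ ⊤) (hf : ∀ K, BoundedDensity Ω T (f K) C) (hg : BoundedDensity Ω T g C)
    (hlim : ∀ w : R3 → ℝ, ContDiff ℝ ∞ w → HasCompactSupport w →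
      ∀ᵐ t ∂(timeMeasure T), Tendsto (fun K => ∫ x in Ω, w x * f K t x) atTop
        (𝓝 (∫ x in Ω, w x * g t x)))
    {v : ℕ → ℝ → R3 → ℝ} {v' : ℝ → R3 → ℝ} {B : ENNReal} (hB : B ≠ ⊤)
    (hv : ∀ K, TranslateBounded Ω T (v K) B) (hv' : TranslateBounded Ω T v' B)
    (hvB : ∀ K, eLpNorm (Function.uncurry (v K)) 2 (cylMeasure Ω T) ≤ B)
    (hw : WeaklyTendsto (cylMeasure Ω T) (fun K => Function.uncurry (v K))
      (Function.uncurry v')) :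
    Tendsto (fun K => ∫ z, f K z.1 z.2 * v K z.1 z.2 ∂(cylMeasure Ω T)) atTop
      (𝓝 (∫ z, g z.1 z.2 * v' z.1 z.2 ∂(cylMeasure Ω T))) := by
  have := isFiniteMeasure_cylMeasure hΩb T
  have := isFiniteMeasure_restrict_of_isBounded hΩb
  have mm : ∀ {h : ℝ → R3 → ℝ}, BoundedDensity Ω T h C → ∀ ε > 0,
      MemLp (fun z : ℝ × R3 => moll ε (h z.1) z.2) 2 (cylMeasure Ω T) := by
    intro h hh ε hε
    obtain ⟨c, hc⟩ := (mollKernel_contDiff ε).continuous.bounded_above_of_compact_support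
      (mollKernel_hasCompactSupport hε)
    have hDfin : ENNReal.ofReal c * (C * eLpNorm (fun _ : R3 => (1 : ℝ)) 2 (volume.restrict Ω))
        < ⊤ := ENNReal.mul_lt_top ENNReal.ofReal_lt_top
      (ENNReal.mul_lt_top hC.lt_top (memLp_const (1 : ℝ)).2)
    refine MemLp.of_bound (measurable_moll_param hh.meas ε).aestronglyMeasurable
      (ENNReal.ofReal c * (C * eLpNorm (fun _ : R3 => (1 : ℝ)) 2 (volume.restrict Ω))).toReal ?_
    filter_upwards [hh.ae_enorm_moll_le hΩ hc] with z hz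
    have := ENNReal.toReal_mono hDfin.ne hz
    rwa [toReal_enorm] at this
  set c₁ := C * (ENNReal.ofReal T) ^ (1 / 2 : ℝ) with hc₁
  have hc₁fin : c₁ ≠ ⊤ := ENNReal.mul_ne_top hC (ENNReal.rpow_ne_top_of_nonneg (by norm_num)
    ENNReal.ofReal_ne_top)
  have fL2 : ∀ {h : ℝ → R3 → ℝ}, BoundedDensity Ω T h C →
      eLpNorm (Function.uncurry h) 2 (cylMeasure Ω T) ≤ c₁ := by
    intro h hh
    refine (ENNReal.pow_right_strictMono two_ne_zero).le_iff_le.1 ?_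
    refine (eLpNorm_le_of_normLinfL2_le hh.meas.aestronglyMeasurable hh.norm_le).trans
      (le_of_eq ?_)
    rw [hc₁, mul_pow, ← ENNReal.rpow_natCast (_ ^ (1 / 2 : ℝ)), ← ENNReal.rpow_mul]
    norm_num
  have close : ∀ {h k : ℝ → R3 → ℝ}, BoundedDensity Ω T h C → TranslateBounded Ω T k B →
      ∀ {ε η : ℝ}, 0 < ε → 0 < η → ENNReal.ofReal ε * (c₁ * B) ≤ ENNReal.ofReal η →
      |(∫ z, h z.1 z.2 * k z.1 z.2 ∂(cylMeasure Ω T))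
        - ∫ z, moll ε (h z.1) z.2 * k z.1 z.2 ∂(cylMeasure Ω T)| ≤ η := by
    intro h k hh hk ε η hε hη hle
    -- With the mollifier moved onto `k`, the error is `∫ h (k_ε - k)`, of order `ε` with a constant
    -- that depends only on the common bounds.
    rw [← hk.integral_mul_moll hB hΩ hΩb hC hh (mm hh) hε]
    have i1 : Integrable (fun z : ℝ × R3 => h z.1 z.2 * k z.1 z.2) (cylMeasure Ω T) :=
      memLp_one_iff_integrable.1 (hk.memLp.mul (hh.memLp hC))
    have i2 : Integrable (fun z : ℝ × R3 => h z.1 z.2 * moll ε (k z.1) z.2) (cylMeasure Ω T) :=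
      memLp_one_iff_integrable.1 ((hk.memLp_moll hB hΩ hΩb hε).mul (hh.memLp hC))
    rw [abs_sub_comm, ← integral_sub i2 i1]
    simp only [← mul_sub]
    refine abs_integral_mul_le (f := Function.uncurry h)
      (g := fun z : ℝ × R3 => moll ε (k z.1) z.2 - k z.1 z.2) hh.meas.aestronglyMeasurable
      ((measurable_moll_param hk.meas ε).sub hk.meas).aestronglyMeasurable hη.le ?_
    refine (mul_le_mul' (fL2 hh) (hk.eLpNorm_moll_sub_le hΩ hΩb hε)).trans (le_trans ?_ hle)
    rw [mul_left_comm]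
  refine tendsto_of_uniform_approx fun η hη => ?_
  have hlim0 : Tendsto (fun ε => ENNReal.ofReal ε * (c₁ * B)) (𝓝[>] 0) (𝓝 0) := by
    have h1 : Tendsto (fun ε : ℝ => ENNReal.ofReal ε) (𝓝[>] 0) (𝓝 0) := by
      have := (ENNReal.continuous_ofReal.tendsto 0).mono_left
        (nhdsWithin_le_nhds : 𝓝[>] (0 : ℝ) ≤ 𝓝 0)
      simpa using this
    simpa using ENNReal.Tendsto.mul_const h1 (Or.inr (ENNReal.mul_ne_top hc₁fin hB))
  obtain ⟨ε, hle, hε⟩ := ((hlim0.eventually_le_const (u := ENNReal.ofReal η)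
    (by simpa using hη)).and self_mem_nhdsWithin).exists
  refine ⟨fun K => ∫ z, moll ε (f K z.1) z.2 * v K z.1 z.2 ∂(cylMeasure Ω T),
    ∫ z, moll ε (g z.1) z.2 * v' z.1 z.2 ∂(cylMeasure Ω T),
    fun K => close (hf K) (hv K) hε hη hle, close hg hv' hε hη hle, ?_⟩
  exact tendsto_integral_mul_of_strong_weak (fun K => mm (hf K) ε hε) (mm hg ε hε)
    (fun K => (hv K).memLp) hB hvB (tendsto_eLpNorm_moll_sub hΩ hΩb hC hf hg hlim hε) hw

/-! ### Vanishing viscosity in the flux formulation -/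

theorem timeMeasure_restrict_Ioc {T s t : ℝ} (hs : 0 ≤ s) (ht : t ≤ T) :
    (timeMeasure T).restrict (Ioc s t) = volume.restrict (Ioc s t) := by
  rw [timeMeasure, restrict_Ioo_eq_Ioc, Measure.restrict_restrict measurableSet_Ioc,
    inter_eq_left.2 (Ioc_subset_Ioc hs ht)]

theorem cylMeasure_restrict_slab {T s t : ℝ} (Ω : Set R3) (hs : 0 ≤ s) (ht : t ≤ T) :
    (cylMeasure Ω T).restrict (Ioc s t ×ˢ univ)
      = (volume.restrict (Ioc s t)).prod (volume.restrict Ω) := by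
  rw [cylMeasure_eq_prod, ← Measure.prod_restrict, timeMeasure_restrict_Ioc hs ht,
    Measure.restrict_univ]

/-- Boundedness in time gives the square root of the length of the interval, the source of the
Hölder exponent `1/2`. -/
theorem eLpNorm_slab_le {Ω : Set R3} {T s t : ℝ} (hs : 0 ≤ s) (hst : s ≤ t) (ht : t ≤ T)
    {f : ℝ → R3 → ℝ} (hf : AEStronglyMeasurable (Function.uncurry f) (cylMeasure Ω T))
    {C : ENNReal} (h : normLinfL2 Ω T f ≤ C) :
    eLpNorm (Function.uncurry f) 2 ((cylMeasure Ω T).restrict (Ioc s t ×ˢ univ))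
      ≤ C * ENNReal.ofReal √(t - s) := by
  refine (ENNReal.pow_right_strictMono two_ne_zero).le_iff_le.1 ?_
  have h1 := normLinfL2_le_iff.1 h
  have hm := (hf.restrict (s := Ioc s t ×ˢ univ)).enorm.pow_const 2
  rw [eLpNorm_two_sq, mul_pow, ← ENNReal.ofReal_pow (Real.sqrt_nonneg _),
    Real.sq_sqrt (by linarith)]
  rw [cylMeasure_restrict_slab Ω hs ht] at hm ⊢
  rw [lintegral_prod _ hm, ← timeMeasure_restrict_Ioc hs ht]
  calc _ ≤ ∫⁻ _ in Ioc s t, C ^ 2 ∂(timeMeasure T) := by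
        refine lintegral_mono_ae ((ae_restrict_of_ae h1).mono fun r hr => ?_)
        have := pow_le_pow_left' hr 2
        rwa [eLpNorm_two_sq] at this
    _ = _ := by rw [timeMeasure_restrict_Ioc hs ht]; simp

/-- Cauchy–Schwarz on the slab. For the convective part the density supplies `√(t - s)`; for `E`, of
which only an `L²` bound is known, the constant one supplies it, with norm `κ`. -/
theorem lintegral_slab_flux_le {Ω : Set R3} {T s t : ℝ} (hs : 0 ≤ s) (hst : s ≤ t) (ht : t ≤ T)
    {f : ℝ → R3 → ℝ} (hf : AEStronglyMeasurable (Function.uncurry f) (cylMeasure Ω T))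
    {C B κ : ENNReal} (h : normLinfL2 Ω T f ≤ C) {u E : ℝ → R3 → R3}
    (hu : AEStronglyMeasurable (Function.uncurry u) (cylMeasure Ω T))
    (huB : eLpNorm (Function.uncurry u) 2 (cylMeasure Ω T) ≤ B)
    (hE : AEStronglyMeasurable (Function.uncurry E) (cylMeasure Ω T))
    (hEB : eLpNorm (Function.uncurry E) 2 (cylMeasure Ω T) ≤ B)
    (hκ : eLpNorm (fun _ : R3 => (1 : ℝ)) 2 (volume.restrict Ω) ≤ κ) :
    ∫⁻ r in Ioc s t, (∫⁻ x in Ω, ‖f r x • u r x - E r x‖ₑ)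
      ≤ (C + κ) * B * ENNReal.ofReal √(t - s) := by
  set μ' := (cylMeasure Ω T).restrict (Ioc s t ×ˢ univ) with hμ'
  have hle : ∀ {G : Type} [NormedAddCommGroup G] {g : ℝ × R3 → G},
      eLpNorm g 2 μ' ≤ eLpNorm g 2 (cylMeasure Ω T) := fun {G} _ {g} =>
    eLpNorm_mono_measure _ Measure.restrict_le_self
  have hm : AEStronglyMeasurable (fun z : ℝ × R3 => f z.1 z.2 • u z.1 z.2 - E z.1 z.2) μ' :=
    ((hf.smul hu).sub hE).restrict
  have hm1 : AEStronglyMeasurable (fun z : ℝ × R3 => f z.1 z.2 • u z.1 z.2) μ' :=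
    (hf.smul hu).restrict
  have h1 : normLinfL2 Ω T (fun _ _ => 1) ≤ κ :=
    normLinfL2_le_iff.2 (Eventually.of_forall fun _ => hκ)
  have e : ∫⁻ r in Ioc s t, (∫⁻ x in Ω, ‖f r x • u r x - E r x‖ₑ)
      = ∫⁻ z, ‖f z.1 z.2 • u z.1 z.2 - E z.1 z.2‖ₑ ∂μ' := by
    rw [hμ', cylMeasure_restrict_slab Ω hs ht] at hm ⊢
    rw [lintegral_prod _ hm.enorm]
  rw [e]
  calc _ ≤ ∫⁻ z, (‖f z.1 z.2 • u z.1 z.2‖ₑ + ‖E z.1 z.2‖ₑ) ∂μ' :=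
        lintegral_mono fun z => enorm_sub_le
    _ = (∫⁻ z, ‖f z.1 z.2 • u z.1 z.2‖ₑ ∂μ') + ∫⁻ z, ‖E z.1 z.2‖ₑ ∂μ' :=
        lintegral_add_left' hm1.enorm _
    _ ≤ C * ENNReal.ofReal √(t - s) * B + κ * ENNReal.ofReal √(t - s) * B := by
        refine add_le_add ?_ ?_
        · simp only [enorm_smul]
          exact (lintegral_enorm_mul_le hf.restrict hu.restrict).trans
            (mul_le_mul' (eLpNorm_slab_le hs hst ht hf h) (hle.trans huB))
        · have := lintegral_enorm_mul_le (μ := μ') (f := fun _ : ℝ × R3 => (1 : ℝ))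
            aestronglyMeasurable_const hE.restrict
          simp only [enorm_one, one_mul] at this
          exact this.trans (mul_le_mul' (eLpNorm_slab_le hs hst ht (f := fun _ _ => (1 : ℝ))
            aestronglyMeasurable_const h1) (hle.trans hEB))
    _ = _ := by ring

/-- A velocity field in `L²(0,T;H¹₀)` with a measurable representative, extended by zero. -/
structure BoundedVelocity (Ω : Set R3) (T : ℝ) (u : ℝ → R3 → R3) (Du : ℝ → R3 → R3 →L[ℝ] R3)
    (B : ENNReal) : Prop where
  meas : Measurable (Function.uncurry u)
  zero : ∀ t x, x ∉ Ω → u t x = 0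
  memL2H10 : MemL2H10 Ω T u Du
  norm_le : eLpNorm (Function.uncurry u) 2 (cylMeasure Ω T) ≤ B
  norm_deriv_le : eLpNorm (Function.uncurry Du) 2 (cylMeasure Ω T) ≤ B

/-- The translate bound at time `t` is `‖Du(t)‖`, and its square integrates to the norm of `Du` in
space-time. -/
theorem BoundedVelocity.translateBounded {Ω : Set R3} {T : ℝ} {u : ℝ → R3 → R3}
    {Du : ℝ → R3 → R3 →L[ℝ] R3} {B : ENNReal} (h : BoundedVelocity Ω T u Du B) (hΩ : IsOpen Ω)
    (i : Fin 3) : TranslateBounded Ω T (fun t x => u t x i) B ∧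
      eLpNorm (Function.uncurry fun t x => u t x i) 2 (cylMeasure Ω T) ≤ B := by
  have hb : eLpNorm (Function.uncurry fun t x => u t x i) 2 (cylMeasure Ω T) ≤ B :=
    (eLpNorm_mono fun z => PiLp.norm_apply_le (Function.uncurry u z) i).trans h.norm_le
  refine ⟨⟨?_, fun t x hx => by simp [h.zero t x hx], ?_, fun t => eLpNorm (Du t) 2
    (volume.restrict Ω), ?_, ?_⟩, hb⟩
  · exact (EuclideanSpace.proj (𝕜 := ℝ) i).continuous.measurable.comp h.meas
  · exact (eLpNorm_mono fun z => PiLp.norm_apply_le (Function.uncurry u z) i).trans_lt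
      h.memL2H10.1.2
  · filter_upwards [h.memL2H10.2.2] with t ht z
    refine le_trans (eLpNorm_mono fun x => ?_)
      (ht.eLpNorm_sub_translate_le hΩ.measurableSet (h.zero t) z)
    exact PiLp.norm_apply_le (u t (x - z) - u t x) i
  · exact (eLpNorm_cylMeasure_sq (f := Function.uncurry Du) h.memL2H10.2.1.1).symm.le.trans
      (pow_le_pow_left' h.norm_deriv_le 2)

/-- Weak limits of flux solutions with vanishing diffusive flux are flux solutions. -/
theorem IsFluxSolution.of_weaklyTendsto {Ω : Set R3} {T : ℝ} (hΩ : IsOpen Ω)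
    (hΩb : Bornology.IsBounded Ω) (hT : 0 < T) {f₀ : R3 → ℝ} {f : ℕ → ℝ → R3 → ℝ}
    {g : ℝ → R3 → ℝ} {u : ℕ → ℝ → R3 → R3} {Du : ℕ → ℝ → R3 → R3 →L[ℝ] R3} {v : ℝ → R3 → R3}
    {Dv : ℝ → R3 → R3 →L[ℝ] R3} {E : ℕ → ℝ → R3 → R3} {C B : ENNReal} (hC : C ≠ ⊤) (hB : B ≠ ⊤)
    (hf : ∀ K, BoundedDensity Ω T (f K) C) (hg : BoundedDensity Ω T g C)
    (hu : ∀ K, BoundedVelocity Ω T (u K) (Du K) B) (hv : BoundedVelocity Ω T v Dv B)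
    (hE : ∀ K, AEStronglyMeasurable (Function.uncurry (E K)) (cylMeasure Ω T))
    (hEB : ∀ K, eLpNorm (Function.uncurry (E K)) 2 (cylMeasure Ω T) ≤ B)
    (hE0 : Tendsto (fun K => eLpNorm (Function.uncurry (E K)) 2 (cylMeasure Ω T)) atTop (𝓝 0))
    (hfw : WeaklyTendsto (cylMeasure Ω T) (fun K => Function.uncurry (f K)) (Function.uncurry g))
    (huw : WeaklyTendsto (cylMeasure Ω T) (fun K => Function.uncurry (u K)) (Function.uncurry v))
    (h : ∀ K, IsFluxSolution Ω T f₀ (f K) (fun t x => f K t x • u K t x - E K t x)) :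
    IsFluxSolution Ω T f₀ g (fun t x => g t x • v t x) := by
  have := isFiniteMeasure_cylMeasure hΩb T
  have := isFiniteMeasure_restrict_of_isBounded hΩb
  set κ := eLpNorm (fun _ : R3 => (1 : ℝ)) 2 (volume.restrict Ω) with hκ
  have hκfin : κ ≠ ⊤ := (memLp_const (1 : ℝ)).2.ne
  have hEm : ∀ K, MemLp (Function.uncurry (E K)) 2 (cylMeasure Ω T) := fun K =>
    ⟨hE K, (hEB K).trans_lt hB.lt_top⟩
  have ifu : ∀ K, Integrable (Function.uncurry fun t x => f K t x • u K t x) (cylMeasure Ω T) :=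
    fun K => memLp_one_iff_integrable.1 ((hu K).memL2H10.1.smul ((hf K).memLp hC))
  have igv : Integrable (Function.uncurry fun t x => g t x • v t x) (cylMeasure Ω T) :=
    memLp_one_iff_integrable.1 (hv.memL2H10.1.smul (hg.memLp hC))
  -- Compactness in time: the flux bound on slabs yields convergence of tested slices at almost
  -- every time.
  have hae : ∀ w : R3 → ℝ, ContDiff ℝ ∞ w → HasCompactSupport w →
      ∀ᵐ t ∂(timeMeasure T), Tendsto (fun K => ∫ x in Ω, w x * f K t x) atTop
        (𝓝 (∫ x in Ω, w x * g t x)) := by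
    intro w hw hwc
    refine IsFluxSolution.ae_tendsto (M := ((C + κ) * B).toReal) hT hΩb ENNReal.toReal_nonneg h
      (fun K => (hf K).memLp hC) (hg.memLp hC) hfw
      (fun K => (ifu K).sub ((hEm K).integrable (by norm_num))) ?_ hw hwc
    intro K s t hs hst ht
    rw [ENNReal.ofReal_mul ENNReal.toReal_nonneg, ENNReal.ofReal_toReal
      (ENNReal.mul_ne_top (ENNReal.add_ne_top.2 ⟨hC, hκfin⟩) hB)]
    exact lintegral_slab_flux_le hs hst ht (hf K).meas.aestronglyMeasurable (hf K).norm_le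
      (hu K).meas.aestronglyMeasurable (hu K).norm_le (hE K) (hEB K) hκ.symm.le
  intro θ w hθ hθc hθT hw hwc
  obtain ⟨cw, hcw⟩ := hw.continuous.bounded_above_of_compact_support hwc
  have hw' : ContDiff ℝ ∞ (fderiv ℝ w) := (contDiff_infty_iff_fderiv.1 hw).2
  obtain ⟨cD, hcD⟩ := hw'.continuous.bounded_above_of_compact_support (hwc.fderiv ℝ)
  obtain ⟨cθ, hcθ⟩ := hθ.continuous.bounded_above_of_compact_support hθc
  have hθ' : Continuous (deriv θ) := hθ.continuous_deriv (by simp)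
  obtain ⟨cθ', hcθ'⟩ := hθ'.bounded_above_of_compact_support hθc.deriv
  -- the time derivative term
  have hψ : MemLp (fun z : ℝ × R3 => deriv θ z.1 * w z.2) 2 (cylMeasure Ω T) := by
    refine MemLp.of_bound (C := cθ' * cw) ?_ (Eventually.of_forall fun z => ?_)
    · exact ((hθ'.comp continuous_fst).mul (hw.continuous.comp
        continuous_snd)).aestronglyMeasurable
    · rw [norm_mul]
      exact mul_le_mul (hcθ' _) (hcw _) (norm_nonneg _) ((norm_nonneg _).trans (hcθ' 0))
  have lim1 : Tendsto (fun K => ∫ z, f K z.1 z.2 * (deriv θ z.1 * w z.2) ∂(cylMeasure Ω T)) atTop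
      (𝓝 (∫ z, g z.1 z.2 * (deriv θ z.1 * w z.2) ∂(cylMeasure Ω T))) := hfw.tendsto_mul hψ
  -- the diffusive flux
  have mθD : Continuous fun z : ℝ × R3 => θ z.1 • fderiv ℝ w z.2 :=
    (hθ.continuous.comp continuous_fst).smul (hw'.continuous.comp continuous_snd)
  have bθD : ∀ z : ℝ × R3, ‖θ z.1 • fderiv ℝ w z.2‖ ≤ cθ * cD := fun z => by
    rw [norm_smul]
    exact mul_le_mul (hcθ _) (hcD _) (norm_nonneg _) ((norm_nonneg _).trans (hcθ 0))
  have iθD : ∀ {G : ℝ × R3 → R3}, Integrable G (cylMeasure Ω T) →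
      Integrable (fun z => (θ z.1 • fderiv ℝ w z.2) (G z)) (cylMeasure Ω T) := by
    intro G hG
    refine (hG.norm.const_mul (cθ * cD)).mono' ?_ (Eventually.of_forall fun z => ?_)
    · exact (isBoundedBilinearMap_apply (𝕜 := ℝ) (E := R3)
        (F := ℝ)).continuous.comp_aestronglyMeasurable
        (mθD.aestronglyMeasurable.prodMk hG.aestronglyMeasurable)
    · exact (ContinuousLinearMap.le_opNorm _ _).trans
        (mul_le_mul_of_nonneg_right (bθD z) (norm_nonneg _))
  have lim2 : Tendsto (fun K => ∫ z, (θ z.1 • fderiv ℝ w z.2) (E K z.1 z.2) ∂(cylMeasure Ω T))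
      atTop (𝓝 0) := by
    refine tendsto_zero_iff_enorm_tendsto_zero.2 ?_
    have h4 := ENNReal.Tendsto.const_mul hE0 (Or.inr (ENNReal.mul_ne_top
      (ENNReal.ofReal_ne_top (r := cθ * cD))
      (memLp_const (p := 2) (μ := cylMeasure Ω T) (1 : ℝ)).2.ne))
    rw [mul_zero] at h4
    refine tendsto_of_tendsto_of_tendsto_of_le_of_le tendsto_const_nhds h4
      (fun _ => zero_le) fun K => ?_
    refine (enorm_integral_le_lintegral_enorm _).trans ?_
    have h5 := lintegral_enorm_mul_le (μ := cylMeasure Ω T) (f := fun _ : ℝ × R3 => (1 : ℝ))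
      aestronglyMeasurable_const (hE K)
    simp only [enorm_one, one_mul] at h5
    rw [mul_assoc]
    refine le_trans ?_ (mul_le_mul' le_rfl h5)
    rw [← lintegral_const_mul' _ _ ENNReal.ofReal_ne_top]
    refine lintegral_mono fun z => ((θ z.1 • fderiv ℝ w z.2).le_opENorm _).trans
      (mul_le_mul' ?_ le_rfl)
    rw [← ofReal_norm]
    exact ENNReal.ofReal_le_ofReal (bθD z)
  -- the convective flux, by components
  have comp : ∀ i : Fin 3, Tendsto (fun K => ∫ z, (θ z.1 * fderiv ℝ w z.2
        (EuclideanSpace.single i 1) * f K z.1 z.2) * u K z.1 z.2 i ∂(cylMeasure Ω T)) atTop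
      (𝓝 (∫ z, (θ z.1 * fderiv ℝ w z.2 (EuclideanSpace.single i 1) * g z.1 z.2) * v z.1 z.2 i
        ∂(cylMeasure Ω T))) := by
    intro i
    set m : R3 → ℝ := fun x => fderiv ℝ w x (EuclideanSpace.single i 1) with hm
    have sm : ContDiff ℝ ∞ m := hw'.clm_apply contDiff_const
    have hmc : HasCompactSupport m := (hwc.fderiv ℝ).comp_left (g := fun L : R3 →L[ℝ] ℝ =>
      L (EuclideanSpace.single i 1)) rfl
    obtain ⟨cm, hcm⟩ := sm.continuous.bounded_above_of_compact_support hmc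
    -- The test factors `θ` and `∂ᵢ w` are absorbed into the density, so that each component becomes
    -- a product of a density and a velocity component.
    have bd : ∀ {k : ℝ → R3 → ℝ}, BoundedDensity Ω T k C →
        BoundedDensity Ω T (fun t x => θ t * m x * k t x) (ENNReal.ofReal (cθ * cm) * C) := by
      intro k hk
      refine ⟨?_, fun t x hx => by simp [hk.zero t x hx], ?_⟩
      · exact (((hθ.continuous.comp continuous_fst).mul
          (sm.continuous.comp continuous_snd)).measurable).mul hk.meas
      · refine normLinfL2_le_iff.2 ((normLinfL2_le_iff.1 hk.norm_le).mono fun t ht => ?_)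
        have h0 : 0 ≤ cθ * cm :=
          mul_nonneg ((norm_nonneg _).trans (hcθ 0)) ((norm_nonneg _).trans (hcm 0))
        refine (eLpNorm_le_mul_eLpNorm_of_ae_le_mul (c := cθ * cm) (g := k t)
          (Eventually.of_forall fun x => ?_) 2).trans (mul_le_mul' le_rfl ht)
        rw [norm_mul, norm_mul]
        exact mul_le_mul_of_nonneg_right (mul_le_mul (hcθ _) (hcm _) (norm_nonneg _)
          ((norm_nonneg _).trans (hcθ 0))) (norm_nonneg _)
    refine tendsto_integral_mul_of_compact_time_space hΩ hΩb
      (f := fun K t x => θ t * m x * f K t x) (g := fun t x => θ t * m x * g t x)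
      (v := fun K t x => u K t x i) (v' := fun t x => v t x i)
      (ENNReal.mul_ne_top ENNReal.ofReal_ne_top hC) (fun K => bd (hf K)) (bd hg) ?_ hB
      (fun K => ((hu K).translateBounded hΩ i).1) (hv.translateBounded hΩ i).1
      (fun K => ((hu K).translateBounded hΩ i).2) (huw.clm (EuclideanSpace.proj i))
    -- On a slice `θ t` is a constant, and `W m` is again a smooth compactly supported function, so
    -- `hae` applies.
    intro W hW hWc
    filter_upwards [hae (fun x => W x * m x) (hW.mul sm) hWc.mul_right] with t ht
    have e : ∀ k : ℝ → R3 → ℝ, ∫ x in Ω, W x * (θ t * m x * k t x)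
        = θ t * ∫ x in Ω, W x * m x * k t x := fun k => by
      rw [← integral_const_mul]
      refine integral_congr_ae (Eventually.of_forall fun x => ?_)
      simp only
      ring
    simp only [e]
    exact ht.const_mul _
  have esum : ∀ {k : ℝ → R3 → ℝ} {U : ℝ → R3 → R3},
      Integrable (Function.uncurry fun t x => k t x • U t x) (cylMeasure Ω T) →
      ∫ z, (θ z.1 • fderiv ℝ w z.2) (k z.1 z.2 • U z.1 z.2) ∂(cylMeasure Ω T)
        = ∑ i : Fin 3, ∫ z, (θ z.1 * fderiv ℝ w z.2 (EuclideanSpace.single i 1) * k z.1 z.2)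
          * U z.1 z.2 i ∂(cylMeasure Ω T) := by
    intro k U hkU
    rw [← integral_finsetSum]
    · refine integral_congr_ae (Eventually.of_forall fun z => ?_)
      simp only
      conv_lhs => rw [R3_eq_sum (U z.1 z.2)]
      simp only [Finset.smul_sum, map_sum, map_smul, smul_eq_mul, smul_apply]
      refine Finset.sum_congr rfl fun i _ => ?_
      ring
    · intro i _
      have i1 := iθD (((EuclideanSpace.proj (𝕜 := ℝ) i).integrable_comp hkU).smul_const
        (EuclideanSpace.single i (1 : ℝ)))
      refine i1.congr (Eventually.of_forall fun z => ?_)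
      simp [Function.uncurry]
      ring
  have lim3 : Tendsto (fun K => ∫ z, (θ z.1 • fderiv ℝ w z.2) (f K z.1 z.2 • u K z.1 z.2)
      ∂(cylMeasure Ω T)) atTop (𝓝 (∫ z, (θ z.1 • fderiv ℝ w z.2) (g z.1 z.2 • v z.1 z.2)
      ∂(cylMeasure Ω T))) := by
    rw [esum igv]
    simp only [fun K => esum (ifu K)]
    exact tendsto_finsetSum _ fun i _ => comp i
  have eK : ∀ K, (∫ z, f K z.1 z.2 * (deriv θ z.1 * w z.2) ∂(cylMeasure Ω T))
      + ((∫ z, (θ z.1 • fderiv ℝ w z.2) (f K z.1 z.2 • u K z.1 z.2) ∂(cylMeasure Ω T))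
      - ∫ z, (θ z.1 • fderiv ℝ w z.2) (E K z.1 z.2) ∂(cylMeasure Ω T))
      + θ 0 * ∫ x in Ω, f₀ x * w x = 0 := by
    intro K
    refine Eq.trans ?_ (h K θ w hθ hθc hθT hw hwc)
    have i1 : Integrable (fun z : ℝ × R3 => f K z.1 z.2 * (deriv θ z.1 * w z.2))
        (cylMeasure Ω T) := memLp_one_iff_integrable.1 (hψ.mul ((hf K).memLp hC))
    have i2 := iθD (ifu K)
    have i3 := iθD ((hEm K).integrable (by norm_num))
    have i4 : Integrable (fun z : ℝ × R3 => (θ z.1 • fderiv ℝ w z.2) (f K z.1 z.2 • u K z.1 z.2)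
      - (θ z.1 • fderiv ℝ w z.2) (E K z.1 z.2)) (cylMeasure Ω T) := i2.sub i3
    have e1 := integral_sub i2 i3
    simp only [Function.uncurry] at e1
    rw [← e1, ← integral_add i1 i4]
    congr 1
    refine integral_congr_ae (Eventually.of_forall fun z => ?_)
    simp only [map_sub, smul_apply, smul_eq_mul]
    ring
  have eL : (∫ z, g z.1 z.2 * (deriv θ z.1 * w z.2) ∂(cylMeasure Ω T))
      + ((∫ z, (θ z.1 • fderiv ℝ w z.2) (g z.1 z.2 • v z.1 z.2) ∂(cylMeasure Ω T)) - 0)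
      + θ 0 * ∫ x in Ω, f₀ x * w x = 0 := by
    refine tendsto_nhds_unique ((lim1.add (lim3.sub lim2)).add_const _) ?_
    simp only [eK]
    exact tendsto_const_nhds
  rw [sub_zero] at eL
  refine Eq.trans ?_ eL
  have i1 : Integrable (fun z : ℝ × R3 => g z.1 z.2 * (deriv θ z.1 * w z.2))
      (cylMeasure Ω T) := memLp_one_iff_integrable.1 (hψ.mul (hg.memLp hC))
  have i2 := iθD igv
  have e1 := integral_add i1 i2
  simp only [Function.uncurry] at e1
  rw [← e1]
  congr 1
  refine integral_congr_ae (Eventually.of_forall fun z => ?_)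
  simp only [smul_apply, smul_eq_mul]
  ring

/-! ### Representatives and stability of the formulation -/

/-- Extension by zero makes convolutions on the whole space meaningful, and Borel measurability
makes every time slice measurable. -/
theorem exists_measurable_rep {Ω : Set R3} (hΩ : IsOpen Ω) {T : ℝ} {E : Type*}
    [NormedAddCommGroup E] [MeasurableSpace E] [BorelSpace E] {f : ℝ → R3 → E}
    (hf : AEStronglyMeasurable (Function.uncurry f) (cylMeasure Ω T)) :
    ∃ g : ℝ → R3 → E, Measurable (Function.uncurry g) ∧ (∀ t x, x ∉ Ω → g t x = 0) ∧
      Function.uncurry f =ᵐ[cylMeasure Ω T] Function.uncurry g := by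
  have hm : MeasurableSet ((univ : Set ℝ) ×ˢ Ω) := MeasurableSet.univ.prod hΩ.measurableSet
  set F : ℝ × R3 → E := ((univ : Set ℝ) ×ˢ Ω).indicator (hf.mk (Function.uncurry f)) with hF
  refine ⟨fun t x => F (t, x), ?_, fun t x hx => ?_, ?_⟩
  · exact hf.stronglyMeasurable_mk.measurable.indicator hm
  · exact indicator_of_notMem (fun h => hx h.2) _
  · filter_upwards [hf.ae_eq_mk, ae_restrict_mem (measurableSet_Ioo.prod hΩ.measurableSet)]
      with z h1 h2
    have hz : z ∈ (univ : Set ℝ) ×ˢ Ω := ⟨mem_univ _, h2.2⟩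
    have h3 : F z = hf.mk (Function.uncurry f) z := indicator_of_mem hz _
    rw [h1, ← h3]
    rfl

theorem exists_measurable_rep_slice {Ω : Set R3} (hΩ : IsOpen Ω) {f : R3 → ℝ}
    (hf : IntegrableOn f Ω) (h0 : ∀ᵐ x ∂(volume.restrict Ω), 0 ≤ f x) :
    ∃ g : R3 → ℝ, Measurable g ∧ (∀ x, x ∉ Ω → g x = 0) ∧ (∀ x, 0 ≤ g x) ∧ Integrable g ∧
      f =ᵐ[volume.restrict Ω] g := by
  have hm := hf.aestronglyMeasurable
  have he : f =ᵐ[volume.restrict Ω] Ω.indicator fun x => max (hm.mk f x) 0 := by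
    filter_upwards [hm.ae_eq_mk, ae_restrict_mem hΩ.measurableSet, h0] with x h1 h2 h3
    rw [indicator_of_mem h2, ← h1, max_eq_left h3]
  refine ⟨Ω.indicator fun x => max (hm.mk f x) 0,
    (hm.stronglyMeasurable_mk.measurable.max measurable_const).indicator hΩ.measurableSet,
    fun x hx => by simp [hx], fun x => indicator_nonneg (fun _ _ => le_max_right _ _) x, ?_, he⟩
  refine IntegrableOn.integrable_of_forall_notMem_eq_zero (s := Ω) ?_ fun x hx => by simp [hx]
  exact (integrable_congr he).1 hf

theorem normLinfL2_congr {Ω : Set R3} {T : ℝ} {f g : ℝ → R3 → ℝ}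
    (h : Function.uncurry f =ᵐ[cylMeasure Ω T] Function.uncurry g) :
    normLinfL2 Ω T f = normLinfL2 Ω T g :=
  essSup_congr_ae ((ae_ae_of_ae_cylMeasure h).mono fun _ ht => eLpNorm_congr_ae ht)

theorem MemL2H10.congr {Ω : Set R3} {T : ℝ} {u v : ℝ → R3 → R3} {Du Dv : ℝ → R3 → R3 →L[ℝ] R3}
    (h : MemL2H10 Ω T u Du) (hu : Function.uncurry u =ᵐ[cylMeasure Ω T] Function.uncurry v)
    (hDu : Function.uncurry Du =ᵐ[cylMeasure Ω T] Function.uncurry Dv) : MemL2H10 Ω T v Dv := by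
  refine ⟨h.1.ae_eq hu, h.2.1.ae_eq hDu, ?_⟩
  filter_upwards [h.2.2, ae_ae_of_ae_cylMeasure hu, ae_ae_of_ae_cylMeasure hDu] with t h1 h2 h3
  exact h1.congr_ae h2 h3

theorem IsFluxSolution.congr {Ω : Set R3} {T : ℝ} {f₀ g₀ : R3 → ℝ} {f g : ℝ → R3 → ℝ}
    {J I : ℝ → R3 → R3} (h : IsFluxSolution Ω T f₀ f J) (h0 : f₀ =ᵐ[volume.restrict Ω] g₀)
    (hf : Function.uncurry f =ᵐ[cylMeasure Ω T] Function.uncurry g)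
    (hJ : Function.uncurry J =ᵐ[cylMeasure Ω T] Function.uncurry I) :
    IsFluxSolution Ω T g₀ g I := by
  intro θ w h1 h2 h3 h4 h5
  refine Eq.trans ?_ (h θ w h1 h2 h3 h4 h5)
  congr 1
  · refine integral_congr_ae ?_
    filter_upwards [hf, hJ] with z e1 e2
    simp only [Function.uncurry] at e1 e2
    simp only [e1, e2]
  · congr 1
    refine integral_congr_ae ?_
    filter_upwards [h0] with x e1
    simp only [e1]

theorem IsFluxSolution.add {Ω : Set R3} {T : ℝ} {f₀ g₀ : R3 → ℝ} {f g : ℝ → R3 → ℝ}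
    {J I : ℝ → R3 → R3} (h : IsFluxSolution Ω T f₀ f J) (h' : IsFluxSolution Ω T g₀ g I)
    (hf₀ : IntegrableOn f₀ Ω) (hg₀ : IntegrableOn g₀ Ω)
    (hf : Integrable (Function.uncurry f) (cylMeasure Ω T))
    (hg : Integrable (Function.uncurry g) (cylMeasure Ω T))
    (hJ : Integrable (Function.uncurry J) (cylMeasure Ω T))
    (hI : Integrable (Function.uncurry I) (cylMeasure Ω T)) :
    IsFluxSolution Ω T (fun x => f₀ x + g₀ x) (fun t x => f t x + g t x)
      (fun t x => J t x + I t x) := by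
  intro θ w hθ hθc hθT hw hwc
  obtain ⟨cw, hcw⟩ := hw.continuous.bounded_above_of_compact_support hwc
  have hw' : Continuous (fderiv ℝ w) := hw.continuous_fderiv (by simp)
  obtain ⟨cD, hcD⟩ := hw'.bounded_above_of_compact_support (hwc.fderiv ℝ)
  obtain ⟨cθ, hcθ⟩ := hθ.continuous.bounded_above_of_compact_support hθc
  have hθ' : Continuous (deriv θ) := hθ.continuous_deriv (by simp)
  obtain ⟨cθ', hcθ'⟩ := hθ'.bounded_above_of_compact_support hθc.deriv
  have i0 : ∀ {k : R3 → ℝ}, IntegrableOn k Ω → Integrable (fun x => k x * w x)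
      (volume.restrict Ω) := fun hk =>
    hk.mul_bdd hw.continuous.aestronglyMeasurable (Eventually.of_forall hcw)
  have i1 : ∀ {k : ℝ → R3 → ℝ} {L : ℝ → R3 → R3},
      Integrable (Function.uncurry k) (cylMeasure Ω T) →
      Integrable (Function.uncurry L) (cylMeasure Ω T) →
      Integrable (fun z : ℝ × R3 => deriv θ z.1 * (w z.2 * k z.1 z.2)
        + θ z.1 * fderiv ℝ w z.2 (L z.1 z.2)) (cylMeasure Ω T) := by
    intro k L hk hL
    refine ((hk.bdd_mul (c := cw) (hw.continuous.comp continuous_snd).aestronglyMeasurable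
      (Eventually.of_forall fun z => hcw z.2)).bdd_mul (c := cθ')
      (hθ'.comp continuous_fst).aestronglyMeasurable
      (Eventually.of_forall fun z => hcθ' z.1)).add ?_
    refine Integrable.bdd_mul (c := cθ) ?_ (hθ.continuous.comp continuous_fst).aestronglyMeasurable
      (Eventually.of_forall fun z => hcθ z.1)
    refine (hL.norm.const_mul cD).mono' ?_ (Eventually.of_forall fun z => ?_)
    · exact (isBoundedBilinearMap_apply (𝕜 := ℝ) (E := R3)
        (F := ℝ)).continuous.comp_aestronglyMeasurable
        ((hw'.comp continuous_snd).aestronglyMeasurable.prodMk hL.aestronglyMeasurable)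
    · exact (ContinuousLinearMap.le_opNorm _ _).trans
        (mul_le_mul_of_nonneg_right (hcD z.2) (norm_nonneg _))
  have e1 := h θ w hθ hθc hθT hw hwc
  have e2 := h' θ w hθ hθc hθT hw hwc
  have e3 := integral_add (i1 hf hJ) (i1 hg hI)
  have e4 := integral_add (i0 hf₀) (i0 hg₀)
  have e5 : ∫ z, (deriv θ z.1 * (w z.2 * (f z.1 z.2 + g z.1 z.2))
      + θ z.1 * fderiv ℝ w z.2 (J z.1 z.2 + I z.1 z.2)) ∂(cylMeasure Ω T)
      = (∫ z, (deriv θ z.1 * (w z.2 * f z.1 z.2) + θ z.1 * fderiv ℝ w z.2 (J z.1 z.2))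
          ∂(cylMeasure Ω T))
        + ∫ z, (deriv θ z.1 * (w z.2 * g z.1 z.2) + θ z.1 * fderiv ℝ w z.2 (I z.1 z.2))
          ∂(cylMeasure Ω T) := by
    refine Eq.trans (integral_congr_ae (Eventually.of_forall fun z => ?_)) e3
    simp only [map_add]
    ring
  have e6 : ∫ x in Ω, (f₀ x + g₀ x) * w x
      = (∫ x in Ω, f₀ x * w x) + ∫ x in Ω, g₀ x * w x := by
    refine Eq.trans (integral_congr_ae (Eventually.of_forall fun x => ?_)) e4
    simp only
    ring
  simp only
  rw [e5, e6]
  linear_combination e1 + e2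

theorem TransportData.integral_quotient_le {Ω : Set R3} {T : ℝ} {b d : ℝ → R3 → ℝ}
    {u : ℝ → R3 → R3} {Du : ℝ → R3 → R3 →L[ℝ] R3} (h : TransportData Ω T b d u Du) (hT : 0 < T)
    {b₀ d₀ : R3 → ℝ} (hb₀m : Measurable b₀) (hd₀m : Measurable d₀)
    (hb₀z : ∀ x, x ∉ Ω → b₀ x = 0) (hd₀z : ∀ x, x ∉ Ω → d₀ x = 0) (hb₀i : Integrable b₀)
    (hd₀i : Integrable d₀) (hb₀ : ∀ x, 0 ≤ b₀ x) (hbd₀ : ∀ x, b₀ x ≤ d₀ x)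
    (hbsol : IsFluxSolution Ω T b₀ b (fun t x => b t x • u t x))
    (hdsol : IsFluxSolution Ω T d₀ d (fun t x => d t x • u t x)) :
    T * ∫ x in Ω, b₀ x ^ 2 / d₀ x ≤ ∫ z, b z.1 z.2 ^ 2 / d z.1 z.2 ∂(cylMeasure Ω T) := by
  have key := h.quotient_bound hT hb₀m hd₀m hb₀z hd₀z hb₀i hd₀i hb₀ hbd₀ hbsol hdsol
  have m : Measurable (Function.uncurry fun t x => b t x ^ 2 / d t x) :=
    (h.meas_b.pow_const 2).div h.meas_d
  rw [lintegral_eq h.isOpen m fun t x hx => by simp [h.b_zero t x hx]] at key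
  have frac : ∀ {p q : ℝ}, 0 ≤ p → p ≤ q → 0 ≤ p ^ 2 / q ∧ p ^ 2 / q ≤ p := fun {p q} h1 h2 => by
    refine ⟨div_nonneg (sq_nonneg _) (h1.trans h2), div_le_of_le_mul₀ (h1.trans h2) h1 ?_⟩
    rw [sq]
    exact mul_le_mul_of_nonneg_left h2 h1
  have i1 : Integrable (fun z : ℝ × R3 => b z.1 z.2 ^ 2 / d z.1 z.2) (cylMeasure Ω T) :=
    h.integrable_b.mono m.aestronglyMeasurable (Eventually.of_forall fun z => by
      have := frac (h.b_nonneg z.1 z.2) (h.b_le z.1 z.2)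
      simp only [Function.uncurry]
      rw [Real.norm_of_nonneg this.1, Real.norm_of_nonneg (h.b_nonneg z.1 z.2)]
      exact this.2)
  have i2 : Integrable fun x => b₀ x ^ 2 / d₀ x :=
    hb₀i.mono ((hb₀m.pow_const 2).div hd₀m).aestronglyMeasurable (Eventually.of_forall fun x => by
      have := frac (hb₀ x) (hbd₀ x)
      rw [Real.norm_of_nonneg this.1, Real.norm_of_nonneg (hb₀ x)]
      exact this.2)
  rw [← ofReal_integral_norm_eq_lintegral_enorm i1, ← ofReal_integral_norm_eq_lintegral_enorm i2,
    ← ENNReal.ofReal_mul hT.le, ENNReal.ofReal_le_ofReal_iff (by positivity)] at key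
  have e1 : ∫ z, ‖b z.1 z.2 ^ 2 / d z.1 z.2‖ ∂(cylMeasure Ω T)
      = ∫ z, b z.1 z.2 ^ 2 / d z.1 z.2 ∂(cylMeasure Ω T) :=
    integral_congr_ae (Eventually.of_forall fun z =>
      Real.norm_of_nonneg (frac (h.b_nonneg z.1 z.2) (h.b_le z.1 z.2)).1)
  have e2 : ∫ x, ‖b₀ x ^ 2 / d₀ x‖ = ∫ x in Ω, b₀ x ^ 2 / d₀ x := by
    rw [integral_restrict_of_support fun x hx => by simp [hb₀z x hx]]
    exact integral_congr_ae (Eventually.of_forall fun x =>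
      Real.norm_of_nonneg (frac (hb₀ x) (hbd₀ x)).1)
  rwa [e1, e2] at key

/-! ### Convergence of the fractions -/

section Fractions

variable {α : Type*} [MeasurableSpace α] {μ : Measure α}

/-- If the integrals of `b_K²/d_K` do not exceed that of `b²/d` in the limit, then the fractions
converge. -/
theorem tendsto_integral_mul_sq_sub [IsFiniteMeasure μ] {b d a : ℕ → α → ℝ} {b' d' a' : α → ℝ}
    {I : ℝ} (hb : ∀ k, MemLp (b k) 2 μ) (hd : ∀ k, MemLp (d k) 2 μ) (hd0 : ∀ k, ∀ᵐ z ∂μ, 0 ≤ d k z)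
    (hbw : WeaklyTendsto μ b b') (hdw : WeaklyTendsto μ d d')
    (ham : ∀ k, AEStronglyMeasurable (a k) μ)
    (ha : ∀ k, ∀ᵐ z ∂μ, 0 ≤ a k z ∧ a k z ≤ 1 ∧ a k z * d k z = b k z)
    (ham' : AEStronglyMeasurable a' μ)
    (ha' : ∀ᵐ z ∂μ, 0 ≤ a' z ∧ a' z ≤ 1 ∧ a' z * d' z = b' z)
    (hI : ∀ k, ∫ z, b k z ^ 2 / d k z ∂μ ≤ I) (hI' : I ≤ ∫ z, b' z ^ 2 / d' z ∂μ) :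
    Tendsto (fun k => ∫ z, d k z * (a k z - a' z) ^ 2 ∂μ) atTop (𝓝 0) := by
  -- Where `q = 0` also `p = 0`, and both sides vanish by the convention for division by zero.
  have eq : ∀ {p q r : ℝ}, r * q = p → p ^ 2 / q = p * r := fun {p q r} h => by
    rcases eq_or_ne q 0 with h0 | h0
    · rw [← h, h0]; simp
    · rw [← h]; field_simp
  have m1 : MemLp a' 2 μ := MemLp.of_bound ham' 1 (ha'.mono fun z hz => by
    rw [Real.norm_of_nonneg hz.1]; exact hz.2.1)
  have m2 : MemLp (fun z => a' z ^ 2) 2 μ := MemLp.of_bound (ham'.pow 2) 1 (ha'.mono fun z hz => by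
    rw [Real.norm_of_nonneg (sq_nonneg _)]; exact pow_le_one₀ hz.1 hz.2.1)
  have m3 : ∀ k, MemLp (a k) 2 μ := fun k => MemLp.of_bound (ham k) 1 ((ha k).mono fun z hz => by
    rw [Real.norm_of_nonneg hz.1]; exact hz.2.1)
  have j1 : ∀ k, Integrable (fun z => b k z * a' z) μ := fun k =>
    memLp_one_iff_integrable.1 (m1.mul (hb k))
  have j2 : ∀ k, Integrable (fun z => d k z * a' z ^ 2) μ := fun k =>
    memLp_one_iff_integrable.1 (m2.mul (hd k))
  have j3 : ∀ k, Integrable (fun z => b k z * a k z) μ := fun k =>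
    memLp_one_iff_integrable.1 ((m3 k).mul (hb k))
  -- Expansion of the square with `d a = b` and `d a² = b²/d`; only the first term is nonlinear in
  -- the sequence.
  have e1 : ∀ k, ∫ z, d k z * (a k z - a' z) ^ 2 ∂μ
      = (∫ z, b k z ^ 2 / d k z ∂μ) - 2 * (∫ z, b k z * a' z ∂μ) + ∫ z, d k z * a' z ^ 2 ∂μ := by
    intro k
    have j4 : Integrable (fun z => b k z * a k z - 2 * (b k z * a' z)) μ :=
      (j3 k).sub ((j1 k).const_mul 2)
    have e2 : ∫ z, b k z ^ 2 / d k z ∂μ = ∫ z, b k z * a k z ∂μ :=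
      integral_congr_ae ((ha k).mono fun z hz => eq hz.2.2)
    rw [e2, ← integral_const_mul, ← integral_sub (j3 k) ((j1 k).const_mul 2),
      ← integral_add j4 (j2 k)]
    refine integral_congr_ae ((ha k).mono fun z hz => ?_)
    simp only
    rw [← hz.2.2]
    ring
  have lim := ((tendsto_const_nhds (x := I)).sub ((hbw.tendsto_mul m1).const_mul 2)).add
    (hdw.tendsto_mul m2)
  have e3 : ∫ z, d' z * a' z ^ 2 ∂μ = ∫ z, b' z * a' z ∂μ :=
    integral_congr_ae (ha'.mono fun z hz => by simp only; rw [← hz.2.2]; ring)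
  have e4 : ∫ z, b' z ^ 2 / d' z ∂μ = ∫ z, b' z * a' z ∂μ :=
    integral_congr_ae (ha'.mono fun z hz => eq hz.2.2)
  have hnn : ∀ k, 0 ≤ ∫ z, d k z * (a k z - a' z) ^ 2 ∂μ := fun k =>
    integral_nonneg_of_ae ((hd0 k).mono fun z hz => mul_nonneg hz (sq_nonneg _))
  have hle : ∀ k, ∫ z, d k z * (a k z - a' z) ^ 2 ∂μ
      ≤ I - 2 * (∫ z, b k z * a' z ∂μ) + ∫ z, d k z * a' z ^ 2 ∂μ := fun k => by
    rw [e1 k]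
    linarith [hI k]
  have hL := ge_of_tendsto' lim fun k => (hnn k).trans (hle k)
  -- The limit of the upper bounds is `I - ∫ b'²/d'`: nonnegative as a limit of bounds on
  -- nonnegative integrals, and nonpositive by `hI'`.
  have hL0 : I - 2 * (∫ z, b' z * a' z ∂μ) + ∫ z, d' z * a' z ^ 2 ∂μ = 0 := by
    refine le_antisymm ?_ hL
    rw [e3]
    rw [e4] at hI'
    linarith
  rw [hL0] at lim
  exact tendsto_of_tendsto_of_tendsto_of_le_of_le tendsto_const_nhds lim hnn hle

/-- Split at `x = e`: below it `x ^ s ≤ x ≤ e`, above it `x ^ s ≤ 1 ≤ (x/e)²`. This covers exponents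
between `1` and `2` as well. -/
theorem rpow_le_add_sq_div {x e s : ℝ} (hx : 0 ≤ x) (hx1 : x ≤ 1) (he : 0 < e)
    (hs : 1 < s) : x ^ s ≤ e + e⁻¹ ^ 2 * x ^ 2 := by
  rcases le_or_gt x e with h | h
  · have h1 : x ^ s ≤ x := by
      calc x ^ s ≤ x ^ (1 : ℝ) := Real.rpow_le_rpow_of_exponent_ge' hx hx1 zero_le_one hs.le
        _ = x := Real.rpow_one x
    have h2 : 0 ≤ e⁻¹ ^ 2 * x ^ 2 := by positivity
    linarith
  · have h1 : x ^ s ≤ 1 := Real.rpow_le_one hx hx1 (by linarith)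
    have h2 : 1 ≤ e⁻¹ ^ 2 * x ^ 2 := by
      rw [← mul_pow]
      refine one_le_pow₀ ?_
      rw [← div_eq_inv_mul, one_le_div he]
      exact h.le
    linarith

theorem tendsto_integral_mul_rpow_sub {d a : ℕ → α → ℝ} {a' : α → ℝ} {M : ℝ}
    (hd : ∀ k, Integrable (d k) μ) (hd0 : ∀ k, ∀ᵐ z ∂μ, 0 ≤ d k z) (hM : ∀ k, ∫ z, d k z ∂μ ≤ M)
    (ham : ∀ k, AEStronglyMeasurable (a k) μ) (ha : ∀ k, ∀ᵐ z ∂μ, 0 ≤ a k z ∧ a k z ≤ 1)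
    (ham' : AEStronglyMeasurable a' μ) (ha' : ∀ᵐ z ∂μ, 0 ≤ a' z ∧ a' z ≤ 1)
    (h : Tendsto (fun k => ∫ z, d k z * (a k z - a' z) ^ 2 ∂μ) atTop (𝓝 0)) {s : ℝ} (hs : 1 < s) :
    Tendsto (fun k => ∫ z, d k z * |a k z - a' z| ^ s ∂μ) atTop (𝓝 0) := by
  have hx : ∀ k, ∀ᵐ z ∂μ, |a k z - a' z| ≤ 1 := fun k => by
    filter_upwards [ha k, ha'] with z h1 h2
    rw [abs_le]
    constructor <;> linarith [h1.1, h1.2, h2.1, h2.2]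
  have hi2 : ∀ k, Integrable (fun z => d k z * (a k z - a' z) ^ 2) μ := fun k =>
    (hd k).mul_bdd (c := 1) (((ham k).sub ham').pow 2) ((hx k).mono fun z hz => by
      rw [norm_pow]; exact pow_le_one₀ (norm_nonneg _) hz)
  have hnn : ∀ k, 0 ≤ ∫ z, d k z * |a k z - a' z| ^ s ∂μ := fun k =>
    integral_nonneg_of_ae ((hd0 k).mono fun z hz => mul_nonneg hz (by positivity))
  have hle : ∀ e : ℝ, 0 < e → ∀ k, ∫ z, d k z * |a k z - a' z| ^ s ∂μ
      ≤ e * M + e⁻¹ ^ 2 * ∫ z, d k z * (a k z - a' z) ^ 2 ∂μ := by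
    intro e he k
    have i1 : Integrable (fun z => e * d k z + e⁻¹ ^ 2 * (d k z * (a k z - a' z) ^ 2)) μ :=
      ((hd k).const_mul e).add ((hi2 k).const_mul _)
    calc _ ≤ ∫ z, (e * d k z + e⁻¹ ^ 2 * (d k z * (a k z - a' z) ^ 2)) ∂μ := by
          refine integral_mono_of_nonneg ((hd0 k).mono fun z hz => mul_nonneg hz (by positivity))
            i1 ?_
          filter_upwards [hd0 k, hx k] with z h1 h2
          have := mul_le_mul_of_nonneg_left
            (rpow_le_add_sq_div (abs_nonneg (a k z - a' z)) h2 he hs) h1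
          rw [sq_abs] at this
          linarith
      _ = e * (∫ z, d k z ∂μ) + e⁻¹ ^ 2 * ∫ z, d k z * (a k z - a' z) ^ 2 ∂μ := by
          rw [integral_add ((hd k).const_mul e) ((hi2 k).const_mul _), integral_const_mul,
            integral_const_mul]
      _ ≤ _ := by gcongr; exact hM k
  have hM0 : 0 ≤ M := (integral_nonneg_of_ae (hd0 0)).trans (hM 0)
  rw [Metric.tendsto_atTop]
  intro η hη
  -- Chosen so that `e M ≤ η / 2`; `M + 1` avoids division by zero.
  set e := min 1 (η / (2 * (M + 1))) with he
  have he0 : 0 < e := lt_min one_pos (by positivity)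
  have h1 := h.const_mul (e⁻¹ ^ 2)
  rw [mul_zero] at h1
  obtain ⟨N, hN⟩ := Metric.tendsto_atTop.1 h1 (η / 2) (by positivity)
  refine ⟨N, fun k hk => ?_⟩
  have h2 := hN k hk
  rw [Real.dist_eq, sub_zero] at h2 ⊢
  rw [abs_of_nonneg (hnn k)]
  have h3 := hle e he0 k
  have h4 : e * M ≤ η / 2 := by
    have : e ≤ η / (2 * (M + 1)) := min_le_right _ _
    calc e * M ≤ η / (2 * (M + 1)) * (M + 1) := by gcongr; linarith
      _ = η / 2 := by field_simp
  linarith [le_abs_self (e⁻¹ ^ 2 * ∫ z, d k z * (a k z - a' z) ^ 2 ∂μ)]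

end Fractions

/-- If `a` is a fraction of `d - b`, then `1 - a` is one of `b`, and `|(1 - a_K) - (1 - a)| = |a_K -
a|`. -/
theorem FractionsConverge.compl {Ω : Set R3} {T : ℝ} {b c d : ℕ → ℝ → R3 → ℝ}
    {b' c' d' : ℝ → R3 → ℝ} (h : FractionsConverge Ω T b d b' d')
    (hc : ∀ K t x, c K t x = d K t x - b K t x) (hc' : ∀ t x, c' t x = d' t x - b' t x) :
    FractionsConverge Ω T c d c' d' := by
  have flip : ∀ {p q r a : ℝ → R3 → ℝ}, (∀ t x, q t x = r t x - p t x) → IsFraction Ω T q r a →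
      IsFraction Ω T p r fun t x => 1 - a t x := fun {p q r a} hq ha => by
    refine ⟨aestronglyMeasurable_const.sub ha.1, ha.2.mono fun z hz => ⟨by linarith [hz.2.1],
      by linarith [hz.1], ?_⟩⟩
    have := hz.2.2
    rw [hq] at this
    linarith
  intro a a' ha ha' s hs
  have := h _ _ (fun K => flip (hc K) (ha K)) (flip hc' ha') s hs
  refine this.congr fun K => ?_
  refine integral_congr_ae (Eventually.of_forall fun z => ?_)
  simp only [sub_sub_sub_cancel_left]
  rw [abs_sub_comm]

theorem integral_quotient_cylMeasure_le {Ω : Set R3} (hΩb : Bornology.IsBounded Ω) {T : ℝ}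
    (hT : 0 < T) {b d : ℝ → R3 → ℝ} {b₀ d₀ : R3 → ℝ}
    (hb : MemLp (Function.uncurry b) 2 (cylMeasure Ω T))
    (hd : MemLp (Function.uncurry d) 2 (cylMeasure Ω T))
    (h0 : ∀ᵐ z ∂(cylMeasure Ω T), 0 ≤ b z.1 z.2 ∧ b z.1 z.2 ≤ d z.1 z.2)
    (hq : QuotientBound Ω T b d b₀ d₀) :
    ∫ z, b z.1 z.2 ^ 2 / d z.1 z.2 ∂(cylMeasure Ω T) ≤ T * ∫ x in Ω, b₀ x ^ 2 / d₀ x := by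
  have := isFiniteMeasure_cylMeasure hΩb T
  have m : AEStronglyMeasurable (fun z : ℝ × R3 => b z.1 z.2 ^ 2 / d z.1 z.2) (cylMeasure Ω T) :=
    ((hb.1.aemeasurable.pow_const 2).div hd.1.aemeasurable).aestronglyMeasurable
  have i : Integrable (fun z : ℝ × R3 => b z.1 z.2 ^ 2 / d z.1 z.2) (cylMeasure Ω T) := by
    refine (hb.integrable (by norm_num)).mono m (h0.mono fun z hz => ?_)
    simp only [Function.uncurry]
    rw [Real.norm_of_nonneg (div_nonneg (sq_nonneg _) (hz.1.trans hz.2)),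
      Real.norm_of_nonneg hz.1]
    refine div_le_of_le_mul₀ (hz.1.trans hz.2) hz.1 ?_
    rw [sq]
    exact mul_le_mul_of_nonneg_left hz.2 hz.1
  rw [cylMeasure_eq_prod] at i ⊢
  rw [integral_prod _ i]
  refine (integral_mono_ae i.integral_prod_left (integrable_const _) hq).trans (le_of_eq ?_)
  rw [integral_const]
  simp [timeMeasure, hT.le]

/-- Convergence of the fractions from the entropy inequality along the sequence and the transport
equation in the limit. -/
theorem TransportData.fractionsConverge {Ω : Set R3} {T : ℝ} {b d : ℝ → R3 → ℝ}
    {u : ℝ → R3 → R3} {Du : ℝ → R3 → R3 →L[ℝ] R3} (h : TransportData Ω T b d u Du) (hT : 0 < T)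
    {b₀ d₀ : R3 → ℝ} (hb₀m : Measurable b₀) (hd₀m : Measurable d₀)
    (hb₀z : ∀ x, x ∉ Ω → b₀ x = 0) (hd₀z : ∀ x, x ∉ Ω → d₀ x = 0) (hb₀i : Integrable b₀)
    (hd₀i : Integrable d₀) (hb₀ : ∀ x, 0 ≤ b₀ x) (hbd₀ : ∀ x, b₀ x ≤ d₀ x)
    (hbsol : IsFluxSolution Ω T b₀ b (fun t x => b t x • u t x))
    (hdsol : IsFluxSolution Ω T d₀ d (fun t x => d t x • u t x)) {bK dK : ℕ → ℝ → R3 → ℝ}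
    (hbK : ∀ K, MemLp (Function.uncurry (bK K)) 2 (cylMeasure Ω T))
    (hdK : ∀ K, MemLp (Function.uncurry (dK K)) 2 (cylMeasure Ω T))
    (h0 : ∀ K, ∀ᵐ z ∂(cylMeasure Ω T), 0 ≤ bK K z.1 z.2 ∧ bK K z.1 z.2 ≤ dK K z.1 z.2)
    (hbw : WeaklyTendsto (cylMeasure Ω T) (fun K => Function.uncurry (bK K)) (Function.uncurry b))
    (hdw : WeaklyTendsto (cylMeasure Ω T) (fun K => Function.uncurry (dK K)) (Function.uncurry d))
    (hq : ∀ K, QuotientBound Ω T (bK K) (dK K) b₀ d₀) : FractionsConverge Ω T bK dK b d := by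
  have := isFiniteMeasure_cylMeasure h.isBounded T
  intro a a' ha ha' s hs
  have hd0 : ∀ K, ∀ᵐ z ∂(cylMeasure Ω T), 0 ≤ Function.uncurry (dK K) z := fun K =>
    (h0 K).mono fun z hz => hz.1.trans hz.2
  have h2 := tendsto_integral_mul_sq_sub (μ := cylMeasure Ω T)
    (a := fun K => Function.uncurry (a K)) (a' := Function.uncurry a')
    hbK hdK hd0 hbw hdw (fun K => (ha K).1)
    (fun K => (ha K).2) ha'.1 ha'.2
    (fun K => integral_quotient_cylMeasure_le h.isBounded hT (hbK K) (hdK K) (h0 K) (hq K))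
    (h.integral_quotient_le hT hb₀m hd₀m hb₀z hd₀z hb₀i hd₀i hb₀ hbd₀ hbsol hdsol)
  -- The masses converge, by weak convergence tested with one, so they are bounded.
  obtain ⟨M, hM⟩ := (hdw.tendsto_mul (memLp_const (1 : ℝ))).bddAbove_range
  exact tendsto_integral_mul_rpow_sub (μ := cylMeasure Ω T) (M := M)
    (fun K => (hdK K).integrable (by norm_num)) hd0
    (fun K => by simpa using hM (mem_range_self K)) (fun K => (ha K).1)
    (fun K => (ha K).2.mono fun z hz => ⟨hz.1, hz.2.1⟩) ha'.1
    (ha'.2.mono fun z hz => ⟨hz.1, hz.2.1⟩) h2 hs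

/-! ### Assembly -/

theorem MemL2H10.exists_boundedVelocity {Ω : Set R3} (hΩ : IsOpen Ω) {T : ℝ} {u : ℝ → R3 → R3}
    {Du : ℝ → R3 → R3 →L[ℝ] R3} {B : ENNReal} (h : MemL2H10 Ω T u Du)
    (hu : eLpNorm (Function.uncurry u) 2 (cylMeasure Ω T) ≤ B)
    (hDu : eLpNorm (Function.uncurry Du) 2 (cylMeasure Ω T) ≤ B) :
    ∃ v Dv, BoundedVelocity Ω T v Dv B ∧ Measurable (Function.uncurry Dv) ∧
      (∀ t x, x ∉ Ω → Dv t x = 0) ∧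
      Function.uncurry u =ᵐ[cylMeasure Ω T] Function.uncurry v ∧
      Function.uncurry Du =ᵐ[cylMeasure Ω T] Function.uncurry Dv := by
  obtain ⟨v, m, z, e⟩ := exists_measurable_rep hΩ h.1.1
  obtain ⟨Dv, mD, zD, eD⟩ := exists_measurable_rep hΩ h.2.1.1
  exact ⟨v, Dv, ⟨m, z, h.congr e eD, (eLpNorm_congr_ae e).symm.trans_le hu,
    (eLpNorm_congr_ae eD).symm.trans_le hDu⟩, mD, zD, e, eD⟩

theorem exists_boundedDensity {Ω : Set R3} (hΩ : IsOpen Ω) {T : ℝ} {f : ℝ → R3 → ℝ} {C : ENNReal}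
    (hf : AEStronglyMeasurable (Function.uncurry f) (cylMeasure Ω T))
    (hC : normLinfL2 Ω T f ≤ C) (h0 : ∀ᵐ z ∂(cylMeasure Ω T), 0 ≤ f z.1 z.2) :
    ∃ g, BoundedDensity Ω T g C ∧ (∀ t x, 0 ≤ g t x) ∧
      Function.uncurry f =ᵐ[cylMeasure Ω T] Function.uncurry g := by
  obtain ⟨g, m, z, e⟩ := exists_measurable_rep hΩ hf
  have e' : Function.uncurry f =ᵐ[cylMeasure Ω T] Function.uncurry fun t x => max (g t x) 0 := by
    filter_upwards [e, h0] with z h1 h2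
    simp only [Function.uncurry] at h1 ⊢
    rw [← h1, max_eq_left h2]
  exact ⟨_, ⟨m.max measurable_const, fun t x hx => by simp [z t x hx],
    (normLinfL2_congr e').symm.trans_le hC⟩, fun t x => le_max_right _ _, e'⟩

theorem exists_boundedDensity_limit {Ω : Set R3} (hΩ : IsOpen Ω) {T : ℝ} {f : ℕ → ℝ → R3 → ℝ}
    {C : ENNReal} (hCt : C ≠ ⊤)
    (hf : ∀ K, AEStronglyMeasurable (Function.uncurry (f K)) (cylMeasure Ω T))
    (hC : ∀ K, normLinfL2 Ω T (f K) ≤ C)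
    (h0 : ∀ K, ∀ᵐ z ∂(cylMeasure Ω T), 0 ≤ f K z.1 z.2) :
    ∃ (σ : ℕ → ℕ) (g : ℝ → R3 → ℝ), StrictMono σ ∧ BoundedDensity Ω T g C ∧
      (∀ t x, 0 ≤ g t x) ∧
      WeaklyTendsto (cylMeasure Ω T) (fun K => Function.uncurry (f (σ K)))
        (Function.uncurry g) := by
  have hm : ∀ K, MemLp (Function.uncurry (f K)) 2 (cylMeasure Ω T) := fun K =>
    memLp_of_normLinfL2_le (hf K) hCt (hC K)
  have hb : ∀ K, eLpNorm (Function.uncurry (f K)) 2 (cylMeasure Ω T)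
      ≤ C * ENNReal.ofReal √T := fun K => by
    refine (ENNReal.pow_right_strictMono two_ne_zero).le_iff_le.1 ?_
    refine (eLpNorm_le_of_normLinfL2_le (hf K) (hC K)).trans ?_
    rw [mul_pow, ← ENNReal.ofReal_pow (Real.sqrt_nonneg _)]
    gcongr
    rcases le_total 0 T with h | h
    · rw [Real.sq_sqrt h]
    · exact h.trans (sq_nonneg _)
  obtain ⟨σ, g, hσ, hg, hw⟩ := exists_weaklyTendsto hm
    (ENNReal.mul_ne_top hCt ENNReal.ofReal_ne_top) hb
  have hg' : MemLp (Function.uncurry fun t x => g (t, x)) 2 (cylMeasure Ω T) := hg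
  have hw' : WeaklyTendsto (cylMeasure Ω T) (fun K => Function.uncurry (f (σ K)))
    (Function.uncurry fun t x => g (t, x)) := hw
  obtain ⟨k, hk, hk0, e⟩ := exists_boundedDensity hΩ hg'.1
    (normLinfL2_le_of_weaklyTendsto hw' (fun K => hm _) hg' fun K => hC _)
    (ae_nonneg_of_weaklyTendsto hw' (fun K => hm _) hg' fun K => h0 _)
  exact ⟨σ, k, hσ, hk, hk0, hw'.congr (fun _ => EventuallyEq.rfl) e⟩

theorem exists_boundedVelocity_limit {Ω : Set R3} (hΩ : IsOpen Ω) {T : ℝ}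
    {u : ℕ → ℝ → R3 → R3} {Du : ℕ → ℝ → R3 → R3 →L[ℝ] R3} {C : ENNReal} (hC : C ≠ ⊤)
    (hu : ∀ K, MemL2H10 Ω T (u K) (Du K))
    (hub : ∀ K, eLpNorm (Function.uncurry (u K)) 2 (cylMeasure Ω T) ≤ C)
    (hDub : ∀ K, eLpNorm (Function.uncurry (Du K)) 2 (cylMeasure Ω T) ≤ C) :
    ∃ (σ : ℕ → ℕ) (v : ℝ → R3 → R3) (Dv : ℝ → R3 → R3 →L[ℝ] R3) (B : ENNReal), StrictMono σ ∧
      B ≠ ⊤ ∧ BoundedVelocity Ω T v Dv B ∧ Measurable (Function.uncurry Dv) ∧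
      (∀ t x, x ∉ Ω → Dv t x = 0) ∧
      WeaklyTendsto (cylMeasure Ω T) (fun K => Function.uncurry (u (σ K))) (Function.uncurry v) ∧
      WeaklyTendsto (cylMeasure Ω T) (fun K => Function.uncurry (Du (σ K)))
        (Function.uncurry Dv) := by
  obtain ⟨σ, v, Dv, hσ, hv, hw, hDw⟩ := exists_weakly_convergent_subseq_of_memL2H10 hC hu hub hDub
  obtain ⟨v', Dv', h1, h2, h3, e, eD⟩ := hv.exists_boundedVelocity hΩ
    (le_max_left _ (eLpNorm (Function.uncurry Dv) 2 (cylMeasure Ω T))) (le_max_right _ _)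
  exact ⟨σ, v', Dv', _, hσ, (max_lt hv.1.2 hv.2.1.2).ne, h1, h2, h3,
    hw.congr (fun _ => EventuallyEq.rfl) e, hDw.congr (fun _ => EventuallyEq.rfl) eD⟩

theorem BoundedVelocity.mono {Ω : Set R3} {T : ℝ} {u : ℝ → R3 → R3}
    {Du : ℝ → R3 → R3 →L[ℝ] R3} {B B' : ENNReal} (h : BoundedVelocity Ω T u Du B) (hB : B ≤ B') :
    BoundedVelocity Ω T u Du B' :=
  { h with
    norm_le := h.norm_le.trans hB
    norm_deriv_le := h.norm_deriv_le.trans hB }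

/-- Weak solutions with vanishing viscosity converge to weak solutions of the transport
equation. -/
theorem isFluxSolution_of_vanishing_viscosity {Ω : Set R3} (hΩ : IsOpen Ω)
    (hΩb : Bornology.IsBounded Ω) {T : ℝ} (hT : 0 < T) {C B : ENNReal} (hC : C ≠ ⊤) (hB : B ≠ ⊤)
    {ν : ℕ → ℝ} (hν : ∀ K, 0 ≤ ν K) (hν0 : Tendsto ν atTop (𝓝 0)) {f₀ g₀ : R3 → ℝ}
    (hfg₀ : f₀ =ᵐ[volume.restrict Ω] g₀) {f : ℕ → ℝ → R3 → ℝ} {Df : ℕ → ℝ → R3 → R3}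
    {u : ℕ → ℝ → R3 → R3} {Du : ℕ → ℝ → R3 → R3 →L[ℝ] R3} {g : ℝ → R3 → ℝ} {v : ℝ → R3 → R3}
    {Dv : ℝ → R3 → R3 →L[ℝ] R3}
    (hf : ∀ K, AEStronglyMeasurable (Function.uncurry (f K)) (cylMeasure Ω T))
    (hfC : ∀ K, normLinfL2 Ω T (f K) ≤ C)
    (hDf : ∀ K, ENNReal.ofReal (Real.sqrt (ν K)) *
      eLpNorm (Function.uncurry (Df K)) 2 (cylMeasure Ω T) ≤ C)
    (hu : ∀ K, MemL2H10 Ω T (u K) (Du K))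
    (hub : ∀ K, eLpNorm (Function.uncurry (u K)) 2 (cylMeasure Ω T) ≤ C)
    (hDub : ∀ K, eLpNorm (Function.uncurry (Du K)) 2 (cylMeasure Ω T) ≤ C)
    (hsol : ∀ K, IsWeakSolution Ω T (ν K) (u K) f₀ (f K) (Df K))
    (hg : BoundedDensity Ω T g C) (hv : BoundedVelocity Ω T v Dv B)
    (hfw : WeaklyTendsto (cylMeasure Ω T) (fun K => Function.uncurry (f K)) (Function.uncurry g))
    (huw : WeaklyTendsto (cylMeasure Ω T) (fun K => Function.uncurry (u K))
      (Function.uncurry v)) : IsFluxSolution Ω T g₀ g (fun t x => g t x • v t x) := by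
  obtain ⟨R, hR⟩ := hν0.sqrt.bddAbove_range
  have hE : ∀ K, AEStronglyMeasurable (Function.uncurry fun t x => ν K • Df K t x)
      (cylMeasure Ω T) := fun K => by
    -- For zero viscosity nothing is known about `Df`, not even measurability, but the flux is then
    -- zero.
    rcases (hν K).eq_or_lt with h | h
    · have : (Function.uncurry fun t x => ν K • Df K t x) = fun _ => 0 := by
        ext1 z; simp [Function.uncurry, ← h]
      rw [this]
      exact aestronglyMeasurable_const
    · exact ((hsol K).1 h).1.const_smul (ν K)
  -- One factor `√ν` is spent on the gradient bound; the other makes the flux tend to zero.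
  have hEle : ∀ K, eLpNorm (Function.uncurry fun t x => ν K • Df K t x) 2 (cylMeasure Ω T)
      ≤ ENNReal.ofReal √(ν K) * C := fun K => by
    have e : eLpNorm (Function.uncurry fun t x => ν K • Df K t x) 2 (cylMeasure Ω T)
        = ENNReal.ofReal √(ν K) * (ENNReal.ofReal √(ν K)
          * eLpNorm (Function.uncurry (Df K)) 2 (cylMeasure Ω T)) := by
      rw [← mul_assoc, ← ENNReal.ofReal_mul (Real.sqrt_nonneg _), Real.mul_self_sqrt (hν K),
        ← Real.enorm_of_nonneg (hν K)]
      exact eLpNorm_const_smul (ν K) (Function.uncurry (Df K)) 2 (cylMeasure Ω T)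
    rw [e]
    exact mul_le_mul' le_rfl (hDf K)
  have hE0 : Tendsto (fun K => eLpNorm (Function.uncurry fun t x => ν K • Df K t x) 2
      (cylMeasure Ω T)) atTop (𝓝 0) := by
    refine tendsto_of_tendsto_of_tendsto_of_le_of_le tendsto_const_nhds ?_ (fun _ => zero_le) hEle
    have := ENNReal.Tendsto.mul_const (ENNReal.tendsto_ofReal hν0.sqrt) (Or.inr hC)
    simpa using this
  set B' := C + ENNReal.ofReal R * C + B with hB'
  have hB't : B' ≠ ⊤ := ENNReal.add_ne_top.2 ⟨ENNReal.add_ne_top.2 ⟨hC, ENNReal.mul_ne_top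
    ENNReal.ofReal_ne_top hC⟩, hB⟩
  have hC' : C ≤ B' := le_self_add.trans le_self_add
  choose f' mf zf ef using fun K => exists_measurable_rep hΩ (hf K)
  choose u' Du' hu' _ _ eu _ using fun K =>
    (hu K).exists_boundedVelocity hΩ ((hub K).trans hC') ((hDub K).trans hC')
  refine IsFluxSolution.of_weaklyTendsto hΩ hΩb hT hC hB't (f := f') (u := u') (Du := Du')
    (E := fun K t x => ν K • Df K t x)
    (fun K => ⟨mf K, zf K, (normLinfL2_congr (ef K)).symm.trans_le (hfC K)⟩) hg hu'
    (hv.mono le_add_self) hE (fun K => (hEle K).trans ?_) hE0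
    (hfw.congr ef EventuallyEq.rfl) (huw.congr eu EventuallyEq.rfl) fun K => ?_
  · refine le_trans ?_ (le_self_add.trans' le_add_self)
    exact mul_le_mul' (ENNReal.ofReal_le_ofReal (hR (mem_range_self K))) le_rfl
  · refine (hsol K).isFluxSolution.congr hfg₀ (ef K) ?_
    filter_upwards [ef K, eu K] with z h1 h2
    simp only [Function.uncurry] at h1 h2 ⊢
    rw [h1, h2]

theorem WeaklyTendsto.add {α E : Type*} [MeasurableSpace α] [NormedAddCommGroup E]
    [NormedSpace ℝ E] {μ : Measure α} {f f' : ℕ → α → E} {g g' : α → E}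
    (h : WeaklyTendsto μ f g) (h' : WeaklyTendsto μ f' g') (hf : ∀ k, MemLp (f k) 2 μ)
    (hf' : ∀ k, MemLp (f' k) 2 μ) (hg : MemLp g 2 μ) (hg' : MemLp g' 2 μ) :
    WeaklyTendsto μ (fun k x => f k x + f' k x) fun x => g x + g' x := by
  intro ψ hψ
  have i : ∀ {k : α → E}, MemLp k 2 μ → Integrable (fun x => ψ x (k x)) μ := fun {k} hk => by
    refine memLp_one_iff_integrable.1 ?_
    exact MemLp.of_bilin (r := 1) (fun (L : E →L[ℝ] ℝ) y => L y) 1 hψ hk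
      ((isBoundedBilinearMap_apply (𝕜 := ℝ) (E := E) (F := ℝ)).continuous.comp_aestronglyMeasurable
        (hψ.1.prodMk hk.1))
      (Eventually.of_forall fun x => by simpa only [one_mul] using (ψ x).le_opNNNorm (k x))
  simp only [map_add]
  rw [integral_add (i hg) (i hg')]
  refine ((h ψ hψ).add (h' ψ hψ)).congr fun k => ?_
  rw [integral_add (i (hf k)) (i (hf' k))]

/-- The equation for the total density is the sum of the two equations, by linearity with a common
velocity; `TransportData.fractionsConverge` then applies to the pair `b'`, `b' + c'`. -/
theorem fractionsConverge_of_quotientBound {Ω : Set R3} (hΩ : IsOpen Ω)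
    (hΩb : Bornology.IsBounded Ω) {T : ℝ} (hT : 0 < T) {C B : ENNReal} (hC : C ≠ ⊤)
    {b c : ℕ → ℝ → R3 → ℝ} {b' c' : ℝ → R3 → ℝ} {b₀ c₀ b₀' c₀' : R3 → ℝ} {v : ℝ → R3 → R3}
    {Dv : ℝ → R3 → R3 →L[ℝ] R3}
    (hb : ∀ K, MemLp (Function.uncurry (b K)) 2 (cylMeasure Ω T))
    (hc : ∀ K, MemLp (Function.uncurry (c K)) 2 (cylMeasure Ω T))
    (hb0 : ∀ K, ∀ᵐ z ∂(cylMeasure Ω T), 0 ≤ b K z.1 z.2)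
    (hc0 : ∀ K, ∀ᵐ z ∂(cylMeasure Ω T), 0 ≤ c K z.1 z.2)
    (hb' : BoundedDensity Ω T b' C) (hc' : BoundedDensity Ω T c' C)
    (hb0' : ∀ t x, 0 ≤ b' t x) (hc0' : ∀ t x, 0 ≤ c' t x) (hv : BoundedVelocity Ω T v Dv B)
    (hDvm : Measurable (Function.uncurry Dv)) (hDvz : ∀ t x, x ∉ Ω → Dv t x = 0)
    (hbw : WeaklyTendsto (cylMeasure Ω T) (fun K => Function.uncurry (b K)) (Function.uncurry b'))
    (hcw : WeaklyTendsto (cylMeasure Ω T) (fun K => Function.uncurry (c K)) (Function.uncurry c'))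
    (hb₀m : Measurable b₀') (hc₀m : Measurable c₀') (hb₀z : ∀ x, x ∉ Ω → b₀' x = 0)
    (hc₀z : ∀ x, x ∉ Ω → c₀' x = 0) (hb₀ : ∀ x, 0 ≤ b₀' x) (hc₀ : ∀ x, 0 ≤ c₀' x)
    (hb₀i : Integrable b₀') (hc₀i : Integrable c₀') (hb₀e : b₀ =ᵐ[volume.restrict Ω] b₀')
    (hc₀e : c₀ =ᵐ[volume.restrict Ω] c₀')
    (hbsol : IsFluxSolution Ω T b₀' b' (fun t x => b' t x • v t x))
    (hcsol : IsFluxSolution Ω T c₀' c' (fun t x => c' t x • v t x))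
    (hq : ∀ K, QuotientBound Ω T (b K) (fun t x => b K t x + c K t x) b₀ fun x => b₀ x + c₀ x) :
    FractionsConverge Ω T b (fun K t x => b K t x + c K t x) b' fun t x => b' t x + c' t x := by
  have := isFiniteMeasure_cylMeasure hΩb T
  have hbm := hb'.memLp hC
  have hcm := hc'.memLp hC
  have hD : TransportData Ω T b' (fun t x => b' t x + c' t x) v Dv :=
    { isOpen := hΩ
      isBounded := hΩb
      meas_b := hb'.meas
      meas_d := hb'.meas.add hc'.meas
      meas_u := hv.meas
      meas_Du := hDvm
      b_zero := hb'.zero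
      d_zero := fun t x hx => by simp [hb'.zero t x hx, hc'.zero t x hx]
      u_zero := hv.zero
      Du_zero := hDvz
      b_nonneg := hb0'
      b_le := fun t x => le_add_of_nonneg_right (hc0' t x)
      d_memLp := hbm.add hcm
      memL2H10 := hv.memL2H10 }
  have hdsol : IsFluxSolution Ω T (fun x => b₀' x + c₀' x) (fun t x => b' t x + c' t x)
      (fun t x => (b' t x + c' t x) • v t x) := by
    have := hbsol.add hcsol hb₀i.integrableOn hc₀i.integrableOn (hbm.integrable (by norm_num))
      (hcm.integrable (by norm_num)) (memLp_one_iff_integrable.1 (hv.memL2H10.1.smul hbm))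
      (memLp_one_iff_integrable.1 (hv.memL2H10.1.smul hcm))
    simpa only [← add_smul] using this
  refine hD.fractionsConverge hT hb₀m (hb₀m.add hc₀m) hb₀z
    (fun x hx => by simp [hb₀z x hx, hc₀z x hx]) hb₀i (hb₀i.add hc₀i) hb₀
    (fun x => le_add_of_nonneg_right (hc₀ x)) hbsol hdsol hb (fun K => (hb K).add (hc K))
    (fun K => ?_) hbw ?_ fun K => ?_
  · filter_upwards [hb0 K, hc0 K] with z h1 h2
    exact ⟨h1, le_add_of_nonneg_right h2⟩
  · exact hbw.add hcw hb hc hbm hcm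
  · have e : ∫ x in Ω, b₀ x ^ 2 / (b₀ x + c₀ x) = ∫ x in Ω, b₀' x ^ 2 / (b₀' x + c₀' x) := by
      refine integral_congr_ae ?_
      filter_upwards [hb₀e, hc₀e] with x h1 h2
      rw [h1, h2]
    have := hq K
    rw [QuotientBound, e] at this
    exact this

theorem mainTheorem2
    (Ω : Set R3) (hΩ : IsOpen Ω) (hΩb : Bornology.IsBounded Ω)
    (T : ℝ) (hT : 0 < T) (C₀ : ℝ)
    (ν : ℕ → ℝ) (hν : ∀ K, 0 ≤ ν K) (hν0 : Tendsto ν atTop (𝓝 0))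
    (ρ₀ n₀ : R3 → ℝ)
    (hρ₀ : IntegrableOn ρ₀ Ω) (hn₀ : IntegrableOn n₀ Ω)
    (hρ₀pos : ∀ᵐ x ∂(volume.restrict Ω), 0 ≤ ρ₀ x)
    (hn₀pos : ∀ᵐ x ∂(volume.restrict Ω), 0 ≤ n₀ x)
    (ρ n : ℕ → ℝ → R3 → ℝ) (Dρ Dn : ℕ → ℝ → R3 → R3)
    (u : ℕ → ℝ → R3 → R3) (Du : ℕ → ℝ → R3 → R3 →L[ℝ] R3)
    (hρ : ∀ K, MemLinfL2 Ω T (ρ K)) (hn : ∀ K, MemLinfL2 Ω T (n K))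
    (hu : ∀ K, MemL2H10 Ω T (u K) (Du K))
    (hρpos : ∀ K, ∀ᵐ z ∂(cylMeasure Ω T), 0 ≤ ρ K z.1 z.2)
    (hnpos : ∀ K, ∀ᵐ z ∂(cylMeasure Ω T), 0 ≤ n K z.1 z.2)
    (hρsol : ∀ K, IsWeakSolution Ω T (ν K) (u K) ρ₀ (ρ K) (Dρ K))
    (hnsol : ∀ K, IsWeakSolution Ω T (ν K) (u K) n₀ (n K) (Dn K))
    (hρbd : ∀ K, normLinfL2 Ω T (ρ K) ≤ ENNReal.ofReal C₀)
    (hnbd : ∀ K, normLinfL2 Ω T (n K) ≤ ENNReal.ofReal C₀)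
    (hDρbd : ∀ K, ENNReal.ofReal (Real.sqrt (ν K)) *
      eLpNorm (Function.uncurry (Dρ K)) 2 (cylMeasure Ω T) ≤ ENNReal.ofReal C₀)
    (hDnbd : ∀ K, ENNReal.ofReal (Real.sqrt (ν K)) *
      eLpNorm (Function.uncurry (Dn K)) 2 (cylMeasure Ω T) ≤ ENNReal.ofReal C₀)
    (hubd : ∀ K, eLpNorm (Function.uncurry (u K)) 2 (cylMeasure Ω T) ≤ ENNReal.ofReal C₀)
    (hDubd : ∀ K, eLpNorm (Function.uncurry (Du K)) 2 (cylMeasure Ω T) ≤ ENNReal.ofReal C₀)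
    (hquot :
      (∀ K, QuotientBound Ω T (ρ K) (fun t x => ρ K t x + n K t x)
        ρ₀ (fun x => ρ₀ x + n₀ x)) ∨
      (∀ K, QuotientBound Ω T (n K) (fun t x => ρ K t x + n K t x)
        n₀ (fun x => ρ₀ x + n₀ x))) :
    ∃ (σ : ℕ → ℕ) (ρ' n' : ℝ → R3 → ℝ) (u' : ℝ → R3 → R3) (Du' : ℝ → R3 → R3 →L[ℝ] R3),
      StrictMono σ ∧
      MemLinfL2 Ω T ρ' ∧ MemLinfL2 Ω T n' ∧ MemL2H10 Ω T u' Du' ∧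
      (∀ᵐ z ∂(cylMeasure Ω T), 0 ≤ ρ' z.1 z.2 ∧ 0 ≤ n' z.1 z.2) ∧
      TendstoWeakStar Ω T (fun K => ρ (σ K)) ρ' ∧
      TendstoWeakStar Ω T (fun K => n (σ K)) n' ∧
      TendstoWeakL2H10 Ω T (fun K => u (σ K)) (fun K => Du (σ K)) u' Du' ∧
      FractionsConverge Ω T (fun K => ρ (σ K)) (fun K t x => ρ (σ K) t x + n (σ K) t x)
        ρ' (fun t x => ρ' t x + n' t x) ∧
      FractionsConverge Ω T (fun K => n (σ K)) (fun K t x => ρ (σ K) t x + n (σ K) t x)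
        n' (fun t x => ρ' t x + n' t x) := by
  have hC : ENNReal.ofReal C₀ ≠ ⊤ := ENNReal.ofReal_ne_top
  have hρm : ∀ K, MemLp (Function.uncurry (ρ K)) 2 (cylMeasure Ω T) := fun K =>
    memLp_of_normLinfL2_le (hρ K).1 hC (hρbd K)
  have hnm : ∀ K, MemLp (Function.uncurry (n K)) 2 (cylMeasure Ω T) := fun K =>
    memLp_of_normLinfL2_le (hn K).1 hC (hnbd K)
  obtain ⟨r₀, hr₀m, hr₀z, hr₀, hr₀i, hr₀e⟩ := exists_measurable_rep_slice hΩ hρ₀ hρ₀pos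
  obtain ⟨m₀, hm₀m, hm₀z, hm₀, hm₀i, hm₀e⟩ := exists_measurable_rep_slice hΩ hn₀ hn₀pos
  -- Three successive extractions; the final subsequence is `σ₁ ∘ σ₂ ∘ σ₃`.
  obtain ⟨σ₁, ρ', hσ₁, hρ', hρ0', hρw₁⟩ := exists_boundedDensity_limit hΩ hC
    (fun K => (hρ K).1) hρbd hρpos
  obtain ⟨σ₂, n', hσ₂, hn', hn0', hnw₂⟩ := exists_boundedDensity_limit hΩ hC
    (fun K => (hn (σ₁ K)).1) (fun K => hnbd (σ₁ K)) fun K => hnpos (σ₁ K)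
  obtain ⟨σ₃, u', Du', B, hσ₃, hB, hu', hDum, hDuz, huw, hDuw⟩ := exists_boundedVelocity_limit hΩ hC
    (fun K => hu (σ₁ (σ₂ K))) (fun K => hubd (σ₁ (σ₂ K))) fun K => hDubd (σ₁ (σ₂ K))
  have hρw := (hρw₁.comp hσ₂).comp hσ₃
  have hnw := hnw₂.comp hσ₃
  set σ : ℕ → ℕ := fun K => σ₁ (σ₂ (σ₃ K)) with hσdef
  have hσ : StrictMono σ := hσ₁.comp (hσ₂.comp hσ₃)
  have hνσ : Tendsto (fun K => ν (σ K)) atTop (𝓝 0) := hν0.comp hσ.tendsto_atTop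
  have hρs : IsFluxSolution Ω T r₀ ρ' (fun t x => ρ' t x • u' t x) :=
    isFluxSolution_of_vanishing_viscosity hΩ hΩb hT hC hB (fun K => hν (σ K)) hνσ hr₀e
      (fun K => (hρ (σ K)).1) (fun K => hρbd (σ K)) (fun K => hDρbd (σ K)) (fun K => hu (σ K))
      (fun K => hubd (σ K)) (fun K => hDubd (σ K)) (fun K => hρsol (σ K)) hρ' hu' hρw huw
  have hns : IsFluxSolution Ω T m₀ n' (fun t x => n' t x • u' t x) :=
    isFluxSolution_of_vanishing_viscosity hΩ hΩb hT hC hB (fun K => hν (σ K)) hνσ hm₀e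
      (fun K => (hn (σ K)).1) (fun K => hnbd (σ K)) (fun K => hDnbd (σ K)) (fun K => hu (σ K))
      (fun K => hubd (σ K)) (fun K => hDubd (σ K)) (fun K => hnsol (σ K)) hn' hu' hnw huw
  refine ⟨σ, ρ', n', u', Du', hσ, ⟨(hρ'.memLp hC).1, hρ'.norm_le.trans_lt hC.lt_top⟩,
    ⟨(hn'.memLp hC).1, hn'.norm_le.trans_lt hC.lt_top⟩, hu'.memL2H10,
    Eventually.of_forall fun z => ⟨hρ0' _ _, hn0' _ _⟩,
    tendstoWeakStar_of_weaklyTendsto hC hρw (fun K => (hρ (σ K)).1) (hρ'.memLp hC).1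
      (fun K => hρbd (σ K)) hρ'.norm_le,
    tendstoWeakStar_of_weaklyTendsto hC hnw (fun K => (hn (σ K)).1) (hn'.memLp hC).1
      (fun K => hnbd (σ K)) hn'.norm_le,
    tendstoWeakL2H10_of_weaklyTendsto huw hDuw, ?_⟩
  -- The quotient bound is given for one component only; the other fraction follows by complement.
  rcases hquot with hq | hq
  · have h := fractionsConverge_of_quotientBound hΩ hΩb hT hC (fun K => hρm (σ K))
      (fun K => hnm (σ K)) (fun K => hρpos (σ K)) (fun K => hnpos (σ K)) hρ' hn' hρ0' hn0' hu' hDum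
      hDuz hρw hnw hr₀m hm₀m hr₀z hm₀z hr₀ hm₀ hr₀i hm₀i hr₀e hm₀e hρs hns fun K => hq (σ K)
    exact ⟨h, h.compl (fun _ _ _ => (add_sub_cancel_left _ _).symm)
      fun _ _ => (add_sub_cancel_left _ _).symm⟩
  · have h := fractionsConverge_of_quotientBound hΩ hΩb hT hC (fun K => hnm (σ K))
      (fun K => hρm (σ K)) (fun K => hnpos (σ K)) (fun K => hρpos (σ K)) hn' hρ' hn0' hρ0' hu' hDum
      hDuz hnw hρw hm₀m hr₀m hm₀z hr₀z hm₀ hr₀ hm₀i hr₀i hm₀e hr₀e hns hρs fun K => by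
        simpa only [add_comm] using hq (σ K)
    have h' : FractionsConverge Ω T (fun K => n (σ K)) (fun K t x => ρ (σ K) t x + n (σ K) t x)
        n' (fun t x => ρ' t x + n' t x) := by simpa only [add_comm] using h
    exact ⟨h'.compl (fun _ _ _ => (add_sub_cancel_right _ _).symm)
      fun _ _ => (add_sub_cancel_right _ _).symm, h'⟩
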